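/- Let $a_1,a_2,a_3$ be integers, none of which is $-1$ or a perfect square, write $\mathbf a=(a_1,a_2,a_3)$, and let $n\ge 0$ be an integer. Below $p$ denotes a prime, $\mu$ the Möbius function, $\phi$ Euler's function, $\mathrm e_q(z)=\exp(2\pi i z/q)$, and $(\frac{\cdot}{\cdot})$ the Kronecker symbol. **The factor.** For an integer $a\ne -1$ that is not a square and for positive integers $q,k$ with $k$ squarefree put $G_{a,k}=\mathbb Q(\zeta_k,a^{1/k})$ and $F_{a,q,k}=\mathbb Q(\zeta_q,\zeta_k,a^{1/k})$. For $b$ coprime to $q$ let $c_{a,q,k}(b)=1$ if the automorphism $\zeta_q\mapsto\zeta_q^b$ of $\mathbb Q(\zeta_q)$ is the identity on $\mathbb Q(\zeta_q)\cap G_{a,k}$, and $c_{a,q,k}(b)=0$ otherwise; let $S_{a,q,k}(z)=\sum_{b\in(\mathbb Z/q)^*}c_{a,q,k}(b)\,\mathrm e_q(zb)$. For $\mathbf k=(k_1,k_2,k_3)$ with squarefree $k_i$ set $$\mathfrak S_{\mathbf a,\mathbf k}(n)=\sum_{q\ge1}\Big(\prod_{i=1}^3[F_{a_i,q,k_i}:\mathbb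 Q]\Big)^{-1}\sum_{z\in(\mathbb Z/q)^*}\mathrm e_q(-nz)\prod_{i=1}^3S_{a_i,q,k_i}(z),\qquad \mathcal A_{\mathbf a}(n)=\frac12\sum_{\mathbf k\in\mathbb N^3}\mu(k_1)\mu(k_2)\mu(k_3)\,\mathfrak S_{\mathbf a,\mathbf k}(n).$$ **The densities.** Let $\Delta_a$ be the discriminant of $\mathbb Q(\sqrt a)$, let $h_a$ be the largest $m$ such that $a$ is an $m$-th power of an integer, and let $$\mathcal A_a=\prod_{p\mid h_a}\Big(1-\frac1{p-1}\Big)\prod_{p\nmid h_a}\Big(1-\frac1{p(p-1)}\Big),\qquad f_a^\ddagger(q)=\prod_{p\mid q,\,p\mid h_a}\frac1{p-2}\prod_{p\mid q,\,p\nmid h_a}\frac1{p^2-p-1},$$ $$f_a^\dagger(q)=\prod_{p\mid q,\,p\mid h_a}\Big(1-\frac1{p-1}\Big)^{-1}\prod_{p\mid q,\,p\nmid h_a}\Big(1-\frac1{p(p-1)}\Big)^{-1},\qquad \mathcal L_a=\mathcal A_a\big(1+\mu(2|\Delta_a|)f_a^\ddagger(|\Delta_a|)\big).$$ With $g=\gcd(q,\Delta_a)$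 let $\beta_a(q)=(-1)^{(\Delta_a/g-1)/2}g$ if $\Delta_a/g$ is odd and $\beta_a(q)=1$ otherwise. For integers $x$ and $q>0$ let $\mathcal A_a(x\bmod q)=\mathcal A_a\frac{f_a^\dagger(q)}{\phi(q)}\prod_{p\mid x-1,\,p\mid q}(1-\frac1p)$ if $\gcd(x-1,q,h_a)=\gcd(x,q)=1$ and $\mathcal A_a(x\bmod q)=0$ otherwise, and let (Moree's density) $$\delta_a(x\bmod q)=\mathcal A_a(x\bmod q)\Big(1+\mu\Big(\frac{2|\Delta_a|}{g}\Big)\Big(\frac{\beta_a(q)}{x}\Big)f_a^\ddagger\Big(\frac{|\Delta_a|}{g}\Big)\Big).$$ For a positive integer $d$ let $$\sigma_{\mathbf a,n}(d)=d\sum_{\substack{b_1,b_2,b_3\bmod d\\ b_1+b_2+b_3\equiv n\bmod d}}\ \prod_{i=1}^3\frac{\delta_{a_i}(b_i\bmod d)}{\mathcal L_{a_i}},\qquad \mathfrak D_{\mathbf a}=2^{\min_i\nu_2(\Delta_{a_i})-\max_i\nu_2(\Delta_{a_i})}\,\mathrm{lcm}(\Delta_{a_1},\Delta_{a_2},\Delta_{a_3})>0,$$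 where $\nu_2$ is the $2$-adic valuation. **Theorem.** The series defining $\mathfrak S_{\mathbf a,\mathbf k}(n)$ (for squarefree $k_1,k_2,k_3$) and $\mathcal A_{\mathbf a}(n)$ converge absolutely, the product below converges, and $$\mathcal A_{\mathbf a}(n)=\frac12\Big(\prod_{i=1}^3\mathcal L_{a_i}\Big)\,\sigma_{\mathbf a,n}(\mathfrak D_{\mathbf a})\prod_{p\nmid\mathfrak D_{\mathbf a}}\sigma_{\mathbf a,n}(p).$$ In particular $\mathcal A_{\mathbf a}(n)$ is real. Moreover, there is an absolute constant $C>0$ such that, for all such $\mathbf a$ and $n$ with $\mathcal A_{\mathbf a}(n)>0$, $$\mathcal A_{\mathbf a}(n)\ \ge\ C\prod_{i=1}^3\frac{\phi(h_{a_i})}{|\Delta_{a_i}|^2\,h_{a_i}}.$$ -/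

import Mathlib

open scoped BigOperators

noncomputable section

namespace ArtinGoldbach

/-! ### Invariants of `a` -/

/-- The field `ℚ(√a)`, as a subfield of `ℂ`. -/
def quadField (a : ℤ) : IntermediateField ℚ ℂ :=
  IntermediateField.adjoin ℚ {x : ℂ | x ^ 2 = (a : ℂ)}

instance quadField_numberField (a : ℤ) : NumberField (quadField a) where
  to_charZero := inferInstance
  to_finiteDimensional := by
    have hfin : Set.Finite {x : ℂ | x ^ 2 = (a : ℂ)} := by
      have h0 : (Polynomial.X ^ 2 - Polynomial.C (a : ℂ)) ≠ 0 :=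
        Polynomial.X_pow_sub_C_ne_zero two_pos _
      refine ((Polynomial.X ^ 2 - Polynomial.C (a : ℂ)).roots.toFinset.finite_toSet).subset ?_
      intro x hx
      have hx' : x ^ 2 = (a : ℂ) := hx
      rw [Finset.mem_coe, Multiset.mem_toFinset, Polynomial.mem_roots h0]
      simp only [Polynomial.IsRoot, Polynomial.eval_sub, Polynomial.eval_pow, Polynomial.eval_X,
        Polynomial.eval_C, hx', sub_self]
    have : Finite {x : ℂ | x ^ 2 = (a : ℂ)} := hfin
    refine IntermediateField.finiteDimensional_adjoin (K := ℚ) ?_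
    intro x hx
    have hx' : x ^ 2 = (a : ℂ) := hx
    refine IsIntegral.of_pow two_pos ?_
    rw [hx']
    have h := isIntegral_algebraMap (R := ℚ) (A := ℂ) (x := (a : ℚ))
    simpa using h

/-- `Δ_a`, the discriminant of `ℚ(√a)`. -/
def disc (a : ℤ) : ℤ := NumberField.discr (quadField a)

/-- `h_a`, the largest `m` such that `a` is an `m`-th power of an integer. -/
def powIndex (a : ℤ) : ℕ := sSup {m : ℕ | ∃ b : ℤ, b ^ m = a}

/-- `𝒜_a = ∏_{p ∣ h_a} (1 - 1/(p-1)) ∏_{p ∤ h_a} (1 - 1/(p(p-1)))`. -/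
def artinA (a : ℤ) : ℝ :=
  (∏ p ∈ (powIndex a).primeFactors, (1 - 1 / ((p : ℝ) - 1))) *
    ∏' p : {p : ℕ // p.Prime ∧ ¬ p ∣ powIndex a},
      (1 - 1 / (((p : ℕ) : ℝ) * (((p : ℕ) : ℝ) - 1)))

/-- `f_a^‡(q) = ∏_{p ∣ q, p ∣ h_a} (p-2)⁻¹ ∏_{p ∣ q, p ∤ h_a} (p²-p-1)⁻¹`. -/
def fDDagger (a : ℤ) (q : ℕ) : ℝ :=
  (∏ p ∈ q.primeFactors with p ∣ powIndex a, ((p : ℝ) - 2)⁻¹) *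
    ∏ p ∈ q.primeFactors with ¬ p ∣ powIndex a, ((p : ℝ) ^ 2 - p - 1)⁻¹

/-- `f_a^†(q) = ∏_{p ∣ q, p ∣ h_a} (1-1/(p-1))⁻¹ ∏_{p ∣ q, p ∤ h_a} (1-1/(p(p-1)))⁻¹`. -/
def fDagger (a : ℤ) (q : ℕ) : ℝ :=
  (∏ p ∈ q.primeFactors with p ∣ powIndex a, (1 - 1 / ((p : ℝ) - 1))⁻¹) *
    ∏ p ∈ q.primeFactors with ¬ p ∣ powIndex a, (1 - 1 / ((p : ℝ) * ((p : ℝ) - 1)))⁻¹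

/-- `ℒ_a = 𝒜_a (1 + μ(2|Δ_a|) f_a^‡(|Δ_a|))`, Artin's constant for `a`. -/
def artinL (a : ℤ) : ℝ :=
  artinA a *
    (1 + (ArithmeticFunction.moebius (2 * (disc a).natAbs) : ℝ) * fDDagger a (disc a).natAbs)

/-! ### Moree's densities -/

/-- The Kronecker symbol `(D / x)`: `(D / 0)` is `1` if `D = ±1` and `0` otherwise; for
`x = u · 2^e · m` with `u = ±1` and `m > 0` odd it is `(D / u) (D / 2)^e (D / m)`, where
`(D / 1) = 1`, `(D / -1)` is the sign of `D` (with `(0 / -1) = 1`), `(D / 2)` is `0` for even `D`,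
`1` for `D ≡ ±1 mod 8`, `-1` for `D ≡ ±3 mod 8`, and `(D / m)` is the Jacobi symbol. -/
def kronecker (D x : ℤ) : ℤ :=
  if x = 0 then (if D.natAbs = 1 then 1 else 0)
  else
    (if x < 0 ∧ D < 0 then -1 else 1) *
      (if D % 2 = 0 then 0 else if D % 8 = 1 ∨ D % 8 = 7 then 1 else -1) ^
        (x.natAbs.factorization 2) *
      jacobiSym D (x.natAbs / 2 ^ (x.natAbs.factorization 2))

/-- `β_a(q) = (-1)^((Δ_a/g - 1)/2) · g` with `g = gcd(q, Δ_a)` if `Δ_a/g` is odd, and `1` otherwise.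
For odd `t` the sign `(-1)^((t-1)/2)` is `1` if `t ≡ 1 mod 4` and `-1` if `t ≡ 3 mod 4`. -/
def betaDisc (a : ℤ) (q : ℕ) : ℤ :=
  let g : ℤ := (Int.gcd q (disc a) : ℤ)
  let t : ℤ := disc a / g
  if t % 2 = 1 then (if t % 4 = 1 then 1 else -1) * g else 1

/-- `𝒜_a(x mod q)`. -/
def artinAMod (a x : ℤ) (q : ℕ) : ℝ :=
  artinA a *
    if Nat.gcd (Int.gcd (x - 1) q) (powIndex a) = 1 ∧ Int.gcd x q = 1 then
      fDagger a q / (Nat.totient q : ℝ) *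
        ∏ p ∈ q.primeFactors with ((p : ℕ) : ℤ) ∣ x - 1, (1 - 1 / (p : ℝ))
    else 0

/-- `δ_a(x mod q)`, Moree's density of the primes `p ≡ x mod q` with primitive root `a`. -/
def moreeDelta (a x : ℤ) (q : ℕ) : ℝ :=
  artinAMod a x q *
    (1 +
      (ArithmeticFunction.moebius
        (2 * (disc a).natAbs / Nat.gcd q (disc a).natAbs) : ℝ) *
      (kronecker (betaDisc a q) x : ℝ) *
      fDDagger a ((disc a).natAbs / Nat.gcd q (disc a).natAbs))

/-! ### The local densities -/

/-- `σ_{a,n}(d) = d ∑_{b₁+b₂+b₃ ≡ n mod d} ∏ᵢ δ_{aᵢ}(bᵢ mod d) / ℒ_{aᵢ}`; the residue classes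
modulo `d` are represented by `0, …, d-1`. -/
def localDensity (a : Fin 3 → ℤ) (n d : ℕ) : ℝ :=
  (d : ℝ) *
    ∑ b ∈ Fintype.piFinset (fun _ : Fin 3 => Finset.range d) with (∑ i, b i) ≡ n [MOD d],
      ∏ i, moreeDelta (a i) (b i) d / artinL (a i)

/-- `min {ν₂(Δ_{aᵢ})}`. -/
def minVal2 (a : Fin 3 → ℤ) : ℕ :=
  Finset.univ.inf' Finset.univ_nonempty fun i => padicValInt 2 (disc (a i))

/-- `max {ν₂(Δ_{aᵢ})}`. -/
def maxVal2 (a : Fin 3 → ℤ) : ℕ :=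
  Finset.univ.sup' Finset.univ_nonempty fun i => padicValInt 2 (disc (a i))

/-- `𝔇_a = 2^(min ν₂(Δ_{aᵢ}) - max ν₂(Δ_{aᵢ})) · [Δ_{a₁}, Δ_{a₂}, Δ_{a₃}]`. The division is exact,
since `2^(max ν₂(Δ_{aᵢ}))` divides the least common multiple. -/
def badModulus (a : Fin 3 → ℤ) : ℕ :=
  (Finset.univ.lcm fun i => (disc (a i)).natAbs) / 2 ^ (maxVal2 a - minVal2 a)

/-! ### The singular series and the factor `𝒜_a(n)` -/

/-- `ℚ(ζ_q)` as a subfield of `ℂ`. -/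
def cycloField (q : ℕ) : IntermediateField ℚ ℂ :=
  IntermediateField.adjoin ℚ {x : ℂ | x ^ q = 1}

/-- `G_{a,k} = ℚ(ζ_k, a^{1/k})` as a subfield of `ℂ`; it contains all `k`-th roots of `a`. -/
def kummerField (a : ℤ) (k : ℕ) : IntermediateField ℚ ℂ :=
  IntermediateField.adjoin ℚ {x : ℂ | x ^ k = 1 ∨ x ^ k = (a : ℂ)}

/-- `F_{a,q,k} = ℚ(ζ_q, ζ_k, a^{1/k})`. -/
def compField (a : ℤ) (q k : ℕ) : IntermediateField ℚ ℂ :=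
  cycloField q ⊔ kummerField a k

/-- The restriction of `σ_b : ζ_q ↦ ζ_q^b` to `ℚ(ζ_q) ∩ G_{a,k}` is the identity. -/
def FixesIntersection (a : ℤ) (q k : ℕ) (b : (ZMod q)ˣ) : Prop :=
  ∃ σ : cycloField q ≃ₐ[ℚ] cycloField q,
    (∀ ζ : cycloField q, ζ ^ q = 1 → σ ζ = ζ ^ (b : ZMod q).val) ∧
      ∀ x : cycloField q, (x : ℂ) ∈ kummerField a k → σ x = x

open Classical in
/-- `c_{a,q,k}(b)`. -/
def cInd (a : ℤ) (q k : ℕ) (b : (ZMod q)ˣ) : ℂ :=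
  if FixesIntersection a q k b then 1 else 0

/-- `S_{a,q,k}(z) = ∑_{b ∈ (ℤ/q)ˣ} c_{a,q,k}(b) e_q(zb)`; `ZMod.stdAddChar` on `ℤ/q` is
`z ↦ exp(2πiz/q)`. -/
def expSum (a : ℤ) (q k : ℕ) [NeZero q] (z : ZMod q) : ℂ :=
  ∑ b : (ZMod q)ˣ, cInd a q k b * ZMod.stdAddChar (z * (b : ZMod q))

/-- `L_{a,q,k}(z) = ∏ᵢ S_{aᵢ,q,kᵢ}(z)`. -/
def expSumProd (a : Fin 3 → ℤ) (q : ℕ) [NeZero q] (k : Fin 3 → ℕ+) (z : ZMod q) : ℂ :=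
  ∏ i, expSum (a i) q (k i) z

/-- `d_{a,k}(q) = ∏ᵢ [F_{aᵢ,q,kᵢ} : ℚ]`. -/
def degProd (a : Fin 3 → ℤ) (k : Fin 3 → ℕ+) (q : ℕ) : ℕ :=
  ∏ i, Module.finrank ℚ (compField (a i) q (k i))

/-- The `q`-th term of the singular series `𝔖_{a,k}(n)`. -/
def singTerm (a : Fin 3 → ℤ) (k : Fin 3 → ℕ+) (n : ℕ) (q : ℕ+) : ℂ :=
  (1 / (degProd a k q : ℂ)) *
    ∑ z : (ZMod (q : ℕ))ˣ,
      ZMod.stdAddChar (-(n : ZMod (q : ℕ)) * (z : ZMod (q : ℕ))) *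
        expSumProd a (q : ℕ) k (z : ZMod (q : ℕ))

/-- The singular series `𝔖_{a,k}(n)`, for squarefree `k₁, k₂, k₃`. -/
def singSeries (a : Fin 3 → ℤ) (k : Fin 3 → ℕ+) (n : ℕ) : ℂ :=
  ∑' q : ℕ+, singTerm a k n q

/-- `μ(k₁) μ(k₂) μ(k₃) 𝔖_{a,k}(n)`. -/
def factorTerm (a : Fin 3 → ℤ) (n : ℕ) (k : Fin 3 → ℕ+) : ℂ :=
  (∏ i, (ArithmeticFunction.moebius (k i : ℕ) : ℂ)) * singSeries a k n

/-- The factor `𝒜_a(n) = ½ ∑_k μ(k₁) μ(k₂) μ(k₃) 𝔖_{a,k}(n)`. -/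
def artinFactor (a : Fin 3 → ℤ) (n : ℕ) : ℂ :=
  (1 / 2) * ∑' k : Fin 3 → ℕ+, factorTerm a n k

end ArtinGoldbach

end

noncomputable section

namespace ArtinGoldbach

/-! ### Galois theory of the fields ℚ(ζ_q), ℚ(ζ_k, a^{1/k}) and their composita. -/

section

open Polynomial IntermediateField

/-! ### Automorphisms of `ℂ` -/

/-! Galois groups are replaced throughout by automorphisms of ℂ, which act on the q-th roots of
unity through the cyclotomic character `cyc`. The classes b with c_{a,q,k}(b) = 1 form the image H
of the automorphisms fixing G_{a,k} (`fixesIntersection_iff`), and |H|·[G:ℚ] = [F:ℚ]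
(`card_kummerSubgroup_mul_finrank`). So S_{a,q,k}(z)/[F:ℚ] is 1/[G:ℚ] times the mean of e_q(zb) over
H. These subgroups are compatible with reduction, hence the normalized sum depends only on the
fraction z/q (`normSum_eq_of_dvd`).

For an odd prime p ∤ h_a no p-th root of a is cyclotomic, so besides ζ_k the only entanglement of
G_{a,k} with cyclotomic fields is √a ∈ ℚ(ζ_{|Δ_a|}), on which Galois acts by the Kronecker symbol of
Δ_a (`exists_sqrt_kronecker`). In particular H contains every b ≡ 1 modulo gcd(q, lcm(k, |Δ_a|)).
Cancellation over this subgroup bounds the normalized sums well enough for absolute convergence over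
q and k together (`norm_singTerm_le`). It also makes them vanish when some p² divides q and the
exponent of p in q exceeds the one in Δ_a (`normSum_eq_zero`).

After interchanging the sums, 𝒜(n) is half the sum, over fractions z/q in lowest terms, of e_q(-nz)
∏ D_i(z/q), where D_a sums μ(k)S_{a,q,k}(z)/[F:ℚ] over k. Modulo d with `IsSaturated a d`, that sum
is an Euler product, and D_a is the Fourier transform of Moree's density modulo d
(`densityFourier_eq`). The part of the series with q ∣ d is then, by orthogonality, d times a count
of b₁+b₂+b₃ ≡ n weighted by δ_{a_i}(b_i mod d), that is ∏ℒ_{a_i}·σ(d).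

Every multiple of 𝔇 is saturated for all three a_i, and a term survives only if q divides 𝔇 times a
product of distinct primes not dividing 𝔇. These moduli exhaust the series; multiplicativity of the
densities (`densitySum_mul`) turns the partial sums into partial products
(`tendsto_prod_localDensity`).

For the lower bound, σ(p) = 1 + O(p⁻²), a nonzero σ(p) at a prime p ∤ 𝔇 is at least p⁻², a nonzero
main factor is at least ∏𝒜_{a_i}/𝔇², and 𝒜_a ≫ φ(h_a)/h_a. All constants are absolute. -/

/-- Automorphisms of the relative algebraic closure extend to `ℂ`. -/
theorem exists_complex_aut_extending {K : Type} [Field K] [Algebra K ℂ]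
    (g : algebraicClosure K ℂ ≃ₐ[K] algebraicClosure K ℂ) :
    ∃ τ : ℂ ≃ₐ[K] ℂ, ∀ x : algebraicClosure K ℂ, τ x = g x := by
  obtain ⟨s, hs⟩ := exists_isTranscendenceBasis (algebraicClosure K ℂ) ℂ
  let := IsAlgClosed.isAlgClosure_of_transcendence_basis _ hs
  let A := Algebra.adjoin (algebraicClosure K ℂ) (Set.range (Subtype.val : s → ℂ))
  -- `A` is a polynomial ring on a transcendence basis over the relative algebraic closure. Let `g`
  -- act on coefficients; ℂ is an algebraic closure of `A`, so the action extends to ℂ.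
  let e : A ≃+* A := (hs.1.aevalEquiv.symm.toRingEquiv.trans
    (MvPolynomial.mapEquiv s g.toRingEquiv)).trans hs.1.aevalEquiv.toRingEquiv
  have he : ∀ x : algebraicClosure K ℂ, e (algebraMap _ A x) = algebraMap _ A (g x) := by
    intro x
    simp only [e, RingEquiv.trans_apply, AlgEquiv.coe_ringEquiv]
    rw [AlgEquiv.commutes]
    rw [MvPolynomial.mapEquiv_apply, MvPolynomial.algebraMap_eq, MvPolynomial.map_C]
    rw [← MvPolynomial.algebraMap_eq]
    exact AlgEquiv.commutes hs.1.aevalEquiv (g x)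
  let t : ℂ ≃+* ℂ := IsAlgClosure.equivOfEquiv ℂ ℂ e
  have ht : ∀ x : algebraicClosure K ℂ, t x = g x := by
    intro x
    have h := IsAlgClosure.equivOfEquiv_algebraMap ℂ ℂ e (algebraMap _ A x)
    rw [he] at h
    exact h
  refine ⟨AlgEquiv.ofRingEquiv (f := t) fun r => ?_, ht⟩
  have := ht (algebraMap K _ r)
  rw [AlgEquiv.commutes] at this
  exact this

/-- The relative algebraic closure is normal, so conjugate elements are exchanged by one of its
automorphisms, which extends to ℂ. Automorphisms with a prescribed value are produced this way
below. -/
theorem exists_complex_aut_of_aeval_minpoly {K : Type} [Field K] [Algebra K ℂ] {x y : ℂ}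
    (hx : IsIntegral K x) (hy : aeval y (minpoly K x) = 0) : ∃ τ : ℂ ≃ₐ[K] ℂ, τ x = y := by
  have hyi : IsIntegral K y := ⟨minpoly K x, minpoly.monic hx, by rwa [← aeval_def]⟩
  have hm : minpoly K x = minpoly K y :=
    minpoly.eq_of_irreducible_of_monic (minpoly.irreducible hx) hy (minpoly.monic hx)
  let x' : algebraicClosure K ℂ := ⟨x, hx⟩
  let y' : algebraicClosure K ℂ := ⟨y, hyi⟩
  have hc : IsConjRoot K y' x' := by
    unfold IsConjRoot
    rw [← minpoly.algebraMap_eq (algebraMap (algebraicClosure K ℂ) ℂ).injective y',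
      ← minpoly.algebraMap_eq (algebraMap (algebraicClosure K ℂ) ℂ).injective x']
    exact hm.symm
  have : IsAlgClosure K (algebraicClosure K ℂ) := inferInstance
  have : Normal K (algebraicClosure K ℂ) := IsAlgClosure.normal K _
  obtain ⟨g, hg⟩ := hc.exists_algEquiv
  obtain ⟨τ, hτ⟩ := exists_complex_aut_extending g
  exact ⟨τ, by simpa [x', y', hg] using hτ x'⟩

/-- Each root of the minimal polynomial of x over K is an image of x under an automorphism fixing K,
hence equals x. By separability the polynomial is linear. -/
theorem mem_of_forall_aut_fixed {K : IntermediateField ℚ ℂ} {x : ℂ} (hx : IsIntegral ℚ x)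
    (h : ∀ τ : ℂ ≃ₐ[ℚ] ℂ, (∀ y ∈ K, τ y = y) → τ x = x) : x ∈ K := by
  have hxK : IsIntegral K x := hx.tower_top
  have hroots : ∀ y ∈ (minpoly K x).aroots ℂ, y = x := by
    intro y hy
    rw [mem_aroots] at hy
    obtain ⟨τ, hτ⟩ := exists_complex_aut_of_aeval_minpoly hxK hy.2
    rw [← hτ]
    have := h (τ.restrictScalars ℚ) fun z hz => τ.commutes ⟨z, hz⟩
    exact this
  have hnd : ((minpoly K x).aroots ℂ).Nodup :=
    nodup_aroots_iff_of_splits (minpoly.ne_zero hxK) (IsAlgClosed.splits _) |>.2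
      (minpoly.irreducible hxK).separable
  have hcard : ((minpoly K x).aroots ℂ).card ≤ 1 := by
    rw [← Multiset.toFinset_card_of_nodup hnd]
    refine Finset.card_le_one.2 fun u hu v hv => ?_
    rw [hroots u (by simpa using hu), hroots v (by simpa using hv)]
  rw [IsAlgClosed.card_aroots_eq_natDegree] at hcard
  have hmem : x ∈ (algebraMap K ℂ).range := by
    refine minpoly.natDegree_eq_one_iff.1 (le_antisymm hcard ?_)
    exact minpoly.natDegree_pos hxK
  obtain ⟨y, rfl⟩ := hmem
  exact y.2

/-! ### The cyclotomic character -/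

/-- The action of an automorphism of `ℂ` on the `q`-th roots of unity. -/
def cyc (q : ℕ) [NeZero q] : (ℂ ≃ₐ[ℚ] ℂ) →* (ZMod q)ˣ :=
  (modularCyclotomicCharacter ℂ (Complex.card_rootsOfUnity q)).comp
    { toFun := fun τ => (τ : ℂ ≃+* ℂ), map_one' := rfl, map_mul' := fun _ _ => rfl }

theorem cyc_spec {q : ℕ} [NeZero q] (τ : ℂ ≃ₐ[ℚ] ℂ) {ζ : ℂ} (hζ : ζ ^ q = 1) :
    τ ζ = ζ ^ (cyc q τ : ZMod q).val := by
  have h0 : ζ ≠ 0 := by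
    rintro rfl
    simp [NeZero.ne q] at hζ
  have := modularCyclotomicCharacter.spec ℂ (Complex.card_rootsOfUnity q) (τ : ℂ ≃+* ℂ)
    (t := Units.mk0 ζ h0) (by rw [mem_rootsOfUnity]; ext; simpa using hζ)
  exact this

theorem pow_eq_pow_of_natCast_eq {q : ℕ} {ζ : ℂ} (hζ : ζ ^ q = 1) {m n : ℕ}
    (h : (m : ZMod q) = n) : ζ ^ m = ζ ^ n := by
  rw [ZMod.natCast_eq_natCast_iff] at h
  exact pow_eq_pow_of_modEq h hζ

theorem cyc_eq_iff {q : ℕ} [NeZero q] (τ : ℂ ≃ₐ[ℚ] ℂ) (n : ℕ) :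
    (cyc q τ : ZMod q) = n ↔ ∀ ζ : ℂ, ζ ^ q = 1 → τ ζ = ζ ^ n := by
  constructor
  · intro h ζ hζ
    rw [cyc_spec τ hζ]
    exact pow_eq_pow_of_natCast_eq hζ (by rw [ZMod.natCast_zmod_val, h])
  · intro h
    have hp := Complex.isPrimitiveRoot_exp q (NeZero.ne q)
    have h1 := h _ hp.pow_eq_one
    rw [cyc_spec τ hp.pow_eq_one] at h1
    have := (hp.isOfFinOrder (NeZero.ne q)).pow_inj_mod.1 h1
    rw [← hp.eq_orderOf] at this
    rw [← ZMod.natCast_zmod_val (cyc q τ : ZMod q), ZMod.natCast_eq_natCast_iff]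
    exact this

theorem cyc_surjective (q : ℕ) [NeZero q] : Function.Surjective (cyc q) := by
  intro b
  have hp := Complex.isPrimitiveRoot_exp q (NeZero.ne q)
  have hco : ((b : ZMod q).val).Coprime q := ZMod.val_coe_unit_coprime b
  obtain ⟨τ, hτ⟩ := exists_complex_aut_of_aeval_minpoly (K := ℚ)
    (x := Complex.exp (2 * Real.pi * Complex.I / q))
    (y := Complex.exp (2 * Real.pi * Complex.I / q) ^ (b : ZMod q).val)
    (hp.isIntegral (NeZero.pos q)).tower_top (by
      rw [← cyclotomic_eq_minpoly_rat hp (NeZero.pos q), aeval_def, eval₂_eq_eval_map,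
        map_cyclotomic]
      exact (isRoot_cyclotomic_iff.2 (hp.pow_of_coprime _ hco)))
  refine ⟨τ, Units.ext ?_⟩
  rw [← ZMod.natCast_zmod_val (b : ZMod q), cyc_eq_iff]
  intro ζ hζ
  obtain ⟨i, -, rfl⟩ := hp.eq_pow_of_pow_eq_one hζ
  rw [map_pow, hτ, ← pow_mul, ← pow_mul, mul_comm i]

theorem unitsMap_cyc {q d : ℕ} [NeZero q] [NeZero d] (h : q ∣ d) (τ : ℂ ≃ₐ[ℚ] ℂ) :
    ZMod.unitsMap h (cyc d τ) = cyc q τ := by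
  refine Units.ext ?_
  have h1 : ((ZMod.unitsMap h (cyc d τ) : (ZMod q)ˣ) : ZMod q) =
      (((cyc d τ : ZMod d).val : ℕ) : ZMod q) := by
    rw [ZMod.unitsMap_def, Units.coe_map]
    exact ZMod.cast_eq_val _
  rw [h1, eq_comm, cyc_eq_iff]
  intro ζ hζ
  obtain ⟨c, rfl⟩ := h
  exact cyc_spec τ (by rw [pow_mul, hζ, one_pow])

/-! ### The subgroup cut out by the Kummer field -/

/-- The residue classes by which automorphisms fixing `ℚ(ζ_k, a^{1/k})` act on the `q`-th roots
of unity. -/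
def kummerSubgroup (a : ℤ) (q k : ℕ) [NeZero q] : Subgroup (ZMod q)ˣ :=
  (kummerField a k).fixingSubgroup.map (cyc q)

theorem mem_kummerSubgroup {a : ℤ} {q k : ℕ} [NeZero q] {b : (ZMod q)ˣ} :
    b ∈ kummerSubgroup a q k ↔
      ∃ τ : ℂ ≃ₐ[ℚ] ℂ, (∀ x ∈ kummerField a k, τ x = x) ∧ cyc q τ = b := by
  simp [kummerSubgroup, Subgroup.mem_map, IntermediateField.mem_fixingSubgroup_iff]

/-- Both sides are images of one group of automorphisms of ℂ, so no lifting is needed. -/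
theorem kummerSubgroup_map {a : ℤ} {q d k : ℕ} [NeZero q] [NeZero d] (h : q ∣ d) :
    (kummerSubgroup a d k).map (ZMod.unitsMap h) = kummerSubgroup a q k := by
  ext b
  simp only [Subgroup.mem_map, mem_kummerSubgroup]
  constructor
  · rintro ⟨c, ⟨τ, hτ, rfl⟩, rfl⟩
    exact ⟨τ, hτ, (unitsMap_cyc h τ).symm⟩
  · rintro ⟨τ, hτ, rfl⟩
    exact ⟨_, ⟨τ, hτ, rfl⟩, unitsMap_cyc h τ⟩

theorem isIntegral_of_pow_eq_intCast {x : ℂ} {n : ℕ} (hn : 0 < n) {a : ℤ} (h : x ^ n = a) :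
    IsIntegral ℚ x := by
  refine IsIntegral.of_pow hn ?_
  rw [h]
  simpa using isIntegral_algebraMap (R := ℚ) (A := ℂ) (x := (a : ℚ))

theorem isIntegral_of_pow_eq_one {x : ℂ} {n : ℕ} (hn : 0 < n) (h : x ^ n = 1) :
    IsIntegral ℚ x := isIntegral_of_pow_eq_intCast (a := 1) hn (by simpa using h)

theorem finite_pow_eq {n : ℕ} (hn : 0 < n) (a : ℂ) : {x : ℂ | x ^ n = a}.Finite := by
  refine ((nthRoots n a).toFinset.finite_toSet).subset fun x hx => ?_
  simpa [mem_nthRoots hn] using hx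

instance cycloField_finite (q : ℕ) [NeZero q] : FiniteDimensional ℚ (cycloField q) := by
  have : Finite {x : ℂ | x ^ q = 1} := finite_pow_eq (NeZero.pos q) 1
  exact finiteDimensional_adjoin fun x hx => isIntegral_of_pow_eq_one (NeZero.pos q) hx

instance kummerField_finite (a : ℤ) (k : ℕ) [NeZero k] :
    FiniteDimensional ℚ (kummerField a k) := by
  have : Finite {x : ℂ | x ^ k = 1 ∨ x ^ k = (a : ℂ)} :=
    (finite_pow_eq (NeZero.pos k) 1).union (finite_pow_eq (NeZero.pos k) a)
  exact finiteDimensional_adjoin fun x hx => hx.elim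
    (isIntegral_of_pow_eq_one (NeZero.pos k)) (isIntegral_of_pow_eq_intCast (NeZero.pos k))

theorem aut_eq_of_adjoin {S : Set ℂ} {σ τ : ℂ ≃ₐ[ℚ] ℂ} (h : ∀ x ∈ S, σ x = τ x) {y : ℂ}
    (hy : y ∈ adjoin ℚ S) : σ y = τ y := by
  induction hy using adjoin_induction with
  | mem x hx => exact h x hx
  | algebraMap x => rw [AlgEquiv.commutes, AlgEquiv.commutes]
  | add x y _ _ hx hy => rw [map_add, map_add, hx, hy]
  | inv x _ hx => rw [map_inv₀, map_inv₀, hx]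
  | mul x y _ _ hx hy => rw [map_mul, map_mul, hx, hy]

theorem aut_eq_on_cycloField {q : ℕ} [NeZero q] {σ τ : ℂ ≃ₐ[ℚ] ℂ} (h : cyc q σ = cyc q τ) {y : ℂ}
    (hy : y ∈ cycloField q) : σ y = τ y :=
  aut_eq_of_adjoin (fun x hx => by rw [cyc_spec σ hx, cyc_spec τ hx, h]) hy

theorem aut_mem_cycloField {q : ℕ} (τ : ℂ ≃ₐ[ℚ] ℂ) {y : ℂ} (hy : y ∈ cycloField q) :
    τ y ∈ cycloField q := by
  have : (cycloField q).map τ.toAlgHom ≤ cycloField q := by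
    rw [cycloField, adjoin_map]
    refine adjoin.mono _ _ _ ?_
    rintro _ ⟨x, hx, rfl⟩
    have hx' : x ^ q = 1 := hx
    change (τ x) ^ q = 1
    rw [← map_pow, hx', map_one]
  exact this ⟨y, hy, rfl⟩

/-- The restriction of an automorphism of `ℂ` to `ℚ(ζ_q)`. -/
def cycloRestrict (q : ℕ) [NeZero q] (τ : ℂ ≃ₐ[ℚ] ℂ) : cycloField q ≃ₐ[ℚ] cycloField q :=
  AlgEquiv.ofBijective
    ((τ.toAlgHom.comp (cycloField q).val).codRestrict (cycloField q).toSubalgebra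
      fun x => aut_mem_cycloField τ x.2 : cycloField q →ₐ[ℚ] cycloField q) (AlgHom.bijective _)

theorem coe_cycloRestrict {q : ℕ} [NeZero q] (τ : ℂ ≃ₐ[ℚ] ℂ) (x : cycloField q) :
    (cycloRestrict q τ x : ℂ) = τ x := rfl

theorem isPrimitiveRoot_exp_mem_cycloField (q : ℕ) [NeZero q] :
    Complex.exp (2 * Real.pi * Complex.I / q) ∈ cycloField q :=
  subset_adjoin ℚ _ (Complex.isPrimitiveRoot_exp q (NeZero.ne q)).pow_eq_one

/-- The roots of the minimal polynomial are themselves q-th roots of unity, so automorphisms trivial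
on ℚ(ζ_q) fix its coefficients. These therefore lie in K ∩ ℚ(ζ_q), the field that occurs in
`FixesIntersection`. -/
theorem coeff_minpoly_mem_cycloField {K : IntermediateField ℚ ℂ} [FiniteDimensional ℚ K]
    {q : ℕ} [NeZero q] {ζ : ℂ} (hζ : ζ ^ q = 1) (i : ℕ) :
    ((minpoly K ζ).coeff i : ℂ) ∈ cycloField q := by
  have hi : IsIntegral K ζ := (isIntegral_of_pow_eq_one (NeZero.pos q) hζ).tower_top
  refine mem_of_forall_aut_fixed ?_ fun τ hτ => ?_
  · exact (IsIntegral.of_finite ℚ ((minpoly K ζ).coeff i)).map (algebraMap K ℂ).toRatAlgHom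
  · have hprod : ((minpoly K ζ).map (algebraMap K ℂ)).map (τ : ℂ →+* ℂ) =
        (minpoly K ζ).map (algebraMap K ℂ) := by
      have hs := (IsAlgClosed.splits ((minpoly K ζ).map (algebraMap K ℂ)))
      have hm := (minpoly.monic hi).map (algebraMap K ℂ)
      rw [hs.eq_prod_roots_of_monic hm, Polynomial.map_multiset_prod, Multiset.map_map]
      congr 1
      refine Multiset.map_congr rfl fun r hr => ?_
      have hr0 : aeval r (minpoly K ζ) = 0 := by
        have := (mem_roots'.1 hr).2
        rwa [IsRoot, eval_map_algebraMap] at this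
      have hdvd : minpoly K ζ ∣ X ^ q - 1 := minpoly.dvd _ _ (by simp [hζ])
      have hrq : r ^ q = 1 := by
        have := aeval_eq_zero_of_dvd_aeval_eq_zero hdvd hr0
        simpa [sub_eq_zero] using this
      have : τ r = r := hτ r (subset_adjoin ℚ _ hrq)
      simp [this]
    have := congrArg (fun P => coeff P i) hprod
    simpa using this

/-- An automorphism of ℚ(ζ_q) trivial on the intersection preserves the minimal polynomial of ζ_q
over G_{a,k}, whose coefficients lie there. Hence ζ_q^b is another root, and some automorphism over
G_{a,k} carries ζ_q to it. -/
theorem fixesIntersection_iff {a : ℤ} {q k : ℕ} [NeZero q] [NeZero k] {b : (ZMod q)ˣ} :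
    FixesIntersection a q k b ↔ b ∈ kummerSubgroup a q k := by
  rw [mem_kummerSubgroup]
  constructor
  · rintro ⟨σ, h1, h2⟩
    set ζ : ℂ := Complex.exp (2 * Real.pi * Complex.I / q)
    have hp : IsPrimitiveRoot ζ q := Complex.isPrimitiveRoot_exp q (NeZero.ne q)
    let z : cycloField q := ⟨ζ, isPrimitiveRoot_exp_mem_cycloField q⟩
    have hz : z ^ q = 1 := Subtype.ext hp.pow_eq_one
    have hi : IsIntegral (kummerField a k) ζ :=
      (isIntegral_of_pow_eq_one (NeZero.pos q) hp.pow_eq_one).tower_top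
    obtain ⟨τ, hτ⟩ := exists_complex_aut_of_aeval_minpoly (K := kummerField a k)
      (x := ζ) (y := ζ ^ (b : ZMod q).val) hi (by
        have h0 := minpoly.aeval (kummerField a k) ζ
        rw [aeval_eq_sum_range] at h0 ⊢
        have h3 : ∑ i ∈ Finset.range ((minpoly (kummerField a k) ζ).natDegree + 1),
            (⟨_, coeff_minpoly_mem_cycloField (K := kummerField a k) hp.pow_eq_one i⟩ :
              cycloField q) * z ^ i = 0 := by
          refine Subtype.ext ?_
          rw [AddSubmonoidClass.coe_finsetSum]
          exact h0
        have h4 := congrArg σ h3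
        rw [map_sum, map_zero] at h4
        have h5 := congrArg (Subtype.val) h4
        rw [AddSubmonoidClass.coe_finsetSum] at h5
        refine Eq.trans (Finset.sum_congr rfl fun i _ => ?_) h5
        rw [map_mul, map_pow, h1 z hz, h2 _ (SetLike.coe_mem _)]
        rfl)
    refine ⟨τ.restrictScalars ℚ, fun x hx => τ.commutes ⟨x, hx⟩, Units.ext ?_⟩
    rw [← ZMod.natCast_zmod_val (b : ZMod q), cyc_eq_iff]
    intro w hw
    obtain ⟨i, -, rfl⟩ := hp.eq_pow_of_pow_eq_one hw
    rw [map_pow]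
    change (τ ζ) ^ i = _
    rw [hτ, ← pow_mul, ← pow_mul, mul_comm i]
  · rintro ⟨τ, hτ, rfl⟩
    refine ⟨cycloRestrict q τ, fun ζ hζ => Subtype.ext ?_, fun x hx => Subtype.ext ?_⟩
    · rw [coe_cycloRestrict, cyc_spec τ (by exact_mod_cast congrArg Subtype.val hζ)]
      rfl
    · rw [coe_cycloRestrict, hτ _ hx]

/-- Since F = G(ζ_q), the degree [F:G] counts the conjugates of ζ_q over G, and these are the powers
ζ_q^b with b in the subgroup. -/
theorem card_kummerSubgroup_mul_finrank (a : ℤ) (q k : ℕ) [NeZero q] [NeZero k] :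
    Nat.card (kummerSubgroup a q k) * Module.finrank ℚ (kummerField a k) =
      Module.finrank ℚ (compField a q k) := by
  set K := kummerField a k
  set ζ : ℂ := Complex.exp (2 * Real.pi * Complex.I / q)
  have hp : IsPrimitiveRoot ζ q := Complex.isPrimitiveRoot_exp q (NeZero.ne q)
  have hi : IsIntegral K ζ :=
    (isIntegral_of_pow_eq_one (NeZero.pos q) hp.pow_eq_one).tower_top
  have hF : (K⟮ζ⟯).restrictScalars ℚ = compField a q k := by
    refine le_antisymm ?_ ?_
    · have hle : K ≤ compField a q k := le_sup_right
      intro x hx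
      have : K⟮ζ⟯ ≤ extendScalars hle := adjoin_simple_le_iff.2
        ((le_sup_left : cycloField q ≤ compField a q k) (isPrimitiveRoot_exp_mem_cycloField q))
      exact this hx
    · refine sup_le ?_ ?_
      · rw [cycloField, adjoin_le_iff]
        intro x hx
        obtain ⟨i, -, rfl⟩ := hp.eq_pow_of_pow_eq_one hx
        exact pow_mem (mem_adjoin_simple_self K ζ) i
      · intro x hx
        exact (K⟮ζ⟯).algebraMap_mem ⟨x, hx⟩
  have hfr : Module.finrank ℚ (compField a q k) =
      Module.finrank ℚ K * (minpoly K ζ).natDegree := by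
    rw [← hF, ← adjoin.finrank hi]
    exact (Module.finrank_mul_finrank ℚ K K⟮ζ⟯).symm
  have hcard : Nat.card (kummerSubgroup a q k) = (minpoly K ζ).natDegree := by
    have hnd : ((minpoly K ζ).aroots ℂ).Nodup :=
      nodup_aroots_iff_of_splits (minpoly.ne_zero hi) (IsAlgClosed.splits _) |>.2
        (minpoly.irreducible hi).separable
    rw [← IsAlgClosed.card_aroots_eq_natDegree (B := ℂ), ← Multiset.toFinset_card_of_nodup hnd,
      ← Set.ncard_coe_finset]
    have himg : (((minpoly K ζ).aroots ℂ).toFinset : Set ℂ) =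
        (fun b : (ZMod q)ˣ => ζ ^ (b : ZMod q).val) '' (kummerSubgroup a q k : Set (ZMod q)ˣ) := by
      ext y
      simp only [Multiset.mem_toFinset, mem_aroots, Set.mem_image,
        SetLike.mem_coe, mem_kummerSubgroup]
      constructor
      · rintro ⟨-, hy⟩
        obtain ⟨τ, hτ⟩ := exists_complex_aut_of_aeval_minpoly hi hy
        refine ⟨cyc q (τ.restrictScalars ℚ),
          ⟨τ.restrictScalars ℚ, fun x hx => τ.commutes ⟨x, hx⟩, rfl⟩, ?_⟩
        rw [← cyc_spec _ hp.pow_eq_one]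
        exact hτ
      · rintro ⟨b, ⟨τ, hτ, rfl⟩, rfl⟩
        refine ⟨minpoly.ne_zero hi, ?_⟩
        rw [← cyc_spec _ hp.pow_eq_one]
        have h0 := minpoly.aeval K ζ
        rw [aeval_eq_sum_range] at h0 ⊢
        have h1 := congrArg τ h0
        rw [map_sum, map_zero] at h1
        refine Eq.trans (Finset.sum_congr rfl fun i _ => ?_) h1
        rw [Algebra.smul_def, Algebra.smul_def, map_mul, map_pow]
        congr 1
        exact (hτ _ (SetLike.coe_mem _)).symm
    rw [himg, Set.ncard_image_of_injective]
    · rfl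
    · intro b c hbc
      refine Units.ext (ZMod.val_injective q ?_)
      exact hp.pow_inj (ZMod.val_lt _) (ZMod.val_lt _) hbc
  rw [hfr, hcard, mul_comm]

/-! ### Powers -/

/-- Bézout: if mu + nv = 1, the element x^v y^u is the required root. -/
theorem exists_pow_mul_eq_of_coprime {L : Type*} [Field L] {a : L} (ha : a ≠ 0) {m n : ℕ}
    (hmn : m.Coprime n) {x y : L} (hx : x ^ m = a) (hy : y ^ n = a) : ∃ z : L, z ^ (m * n) = a := by
  have hb := Nat.gcd_eq_gcd_ab m n
  rw [hmn.gcd_eq_one] at hb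
  have hx' : ∀ t : ℤ, x ^ (m * t : ℤ) = a ^ t := fun t => by
    rw [zpow_mul, zpow_natCast, hx]
  have hy' : ∀ t : ℤ, y ^ (n * t : ℤ) = a ^ t := fun t => by
    rw [zpow_mul, zpow_natCast, hy]
  refine ⟨x ^ (m.gcdB n) * y ^ (m.gcdA n), ?_⟩
  rw [← zpow_natCast, mul_zpow, ← zpow_mul, ← zpow_mul]
  have e1 : m.gcdB n * ((m * n : ℕ) : ℤ) = m * (n * m.gcdB n) := by push_cast; ring
  have e2 : m.gcdA n * ((m * n : ℕ) : ℤ) = n * (m * m.gcdA n) := by push_cast; ring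
  rw [e1, e2, hx', hy', ← zpow_add₀ ha, add_comm]
  have hb' : (m * m.gcdA n + n * m.gcdB n : ℤ) = 1 := by exact_mod_cast hb.symm
  rw [hb', zpow_one]

theorem exists_pow_eq_of_squarefree {L : Type*} [Field L] {a : L} (ha : a ≠ 0) {k : ℕ}
    (hk : Squarefree k) (h : ∀ p, p.Prime → p ∣ k → ∃ x : L, x ^ p = a) : ∃ x : L, x ^ k = a := by
  have key : ∀ s : Finset ℕ, s ⊆ k.primeFactors → ∃ x : L, x ^ (∏ p ∈ s, p) = a := by
    intro s
    induction s using Finset.induction_on with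
    | empty => exact fun _ => ⟨a, by simp⟩
    | insert p s hps ih =>
      intro hs
      rw [Finset.insert_subset_iff] at hs
      obtain ⟨x, hx⟩ := ih hs.2
      have hp := Nat.prime_of_mem_primeFactors hs.1
      obtain ⟨y, hy⟩ := h p hp (Nat.dvd_of_mem_primeFactors hs.1)
      rw [Finset.prod_insert hps]
      refine exists_pow_mul_eq_of_coprime ha ?_ hy hx
      refine Nat.Coprime.prod_right fun r hr => ?_
      exact (Nat.coprime_primes hp (Nat.prime_of_mem_primeFactors (hs.2 hr))).2
        (fun e => hps (e ▸ hr))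
  simpa [Nat.prod_primeFactors_of_squarefree hk] using key _ subset_rfl

theorem exists_intCast_of_rat_pow_eq {a : ℤ} {n : ℕ} (hn : 0 < n) {x : ℚ} (hx : x ^ n = a) :
    ∃ c : ℤ, c ^ n = a := by
  have hi : IsIntegral ℤ x := by
    refine IsIntegral.of_pow hn ?_
    rw [hx]
    exact isIntegral_algebraMap (R := ℤ) (A := ℚ) (x := a)
  obtain ⟨c, rfl⟩ := IsIntegrallyClosed.isIntegral_iff.1 hi
  rw [algebraMap_int_eq, eq_intCast] at hx
  exact ⟨c, by exact_mod_cast hx⟩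

theorem ne_zero_of_not_isSquare {a : ℤ} (ha : a ≠ -1 ∧ ¬ IsSquare a) : a ≠ 0 := by
  rintro rfl
  exact ha.2 ⟨0, rfl⟩

theorem two_le_natAbs {a : ℤ} (ha : a ≠ -1 ∧ ¬ IsSquare a) : 2 ≤ a.natAbs := by
  have h0 := ne_zero_of_not_isSquare ha
  have h1 : a ≠ 1 := by
    rintro rfl
    exact ha.2 ⟨1, rfl⟩
  have := ha.1
  omega

theorem bddAbove_powers {a : ℤ} (ha : a ≠ -1 ∧ ¬ IsSquare a) : BddAbove {m : ℕ | ∃ b : ℤ, b ^ m = a} := by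
  refine ⟨a.natAbs, ?_⟩
  rintro m ⟨b, hb⟩
  have h2 := two_le_natAbs ha
  have hb2 : 2 ≤ b.natAbs := by
    by_contra h
    have hlt : b.natAbs ≤ 1 := by omega
    have : a.natAbs ≤ 1 := by
      rw [← hb, Int.natAbs_pow]
      exact pow_le_one₀ (Nat.zero_le _) hlt
    omega
  calc m ≤ 2 ^ m := Nat.lt_two_pow_self.le
    _ ≤ b.natAbs ^ m := Nat.pow_le_pow_left hb2 m
    _ = a.natAbs := by rw [← Int.natAbs_pow, hb]

theorem exists_pow_powIndex {a : ℤ} (ha : a ≠ -1 ∧ ¬ IsSquare a) : ∃ b : ℤ, b ^ powIndex a = a :=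
  Nat.sSup_mem (s := {m : ℕ | ∃ b : ℤ, b ^ m = a}) ⟨1, a, pow_one a⟩ (bddAbove_powers ha)

theorem powIndex_pos {a : ℤ} (ha : a ≠ -1 ∧ ¬ IsSquare a) : 0 < powIndex a :=
  le_csSup (bddAbove_powers ha) (show 1 ∈ {m : ℕ | ∃ b : ℤ, b ^ m = a} from ⟨a, pow_one a⟩)

/-- If p did not divide h_a, a p-th root and an h_a-th root would combine to a rational, hence
integral, root of order p·h_a, against the maximality of h_a. -/
theorem exists_pow_eq_iff_dvd_powIndex {a : ℤ} (ha : a ≠ -1 ∧ ¬ IsSquare a) {p : ℕ} (hp : p.Prime) :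
    (∃ c : ℤ, c ^ p = a) ↔ p ∣ powIndex a := by
  obtain ⟨b, hb⟩ := exists_pow_powIndex ha
  constructor
  · rintro ⟨c, hc⟩
    by_contra hnd
    obtain ⟨z, hz⟩ := exists_pow_mul_eq_of_coprime (L := ℚ) (a := a)
      (by exact_mod_cast ne_zero_of_not_isSquare ha) ((Nat.Prime.coprime_iff_not_dvd hp).2 hnd)
      (x := c) (y := b) (by exact_mod_cast hc) (by exact_mod_cast hb)
    have h1 := le_csSup (bddAbove_powers ha)
      (exists_intCast_of_rat_pow_eq (Nat.mul_pos hp.pos (powIndex_pos ha)) hz)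
    have h2 := powIndex_pos ha
    change p * powIndex a ≤ powIndex a at h1
    nlinarith [hp.two_le]
  · rintro ⟨m, hm⟩
    exact ⟨b ^ m, by rw [← pow_mul, mul_comm, ← hm, hb]⟩

theorem not_two_dvd_powIndex {a : ℤ} (ha : a ≠ -1 ∧ ¬ IsSquare a) : ¬ 2 ∣ powIndex a := by
  rw [← exists_pow_eq_iff_dvd_powIndex ha Nat.prime_two]
  rintro ⟨c, hc⟩
  exact ha.2 ⟨c, by rw [← hc, sq]⟩

/-- The cyclotomic character has values in a commutative group, so automorphisms of ℂ commute on a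
cyclotomic field. Applied to complex conjugation, this detects that a field is not cyclotomic. -/
theorem conj_aut_of_mem_cycloField {N : ℕ} [NeZero N] (σ : ℂ ≃ₐ[ℚ] ℂ) {y : ℂ}
    (hy : y ∈ cycloField N) : starRingEnd ℂ (σ y) = σ (starRingEnd ℂ y) := by
  let c : ℂ ≃ₐ[ℚ] ℂ := Complex.conjAe.restrictScalars ℚ
  have h : cyc N (c * σ) = cyc N (σ * c) := by rw [map_mul, map_mul, mul_comm]
  exact aut_eq_on_cycloField h hy

theorem cycloField_mono {M N : ℕ} (h : M ∣ N) : cycloField M ≤ cycloField N := by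
  refine adjoin.mono _ _ _ fun x hx => ?_
  obtain ⟨c, rfl⟩ := h
  have hx' : x ^ M = 1 := hx
  change x ^ (M * c) = 1
  rw [pow_mul, hx', one_pow]

theorem exists_real_pow_eq {p : ℕ} (hp : Odd p) (x : ℝ) : ∃ r : ℝ, r ^ p = x := by
  have hp0 : p ≠ 0 := hp.pos.ne'
  rcases le_total 0 x with hx | hx
  · exact ⟨x ^ ((p : ℝ)⁻¹), Real.rpow_inv_natCast_pow hx hp0⟩
  · refine ⟨-((-x) ^ ((p : ℝ)⁻¹)), ?_⟩
    rw [hp.neg_pow, Real.rpow_inv_natCast_pow (by linarith) hp0, neg_neg]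

/-- An odd prime power root of `a` lies in a cyclotomic field only if it is rational. -/
theorem pow_ne_of_mem_cycloField {a : ℤ} (ha : a ≠ -1 ∧ ¬ IsSquare a) {p N : ℕ} [NeZero N] (hp : p.Prime) (hp2 : p ≠ 2)
    (hph : ¬ p ∣ powIndex a) {x : ℂ} (hx : x ∈ cycloField N) : x ^ p ≠ a := by
  intro hxa
  have hodd : Odd p := hp.odd_of_ne_two hp2
  have : NeZero p := ⟨hp.ne_zero⟩
  obtain ⟨r, hr⟩ := exists_real_pow_eq hodd (a : ℝ)
  have ha0 : (a : ℂ) ≠ 0 := by exact_mod_cast ne_zero_of_not_isSquare ha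
  have hrC : (r : ℂ) ^ p = a := by exact_mod_cast congrArg Complex.ofReal hr
  have hr0 : (r : ℂ) ≠ 0 := by
    intro h
    rw [h, zero_pow hp.ne_zero] at hrC
    exact ha0 hrC.symm
  -- The real root r differs from x by a p-th root of unity, so it becomes cyclotomic after
  -- enlarging N to Np.
  have hrmem : (r : ℂ) ∈ cycloField (N * p) := by
    have hx0 : x ≠ 0 := by
      rintro rfl
      rw [zero_pow hp.ne_zero] at hxa
      exact ha0 hxa.symm
    have h1 : (r : ℂ) / x ∈ cycloField p := subset_adjoin ℚ _ (by
      change ((r : ℂ) / x) ^ p = 1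
      rw [div_pow, hrC, hxa, div_self ha0])
    have h2 := mul_mem (cycloField_mono (Dvd.intro_left N rfl) h1)
      (cycloField_mono (Dvd.intro p rfl) hx)
    rwa [div_mul_cancel₀ _ hx0] at h2
  have hirr : Irreducible (X ^ p - C (a : ℚ)) := by
    refine X_pow_sub_C_irreducible_of_prime hp fun b hb => hph ?_
    exact (exists_pow_eq_iff_dvd_powIndex ha hp).1 (exists_intCast_of_rat_pow_eq hp.pos hb)
  have hmin : minpoly ℚ (r : ℂ) = X ^ p - C (a : ℚ) :=
    (minpoly.eq_of_irreducible_of_monic hirr (by simp [hrC])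
      (monic_X_pow_sub_C _ hp.ne_zero)).symm
  have hζ := Complex.isPrimitiveRoot_exp p hp.ne_zero
  set ζ := Complex.exp (2 * Real.pi * Complex.I / p)
  -- σ sends the real number r to ζr. Commuting with conjugation would make ζ real, which is
  -- impossible for a primitive root of unity of odd prime order.
  obtain ⟨σ, hσ⟩ := exists_complex_aut_of_aeval_minpoly (K := ℚ) (x := (r : ℂ)) (y := ζ * r)
    (isIntegral_of_pow_eq_intCast hp.pos hrC) (by simp [hmin, mul_pow, hrC, hζ.pow_eq_one])
  have hc := conj_aut_of_mem_cycloField σ hrmem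
  rw [Complex.conj_ofReal, hσ, map_mul, Complex.conj_ofReal] at hc
  obtain ⟨t, ht⟩ := Complex.conj_eq_iff_real.1 (mul_right_cancel₀ hr0 hc)
  have htp : t ^ p = 1 := by
    have := hζ.pow_eq_one
    rw [ht] at this
    exact_mod_cast this
  have ht1 : t = 1 := hodd.strictMono_pow.injective (by simp [htp])
  refine hζ.ne_one hp.one_lt ?_
  rw [ht, ht1, Complex.ofReal_one]

/-! ### The Kummer extension of a cyclotomic field -/

open Classical in
/-- The product of the primes `p ∣ k` for which `a` is not a `p`-th power in `ℚ(ζ_N)`. -/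
def kummerDegree (a : ℤ) (N k : ℕ) : ℕ :=
  ∏ p ∈ k.primeFactors with ¬ ∃ x ∈ cycloField N, x ^ p = (a : ℂ), p

theorem kummerDegree_dvd_of {a : ℤ} {N k n : ℕ} (h : ∀ p, p.Prime → p ∣ k →
    (¬ ∃ x ∈ cycloField N, x ^ p = (a : ℂ)) → p ∣ n) : kummerDegree a N k ∣ n := by
  classical
  refine Finset.prod_primes_dvd _ (fun p hp => ?_) fun p hp => ?_
  · exact (Nat.prime_of_mem_primeFactors (Finset.mem_filter.1 hp).1).prime
  · rw [Finset.mem_filter, Nat.mem_primeFactors] at hp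
    exact h p hp.1.1 hp.1.2.1 hp.2

theorem dvd_kummerDegree {a : ℤ} {N k p : ℕ} (hk : k ≠ 0) (hp : p.Prime) (hpk : p ∣ k)
    (h : ¬ ∃ x ∈ cycloField N, x ^ p = (a : ℂ)) : p ∣ kummerDegree a N k := by
  classical
  exact Finset.dvd_prod_of_mem (fun p => p)
    (Finset.mem_filter.2 ⟨Nat.mem_primeFactors.2 ⟨hp, hpk, hk⟩, h⟩)

theorem kummerDegree_pos (a : ℤ) (N k : ℕ) : 0 < kummerDegree a N k := by
  classical
  exact Finset.prod_pos fun _ hp => Nat.pos_of_mem_primeFactors (Finset.mem_of_mem_filter _ hp)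

theorem kummerDegree_dvd (a : ℤ) (N k : ℕ) : kummerDegree a N k ∣ k :=
  kummerDegree_dvd_of fun _ _ h _ => h

/-- For each prime p dividing the exponent κ, X^p - a is irreducible over ℚ(ζ_N) and has the root
α^{κ/p}, so p divides the degree of α. As κ is a product of distinct primes, κ divides the degree.
-/
theorem minpoly_kummer {a : ℤ} {N k : ℕ} (hk : k ≠ 0) {α : ℂ}
    (hα : α ^ kummerDegree a N k = a) :
    minpoly (cycloField N) α = X ^ kummerDegree a N k - C (a : cycloField N) := by
  have hκ0 : kummerDegree a N k ≠ 0 := (kummerDegree_pos a N k).ne'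
  have hdvdκ : ∀ n, (∀ p, p.Prime → p ∣ k → (¬ ∃ x ∈ cycloField N, x ^ p = (a : ℂ)) → p ∣ n) →
      kummerDegree a N k ∣ n := fun n => kummerDegree_dvd_of
  have hpdvd : ∀ p, p.Prime → p ∣ k → (¬ ∃ x ∈ cycloField N, x ^ p = (a : ℂ)) →
      p ∣ kummerDegree a N k := fun p => dvd_kummerDegree hk
  generalize kummerDegree a N k = κ at *
  set K := cycloField N
  have hmonic : (X ^ κ - C (a : K)).Monic := monic_X_pow_sub_C _ hκ0
  have hroot : aeval α (X ^ κ - C (a : K)) = 0 := by simp [hα]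
  have hi : IsIntegral K α := ⟨_, hmonic, by rwa [← aeval_def]⟩
  have : FiniteDimensional K K⟮α⟯ := adjoin.finiteDimensional hi
  have hdvd : κ ∣ (minpoly K α).natDegree := by
    refine hdvdκ _ fun p hpp hpk hp => ?_
    · have hpκ : p ∣ κ := hpdvd p hpp hpk hp
      obtain ⟨c, hc⟩ := hpκ
      have hβ : (α ^ c) ^ p = (a : ℂ) := by rw [← pow_mul, mul_comm, ← hc, hα]
      have hirr : Irreducible (X ^ p - C (a : K)) := by
        refine X_pow_sub_C_irreducible_of_prime hpp fun b hb => hp ?_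
        exact ⟨b, b.2, by exact_mod_cast congrArg Subtype.val hb⟩
      have hmin : minpoly K (α ^ c) = X ^ p - C (a : K) :=
        (minpoly.eq_of_irreducible_of_monic hirr (by simp [hβ])
          (monic_X_pow_sub_C _ hpp.ne_zero)).symm
      have h1 : (minpoly K (⟨α ^ c, pow_mem (mem_adjoin_simple_self K α) c⟩ : K⟮α⟯)).natDegree ∣
          Module.finrank K K⟮α⟯ := minpoly.degree_dvd (IsIntegral.of_finite K _)
      rw [← minpoly.algebraMap_eq (algebraMap K⟮α⟯ ℂ).injective, adjoin.finrank hi] at h1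
      change (minpoly K (α ^ c)).natDegree ∣ _ at h1
      rwa [hmin, natDegree_X_pow_sub_C] at h1
  refine (eq_of_monic_of_dvd_of_natDegree_le (minpoly.monic hi) hmonic
    (minpoly.dvd _ _ hroot) ?_).symm
  rw [natDegree_X_pow_sub_C]
  exact Nat.le_of_dvd (minpoly.natDegree_pos hi) hdvd

/-- Because k is squarefree, roots of a of prime order combine into one k-th root in L; the other
k-th roots differ from it by roots of unity. -/
theorem kummerField_le {a : ℤ} (ha : a ≠ 0) {k : ℕ} (hk : Squarefree k) {L : IntermediateField ℚ ℂ}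
    (h1 : ∀ ζ : ℂ, ζ ^ k = 1 → ζ ∈ L)
    (h2 : ∀ p, p.Prime → p ∣ k → ∃ x ∈ L, x ^ p = (a : ℂ)) : kummerField a k ≤ L := by
  obtain ⟨β, hβ⟩ := exists_pow_eq_of_squarefree (L := L) (a := a) (by exact_mod_cast ha) hk
    fun p hp hpk => by
      obtain ⟨x, hx, hxp⟩ := h2 p hp hpk
      exact ⟨⟨x, hx⟩, Subtype.ext (by push_cast; exact hxp)⟩
  have hβ' : (β : ℂ) ^ k = a := by exact_mod_cast congrArg Subtype.val hβ
  have ha0 : (a : ℂ) ≠ 0 := by exact_mod_cast ha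
  have hβ0 : (β : ℂ) ≠ 0 := by
    intro h
    rw [h, zero_pow hk.ne_zero] at hβ'
    exact ha0 hβ'.symm
  rw [kummerField, adjoin_le_iff]
  rintro x (hx | hx)
  · exact h1 x hx
  · have := mul_mem (h1 (x / β) (by rw [div_pow, hx, hβ', div_self ha0])) β.2
    rwa [div_mul_cancel₀ _ hβ0] at this

theorem exists_pow_eq_of_not_mem_kummerDegree {a : ℤ} {N k κ p : ℕ} (hκ : κ = kummerDegree a N k)
    (hp : p.Prime) (hpk : p ∣ k) (hk : k ≠ 0) {α : ℂ} (hα : α ^ κ = a) :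
    (∃ x ∈ cycloField N, x ^ p = (a : ℂ)) ∨ ∃ c, (α ^ c) ^ p = a := by
  by_cases h : ∃ x ∈ cycloField N, x ^ p = (a : ℂ)
  · exact Or.inl h
  · right
    have hmem : p ∣ κ := hκ ▸ dvd_kummerDegree hk hp hpk h
    obtain ⟨c, rfl⟩ := hmem
    exact ⟨c, by rw [← pow_mul, mul_comm, hα]⟩

/-- An automorphism acting trivially on the `k`-th roots of unity (and on `√a` when this lies in
`ℚ(ζ_N)` and `k` is even) agrees on `ℚ(ζ_N)` with one that is trivial on `ℚ(ζ_k, a^{1/k})`. -/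
theorem exists_aut_fixing_kummerField {a : ℤ} (ha : a ≠ -1 ∧ ¬ IsSquare a) {k N : ℕ} [NeZero N]
    (hk : Squarefree k) (hkN : k ∣ N) (τ₀ : ℂ ≃ₐ[ℚ] ℂ) (h1 : ∀ ζ : ℂ, ζ ^ k = 1 → τ₀ ζ = ζ)
    (h2 : 2 ∣ k → ∀ x ∈ cycloField N, x ^ 2 = (a : ℂ) → τ₀ x = x) :
    ∃ τ : ℂ ≃ₐ[ℚ] ℂ, (∀ x ∈ kummerField a k, τ x = x) ∧ cyc N τ = cyc N τ₀ := by
  have hκ0 := kummerDegree_pos a N k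
  obtain ⟨α, hα⟩ := IsAlgClosed.exists_pow_nat_eq (a : ℂ) hκ0
  have hα' : (τ₀ α) ^ kummerDegree a N k = a := by rw [← map_pow, hα, map_intCast]
  -- τ₀ may move α to another root of X^κ - a. As this polynomial is irreducible over ℚ(ζ_N), some ρ
  -- over ℚ(ζ_N) moves it back, and ρτ₀ fixes α without changing the action on ℚ(ζ_N).
  obtain ⟨ρ, hρ⟩ := exists_complex_aut_of_aeval_minpoly (K := cycloField N) (x := τ₀ α) (y := α)
    (isIntegral_of_pow_eq_intCast hκ0 hα').tower_top (by rw [minpoly_kummer hk.ne_zero hα']; simp [hα])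
  have hρK : ∀ x ∈ cycloField N, ρ x = x := fun x hx => ρ.commutes ⟨x, hx⟩
  let τ : ℂ ≃ₐ[ℚ] ℂ := ρ.restrictScalars ℚ * τ₀
  have hτ : ∀ x, τ x = ρ (τ₀ x) := fun _ => rfl
  have hτK : ∀ x ∈ cycloField N, τ x = τ₀ x := fun x hx => hρK _ (aut_mem_cycloField τ₀ hx)
  -- The fixed field of τ contains G_{a,k} as soon as it contains the k-th roots of unity and one
  -- p-th root of a for each p ∣ k. A cyclotomic p-th root exists only for p = 2, covered by `h2`,
  -- or for p ∣ h_a, when an integer root is available; the remaining roots are powers of α.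
  let L : IntermediateField ℚ ℂ := FixedPoints.intermediateField (Subgroup.zpowers τ)
  have hL : ∀ x, x ∈ L ↔ τ x = x := by
    intro x
    constructor
    · exact fun h => h ⟨τ, Subgroup.mem_zpowers τ⟩
    · rintro h ⟨_, n, rfl⟩
      have : Subgroup.zpowers τ ≤ MulAction.stabilizer (ℂ ≃ₐ[ℚ] ℂ) x :=
        Subgroup.zpowers_le.2 h
      exact this (Subgroup.zpow_mem _ (Subgroup.mem_zpowers τ) n)
  refine ⟨τ, fun x hx => (hL x).1 (kummerField_le (ne_zero_of_not_isSquare ha) hk ?_ ?_ hx), ?_⟩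
  · intro ζ hζ
    rw [hL, hτK ζ, h1 ζ hζ]
    refine cycloField_mono hkN (subset_adjoin ℚ _ hζ)
  · intro p hp hpk
    rcases exists_pow_eq_of_not_mem_kummerDegree rfl hp hpk hk.ne_zero hα with ⟨x, hx, hxp⟩ | ⟨c, hc⟩
    · by_cases hp2 : p = 2
      · subst hp2
        exact ⟨x, (hL x).2 (by rw [hτK x hx, h2 hpk x hx hxp]), hxp⟩
      · have hph : p ∣ powIndex a := by
          by_contra hph
          exact pow_ne_of_mem_cycloField ha hp hp2 hph hx hxp
        obtain ⟨c, hc⟩ := (exists_pow_eq_iff_dvd_powIndex ha hp).2 hph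
        exact ⟨c, (hL _).2 (map_intCast τ c), by exact_mod_cast hc⟩
    · refine ⟨α ^ c, (hL _).2 ?_, hc⟩
      rw [map_pow, hτ, hρ]
  · refine Units.ext ?_
    rw [← ZMod.natCast_zmod_val (cyc N τ₀ : ZMod N), cyc_eq_iff]
    intro ζ hζ
    rw [hτK ζ (subset_adjoin ℚ _ hζ), cyc_spec τ₀ hζ]

/-! ### Degrees of cyclotomic fields and of the compositum F. -/

theorem finrank_cycloField (N : ℕ) [NeZero N] : Module.finrank ℚ (cycloField N) = N.totient := by
  have hp := Complex.isPrimitiveRoot_exp N (NeZero.ne N)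
  have h : cycloField N = ℚ⟮Complex.exp (2 * Real.pi * Complex.I / N)⟯ := by
    refine le_antisymm ?_ (adjoin_simple_le_iff.2 (isPrimitiveRoot_exp_mem_cycloField N))
    rw [cycloField, adjoin_le_iff]
    intro x hx
    obtain ⟨i, -, rfl⟩ := hp.eq_pow_of_pow_eq_one hx
    exact pow_mem (mem_adjoin_simple_self ℚ _) i
  rw [h, adjoin.finrank (isIntegral_of_pow_eq_one (NeZero.pos N) hp.pow_eq_one),
    ← cyclotomic_eq_minpoly_rat hp (NeZero.pos N), natDegree_cyclotomic]

theorem cyc_eq_one_iff {q : ℕ} [NeZero q] {τ : ℂ ≃ₐ[ℚ] ℂ} :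
    cyc q τ = 1 ↔ ∀ ζ : ℂ, ζ ^ q = 1 → τ ζ = ζ := by
  rw [← Units.val_inj, Units.val_one, ← Nat.cast_one, cyc_eq_iff]
  simp

theorem cycloField_lcm_le (d k : ℕ) [NeZero d] [NeZero k] :
    cycloField (d.lcm k) ≤ cycloField d ⊔ cycloField k := by
  have : NeZero (d.lcm k) := ⟨Nat.lcm_ne_zero (NeZero.ne d) (NeZero.ne k)⟩
  rw [cycloField, adjoin_le_iff]
  intro ζ hζ
  refine mem_of_forall_aut_fixed (isIntegral_of_pow_eq_one (NeZero.pos _) hζ) fun τ hτ => ?_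
  have hd : cyc d τ = 1 := cyc_eq_one_iff.2 fun w hw => hτ w
    ((le_sup_left : cycloField d ≤ _) (subset_adjoin ℚ _ hw))
  have hk : cyc k τ = 1 := cyc_eq_one_iff.2 fun w hw => hτ w
    ((le_sup_right : cycloField k ≤ _) (subset_adjoin ℚ _ hw))
  rw [← unitsMap_cyc (Nat.dvd_lcm_left d k)] at hd
  rw [← unitsMap_cyc (Nat.dvd_lcm_right d k)] at hk
  refine cyc_eq_one_iff.1 (Units.ext ?_) ζ hζ
  set u := cyc (d.lcm k) τ
  have hd' : ((u : ZMod (d.lcm k)).val : ZMod d) = 1 := by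
    have := congrArg Units.val hd
    rwa [ZMod.unitsMap_def, Units.coe_map, MonoidHom.coe_coe, ZMod.castHom_apply,
      ZMod.cast_eq_val] at this
  have hk' : ((u : ZMod (d.lcm k)).val : ZMod k) = 1 := by
    have := congrArg Units.val hk
    rwa [ZMod.unitsMap_def, Units.coe_map, MonoidHom.coe_coe, ZMod.castHom_apply,
      ZMod.cast_eq_val] at this
  rw [← Nat.cast_one, ZMod.natCast_eq_natCast_iff, Nat.modEq_iff_dvd] at hd' hk'
  rw [Units.val_one, ← ZMod.natCast_zmod_val (u : ZMod (d.lcm k)), ← Nat.cast_one,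
    ZMod.natCast_eq_natCast_iff, Nat.modEq_iff_dvd]
  have := lcm_dvd hd' hk'
  rwa [← Int.coe_lcm, Int.lcm_natCast_natCast] at this

/-- With N = lcm(d, k), the field F is ℚ(ζ_N, α) for a root α of order `kummerDegree a N k`: the
other prime-order roots of a are already available in ℚ(ζ_N). -/
theorem finrank_compField {a : ℤ} (ha : a ≠ -1 ∧ ¬ IsSquare a) {d k : ℕ} [NeZero d]
    (hk : Squarefree k) :
    Module.finrank ℚ (compField a d k) =
      (d.lcm k).totient * kummerDegree a (d.lcm k) k := by
  have hk0 : NeZero k := ⟨hk.ne_zero⟩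
  set N := d.lcm k with hN
  have : NeZero N := ⟨Nat.lcm_ne_zero (NeZero.ne d) (NeZero.ne k)⟩
  have hκ0 := kummerDegree_pos a N k
  obtain ⟨c, hc⟩ := kummerDegree_dvd a N k
  obtain ⟨β, hβ⟩ := IsAlgClosed.exists_pow_nat_eq (a : ℂ) (NeZero.pos k)
  set α := β ^ c
  have hα : α ^ kummerDegree a N k = a := by rw [← pow_mul, mul_comm, ← hc, hβ]
  set K := cycloField N
  have hi : IsIntegral K α := (isIntegral_of_pow_eq_intCast hκ0 hα).tower_top
  have hF : (K⟮α⟯).restrictScalars ℚ = compField a d k := by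
    refine le_antisymm ?_ ?_
    · have hle : K ≤ compField a d k :=
        (cycloField_lcm_le d k).trans (sup_le_sup_left
          (adjoin.mono _ _ _ fun x hx => Or.inl hx) _)
      intro x hx
      have : K⟮α⟯ ≤ extendScalars hle := adjoin_simple_le_iff.2
        ((le_sup_right : kummerField a k ≤ compField a d k)
          (pow_mem (subset_adjoin ℚ _ (Or.inr hβ) : β ∈ kummerField a k) c))
      exact this hx
    · have hK : K ≤ (K⟮α⟯).restrictScalars ℚ := fun x hx => (K⟮α⟯).algebraMap_mem ⟨x, hx⟩
      refine sup_le ((cycloField_mono (Nat.dvd_lcm_left d k)).trans hK)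
        (kummerField_le (ne_zero_of_not_isSquare ha) hk (fun ζ hζ => hK ?_) fun p hp hpk => ?_)
      · exact cycloField_mono (Nat.dvd_lcm_right d k) (subset_adjoin ℚ _ hζ)
      · rcases exists_pow_eq_of_not_mem_kummerDegree rfl hp hpk hk.ne_zero hα with
          ⟨x, hx, hxp⟩ | ⟨e, he⟩
        · exact ⟨x, hK hx, hxp⟩
        · exact ⟨α ^ e, pow_mem (mem_adjoin_simple_self K α) e, he⟩
  rw [← hF, ← finrank_cycloField N, ← natDegree_X_pow_sub_C (n := kummerDegree a N k)
    (r := (a : K)), ← minpoly_kummer hk.ne_zero hα, ← adjoin.finrank hi]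
  exact (Module.finrank_mul_finrank ℚ K K⟮α⟯).symm

/-! ### The discriminant of a quadratic field -/

/-- In the basis 1, ω the trace form has the entries 2, b, b, b² + 2c. -/
theorem discr_eq_of_integral_basis (K : IntermediateField ℚ ℂ) [NumberField K] {ω : ℂ} {b c : ℤ}
    (hωK : ω ∈ K) (hω : ω ^ 2 = b * ω + c) (hirr : ∀ r : ℚ, ω ≠ r)
    (hspan : ∀ x ∈ K, IsIntegral ℤ x → ∃ u v : ℤ, x = u + v * ω) :
    NumberField.discr K = b ^ 2 + 4 * c := by
  have hωi : IsIntegral ℤ ω := by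
    refine ⟨X ^ 2 - C b * X - C c, ?_, ?_⟩
    · have : X ^ 2 - C b * X - C c = X ^ 2 - (C b * X + C c) := by ring
      rw [this]
      refine monic_X_pow_sub ?_
      compute_degree!
    · simp only [eval₂_sub, eval₂_mul, eval₂_pow, eval₂_X, eval₂_C, hω]
      simp
  obtain ⟨w, hwω⟩ : ∃ w : NumberField.RingOfIntegers K, ((w : K) : ℂ) = ω := ⟨⟨⟨ω, hωK⟩, by
    rw [mem_integralClosure_iff]
    exact (isIntegral_algHom_iff (IsScalarTower.toAlgHom ℤ K ℂ) Subtype.val_injective).1 hωi⟩, rfl⟩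
  have hinj : Function.Injective fun x : NumberField.RingOfIntegers K => ((x : K) : ℂ) :=
    fun x y h => NumberField.RingOfIntegers.ext (Subtype.ext h)
  have hw : w * w = b * w + c := hinj (by
    have : ω * ω = b * ω + c := by rw [← sq, hω]
    simpa [hwω] using this)
  have hli : LinearIndependent ℤ ![1, w] := by
    rw [LinearIndependent.pair_iff]
    intro s t hst
    have h1 : (s : ℂ) + t * ω = 0 := by
      have := congrArg (fun x : NumberField.RingOfIntegers K => ((x : K) : ℂ)) hst
      simpa [hwω] using this
    have ht : t = 0 := by
      by_contra ht
      refine hirr (-(s / t)) ?_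
      have ht' : (t : ℂ) ≠ 0 := by exact_mod_cast ht
      push_cast
      field_simp
      linear_combination h1
    subst ht
    refine ⟨?_, rfl⟩
    simpa using h1
  have hsp : ⊤ ≤ Submodule.span ℤ (Set.range ![1, w]) := by
    intro x _
    obtain ⟨u, v, huv⟩ := hspan ((x : K) : ℂ) (x : K).2 (by
      exact (isIntegral_algHom_iff (IsScalarTower.toAlgHom ℤ K ℂ) Subtype.val_injective).2
        (NumberField.RingOfIntegers.isIntegral_coe x))
    have hx : x = u • 1 + v • w := hinj (by simpa [hwω] using huv)
    rw [hx]
    refine add_mem (Submodule.smul_mem _ _ (Submodule.subset_span ⟨0, rfl⟩))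
      (Submodule.smul_mem _ _ (Submodule.subset_span ⟨1, rfl⟩))
  let B := Module.Basis.mk hli hsp
  have hB0 : B 0 = 1 := by simp [B]
  have hB1 : B 1 = w := by simp [B]
  have hrepr : ∀ u v : ℤ, B.repr (u * 1 + v * w) = Finsupp.single 0 u + Finsupp.single 1 v := by
    intro u v
    rw [← hB0, ← hB1]
    simp only [← zsmul_eq_mul, map_add, map_zsmul, Module.Basis.repr_self]
    simp
  have htr : ∀ u v : ℤ, Algebra.trace ℤ (NumberField.RingOfIntegers K) (u * 1 + v * w) =
      2 * u + v * b := by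
    intro u v
    rw [Algebra.trace_eq_matrix_trace B, Matrix.trace_fin_two, Algebra.leftMulMatrix_eq_repr_mul,
      Algebra.leftMulMatrix_eq_repr_mul, hB0, hB1]
    have e1 : (u * 1 + v * w) * 1 = (u : NumberField.RingOfIntegers K) * 1 + v * w := by ring
    have e2 : (u * 1 + v * w) * w = ((v * c : ℤ) : NumberField.RingOfIntegers K) * 1 +
        ((u + v * b : ℤ) : NumberField.RingOfIntegers K) * w := by
      push_cast
      linear_combination (v : NumberField.RingOfIntegers K) * hw
    rw [e1, e2, hrepr, hrepr]
    simp
    ring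
  rw [← NumberField.discr_eq_discr K B, Algebra.discr_def, Matrix.det_fin_two]
  simp only [Algebra.traceMatrix_apply, Algebra.traceForm_apply, hB0, hB1]
  have t1 := htr 1 0
  have t2 := htr 0 1
  have t3 := htr c b
  have e3 : (c : NumberField.RingOfIntegers K) * 1 + b * w = w * w := by rw [hw]; ring
  rw [e3] at t3
  simp only [Int.cast_one, Int.cast_zero, zero_mul, add_zero, one_mul, zero_add] at t1 t2
  rw [one_mul, one_mul, mul_one, t1, t2, t3]
  ring

theorem exists_int_of_sq_mul_squarefree {m : ℤ} (hm : Squarefree m) {w : ℚ} {j : ℤ}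
    (h : w ^ 2 * m = j) : ∃ v : ℤ, w = v := by
  have hd : (w.den : ℤ) * w.den ∣ m := by
    have h1 : (w.num : ℚ) ^ 2 * m = j * (w.den : ℚ) ^ 2 := by
      have hden : (w.den : ℚ) ≠ 0 := by exact_mod_cast w.den_ne_zero
      rw [← h]
      nth_rw 2 [← Rat.num_div_den w]
      field_simp
    have h2 : w.num ^ 2 * m = j * (w.den : ℤ) ^ 2 := by exact_mod_cast h1
    have hco : IsCoprime ((w.den : ℤ) ^ 2) (w.num ^ 2) := by
      refine IsCoprime.pow ?_
      rw [Int.isCoprime_iff_gcd_eq_one, Int.gcd_comm]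
      simpa [Int.gcd] using w.reduced
    rw [← sq]
    exact hco.dvd_of_dvd_mul_left ⟨j, by rw [h2]; ring⟩
  have hu := Int.isUnit_iff.1 (hm _ hd)
  have hden : w.den = 1 := by
    have := w.den_pos
    omega
  exact ⟨w.num, ((Rat.den_eq_one_iff w).1 hden).symm⟩

theorem exists_int_of_isIntegral_ratCast {r : ℚ} (h : IsIntegral ℤ (r : ℂ)) : ∃ v : ℤ, r = v := by
  have h' : IsIntegral ℤ r :=
    (isIntegral_algHom_iff ((algebraMap ℚ ℂ).toIntAlgHom) (algebraMap ℚ ℂ).injective).1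
      (by simpa using h)
  obtain ⟨v, hv⟩ := IsIntegrallyClosed.isIntegral_iff.1 h'
  exact ⟨v, by simpa using hv.symm⟩

theorem ne_ratCast_of_sq_eq {m : ℤ} (hm : Squarefree m) (hm1 : m ≠ 1) {t : ℂ} (ht : t ^ 2 = m)
    (r : ℚ) : t ≠ r := by
  rintro rfl
  have h1 : r ^ 2 = m := by exact_mod_cast ht
  obtain ⟨v, hv⟩ := exists_int_of_sq_mul_squarefree (w := r) (j := m * m) hm (by
    rw [h1]; push_cast; ring)
  subst hv
  have h2 : v * v = m := by rw [← sq]; exact_mod_cast h1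
  have h3 := Int.isUnit_iff.1 (hm v ⟨1, by rw [h2, mul_one]⟩)
  rcases h3 with h3 | h3 <;> (subst h3; omega)

theorem quadField_eq_adjoin {a m r : ℤ} (hr : r ≠ 0) (har : a = m * r ^ 2) {t : ℂ}
    (ht : t ^ 2 = m) : quadField a = ℚ⟮t⟯ := by
  have hrC : (r : ℂ) ≠ 0 := by exact_mod_cast hr
  have hrt : (r * t) ^ 2 = (a : ℂ) := by rw [mul_pow, ht, har]; push_cast; ring
  refine le_antisymm ?_ ?_
  · rw [quadField, adjoin_le_iff]
    intro x hx
    have hx' : x ^ 2 = (r * t) ^ 2 := by rw [hrt]; exact hx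
    have hmem : (r : ℂ) * t ∈ ℚ⟮t⟯ := mul_mem (intCast_mem _ r) (mem_adjoin_simple_self ℚ t)
    rcases sq_eq_sq_iff_eq_or_eq_neg.1 hx' with h | h
    · rw [h]; exact hmem
    · rw [h]; exact neg_mem hmem
  · rw [adjoin_simple_le_iff]
    have h1 : (r : ℂ) * t ∈ quadField a := subset_adjoin ℚ _ hrt
    have h2 := mul_mem (inv_mem (intCast_mem (quadField a) r)) h1
    rwa [inv_mul_cancel_left₀ hrC] at h2

theorem exists_rat_of_mem_adjoin_sqrt {m : ℤ} {t : ℂ} (ht : t ^ 2 = m) {x : ℂ} (hx : x ∈ ℚ⟮t⟯) :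
    ∃ u v : ℚ, x = u + v * t := by
  have hi : IsAlgebraic ℚ t := (isIntegral_of_pow_eq_intCast two_pos ht).isAlgebraic
  rw [← mem_toSubalgebra, adjoin_simple_toSubalgebra_of_isAlgebraic hi] at hx
  induction hx using Algebra.adjoin_induction with
  | mem y hy =>
    rw [Set.mem_singleton_iff] at hy
    exact ⟨0, 1, by rw [hy]; simp⟩
  | algebraMap q => exact ⟨q, 0, by simp⟩
  | add y z _ _ hy hz =>
    obtain ⟨u, v, rfl⟩ := hy
    obtain ⟨u', v', rfl⟩ := hz
    exact ⟨u + u', v + v', by push_cast; ring⟩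
  | mul y z _ _ hy hz =>
    obtain ⟨u, v, rfl⟩ := hy
    obtain ⟨u', v', rfl⟩ := hz
    refine ⟨u * u' + v * v' * m, u * v' + v * u', ?_⟩
    push_cast
    linear_combination (v * v' : ℂ) * ht

/-- Integral elements of `ℚ(√m)` have the form `(U + V√m)/2` with `U² ≡ mV² mod 4`. -/
theorem exists_int_of_isIntegral_mem_adjoin_sqrt {m : ℤ} (hm : Squarefree m) (hm1 : m ≠ 1) {t : ℂ}
    (ht : t ^ 2 = m) {x : ℂ} (hx : x ∈ ℚ⟮t⟯) (hxi : IsIntegral ℤ x) :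
    ∃ U V : ℤ, 2 * x = U + V * t ∧ (4 : ℤ) ∣ U ^ 2 - m * V ^ 2 := by
  obtain ⟨u, v, rfl⟩ := exists_rat_of_mem_adjoin_sqrt ht hx
  have hirr := ne_ratCast_of_sq_eq hm hm1 ht
  have hmin : minpoly ℚ t = X ^ 2 - C (m : ℚ) := by
    refine (minpoly.eq_of_irreducible_of_monic ?_ (by simp [ht])
      (monic_X_pow_sub_C _ two_ne_zero)).symm
    refine X_pow_sub_C_irreducible_of_prime Nat.prime_two fun b hb => ?_
    have : t ^ 2 = (b : ℂ) ^ 2 := by rw [ht]; exact_mod_cast congrArg (Rat.cast (K := ℂ)) hb.symm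
    rcases sq_eq_sq_iff_eq_or_eq_neg.1 this with h | h
    · exact hirr b h
    · exact hirr (-b) (by rw [h]; simp)
  -- With the conjugation t ↦ -t, integrality of x passes to the trace 2u, to the squared difference
  -- (2v)²m and to the norm u² - mv². Squarefreeness of m then makes 2v an integer.
  obtain ⟨σ, hσ⟩ := exists_complex_aut_of_aeval_minpoly (K := ℚ) (x := t) (y := -t)
    (isIntegral_of_pow_eq_intCast two_pos ht) (by rw [hmin]; simp [ht])
  have hxi' : IsIntegral ℤ ((u : ℂ) - v * t) := by
    have := hxi.map (σ.toAlgHom.toRingHom.toIntAlgHom)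
    have e : σ.toAlgHom.toRingHom.toIntAlgHom ((u : ℂ) + v * t) = u - v * t := by
      change σ ((u : ℂ) + v * t) = _
      rw [map_add, map_mul, hσ, map_ratCast, map_ratCast]
      ring
    rwa [e] at this
  obtain ⟨U, hU⟩ := exists_int_of_isIntegral_ratCast (r := 2 * u) (by
    have := hxi.add hxi'
    have e : ((2 * u : ℚ) : ℂ) = (u + v * t) + (u - v * t) := by push_cast; ring
    rwa [e])
  obtain ⟨J, hJ⟩ := exists_int_of_isIntegral_ratCast (r := (2 * v) ^ 2 * m) (by
    have := (hxi.sub hxi').pow 2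
    have e : (((2 * v) ^ 2 * m : ℚ) : ℂ) = ((u + v * t) - (u - v * t)) ^ 2 := by
      push_cast
      rw [← ht]
      ring
    rwa [e])
  obtain ⟨V, hV⟩ := exists_int_of_sq_mul_squarefree hm hJ
  obtain ⟨N, hN⟩ := exists_int_of_isIntegral_ratCast (r := u ^ 2 - m * v ^ 2) (by
    have := hxi.mul hxi'
    have e : ((u ^ 2 - m * v ^ 2 : ℚ) : ℂ) = (u + v * t) * (u - v * t) := by
      push_cast
      rw [← ht]
      ring
    rwa [e])
  refine ⟨U, V, ?_, N, ?_⟩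
  · have h1 : (2 * u : ℂ) = U := by exact_mod_cast congrArg (Rat.cast (K := ℂ)) hU
    have h2 : (2 * v : ℂ) = V := by exact_mod_cast congrArg (Rat.cast (K := ℂ)) hV
    rw [← h1, ← h2]
    ring
  · have : (U : ℚ) ^ 2 - m * V ^ 2 = 4 * N := by
      rw [← hU, ← hV, ← hN]
      ring
    exact_mod_cast this

/-- The congruence U² ≡ mV² mod 4 forces U ≡ V mod 2 if m ≡ 1 mod 4, giving the integral basis 1,
(1+t)/2; otherwise it forces both to be even, giving 1, t. -/
theorem disc_eq_of_squarefree {a m r : ℤ} (hm : Squarefree m) (hm1 : m ≠ 1) (hr : r ≠ 0)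
    (har : a = m * r ^ 2) : disc a = if m % 4 = 1 then m else 4 * m := by
  obtain ⟨t, ht⟩ := IsAlgClosed.exists_pow_nat_eq (m : ℂ) two_pos
  have hq := quadField_eq_adjoin hr har ht
  have hirr := ne_ratCast_of_sq_eq hm hm1 ht
  have htK : t ∈ quadField a := by rw [hq]; exact mem_adjoin_simple_self ℚ t
  have hchar := fun x (hx : x ∈ quadField a) =>
    exists_int_of_isIntegral_mem_adjoin_sqrt hm hm1 ht (x := x) (hq ▸ hx)
  split_ifs with h
  · have h4 : m = 1 + 4 * (m / 4) := by omega
    have h4C : (m : ℂ) = 1 + 4 * ((m / 4 : ℤ) : ℂ) := by exact_mod_cast congrArg (Int.cast (R := ℂ)) h4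
    rw [disc, discr_eq_of_integral_basis (quadField a) (ω := (1 + t) / 2) (b := 1) (c := m / 4)]
    · omega
    · exact div_mem (add_mem (one_mem _) htK) (ofNat_mem _ 2)
    · push_cast
      linear_combination (1 / 4 : ℂ) * ht + (1 / 4 : ℂ) * h4C
    · intro q hqq
      refine hirr (2 * q - 1) ?_
      push_cast
      rw [← hqq]
      ring
    · intro x hx hxi
      obtain ⟨U, V, hUV, hd⟩ := hchar x hx hxi
      have hpar : (2 : ℤ) ∣ U - V := by
        obtain ⟨n, hn⟩ := hd
        have : (U - V) % 2 = 0 := by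
          have h2 : U ^ 2 = V ^ 2 + 4 * ((m / 4) * V ^ 2 + n) := by
            rw [h4] at hn
            linear_combination hn
          have h3 : U ^ 2 % 2 = V ^ 2 % 2 := by omega
          rcases Int.emod_two_eq_zero_or_one U with hu | hu <;>
            rcases Int.emod_two_eq_zero_or_one V with hv | hv <;>
            simp [pow_two, Int.mul_emod, hu, hv] at h3 <;> omega
        omega
      obtain ⟨w, hw⟩ := hpar
      refine ⟨w, V, ?_⟩
      have hwC : (U : ℂ) - V = 2 * w := by exact_mod_cast congrArg (Int.cast (R := ℂ)) hw
      linear_combination (1 / 2 : ℂ) * hUV + (1 / 2 : ℂ) * hwC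
  · rw [disc, discr_eq_of_integral_basis (quadField a) (ω := t) (b := 0) (c := m)]
    · ring
    · exact htK
    · rw [ht]; simp
    · exact hirr
    · intro x hx hxi
      obtain ⟨U, V, hUV, hd⟩ := hchar x hx hxi
      have hm4 : m % 4 ≠ 0 := by
        intro h0
        have := Int.isUnit_iff.1 (hm 2 (by omega))
        omega
      have hpar : (2 : ℤ) ∣ U ∧ (2 : ℤ) ∣ V := by
        have h1 : (U ^ 2 - m * V ^ 2) % 4 = 0 := Int.emod_eq_zero_of_dvd hd
        have hm' : m % 4 = 2 ∨ m % 4 = 3 := by omega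
        rw [Int.sub_emod, Int.mul_emod, pow_two, pow_two, Int.mul_emod U, Int.mul_emod V] at h1
        have hu : U % 4 = 0 ∨ U % 4 = 1 ∨ U % 4 = 2 ∨ U % 4 = 3 := by omega
        have hv : V % 4 = 0 ∨ V % 4 = 1 ∨ V % 4 = 2 ∨ V % 4 = 3 := by omega
        rcases hm' with hm' | hm' <;> rcases hu with hu | hu | hu | hu <;>
          rcases hv with hv | hv | hv | hv <;> rw [hm', hu, hv] at h1 <;>
          first
          | (exfalso; revert h1; decide)
          | omega
      obtain ⟨⟨u, hu⟩, ⟨v, hv⟩⟩ := hpar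
      refine ⟨u, v, ?_⟩
      subst hu hv
      push_cast at hUV
      linear_combination (1 / 2 : ℂ) * hUV

/-- The shape of `Δ_a` in terms of the squarefree part of `a`. -/
theorem exists_squarefree_part {a : ℤ} (ha : a ≠ -1 ∧ ¬ IsSquare a) :
    ∃ m r : ℤ, Squarefree m ∧ m ≠ 1 ∧ r ≠ 0 ∧ a = m * r ^ 2 ∧
      disc a = if m % 4 = 1 then m else 4 * m := by
  obtain ⟨n, r, hnr, hn⟩ := Nat.sq_mul_squarefree a.natAbs
  have ha0 := ne_zero_of_not_isSquare ha
  have hr : (r : ℤ) ≠ 0 := by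
    rintro h
    have h' : r = 0 := by exact_mod_cast h
    subst h'
    simp at hnr
    exact ha0 (Int.natAbs_eq_zero.1 hnr.symm)
  have har : a = (a.sign * n) * (r : ℤ) ^ 2 := by
    conv_lhs => rw [← Int.sign_mul_natAbs a, ← hnr]
    push_cast
    ring
  have hs : Squarefree (a.sign * n : ℤ) := by
    rw [← Int.squarefree_natAbs, Int.natAbs_mul, Int.natAbs_sign_of_ne_zero ha0, one_mul,
      Int.natAbs_natCast]
    exact hn
  have h1 : (a.sign * n : ℤ) ≠ 1 := by
    intro h
    rw [h, one_mul] at har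
    exact ha.2 ⟨r, by rw [har, sq]⟩
  exact ⟨_, r, hs, h1, hr, har, disc_eq_of_squarefree hs h1 hr har⟩

/-! ### Square roots in cyclotomic fields and the Kronecker symbol -/

/-- `τ` raises the `N`-th roots of unity to the `x`-th power. -/
def ActsBy (τ : ℂ ≃ₐ[ℚ] ℂ) (N x : ℕ) : Prop := ∀ ζ : ℂ, ζ ^ N = 1 → τ ζ = ζ ^ x

theorem ActsBy.of_dvd {τ : ℂ ≃ₐ[ℚ] ℂ} {M N x : ℕ} (h : ActsBy τ N x) (hd : M ∣ N) :
    ActsBy τ M x := by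
  intro ζ hζ
  obtain ⟨c, rfl⟩ := hd
  exact h ζ (by rw [pow_mul, hζ, one_pow])

/-- The root is the quadratic Gauss sum: replacing its additive character by the x-th power
multiplies it by the quadratic character of x. -/
theorem exists_sqrt_prime {p : ℕ} (hp : p.Prime) (hp2 : p ≠ 2) :
    ∃ s : ℂ, s ^ 2 = ((ZMod.χ₄ p * p : ℤ) : ℂ) ∧ ∀ (τ : ℂ ≃ₐ[ℚ] ℂ) (x : ℕ), x.Coprime p →
      ActsBy τ p x → τ s = (jacobiSym x p : ℂ) * s := by
  have : Fact p.Prime := ⟨hp⟩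
  have : NeZero p := ⟨hp.ne_zero⟩
  have hchar : ringChar (ZMod p) ≠ 2 := by rwa [ZMod.ringChar_zmod_n]
  let χ : MulChar (ZMod p) ℂ := (quadraticChar (ZMod p)).ringHomComp (Int.castRingHom ℂ)
  have hχ : ∀ y : ZMod p, χ y = ((quadraticChar (ZMod p) y : ℤ) : ℂ) := fun y => rfl
  have hχ1 : χ ≠ 1 := by
    rw [MulChar.ringHomComp_ne_one_iff (RingHom.injective_int _)]
    exact quadraticChar_ne_one hchar
  let ψ : AddChar (ZMod p) ℂ := ZMod.stdAddChar
  refine ⟨gaussSum χ ψ, ?_, fun τ x hx hτ => ?_⟩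
  · rw [gaussSum_sq hχ1 ((quadraticChar_isQuadratic _).comp _) (ZMod.isPrimitive_stdAddChar p), hχ,
      quadraticChar_neg_one hchar, ZMod.card]
    push_cast
    rfl
  · have hψ : ∀ y : ZMod p, τ (ψ y) = ψ (x * y) := by
      intro y
      have h1 : ψ y ^ p = 1 := by
        rw [← AddChar.map_nsmul_eq_pow]
        simp
      rw [hτ _ h1, ← AddChar.map_nsmul_eq_pow, nsmul_eq_mul]
    have h2 : τ (gaussSum χ ψ) = gaussSum χ (ψ.mulShift x) := by
      rw [gaussSum, gaussSum, map_sum]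
      refine Finset.sum_congr rfl fun y _ => ?_
      rw [map_mul, hψ, hχ, map_intCast, AddChar.mulShift_apply]
    have h3 := gaussSum_mulShift χ ψ (ZMod.unitOfCoprime x hx)
    rw [ZMod.coe_unitOfCoprime] at h3
    have h4 : χ x = (jacobiSym x p : ℂ) := by
      rw [hχ, ← jacobiSym.legendreSym.to_jacobiSym, legendreSym, Int.cast_natCast]
    have h5 : (jacobiSym x p : ℂ) ^ 2 = 1 := by
      have := jacobiSym.sq_one (a := x) (b := p) (by simpa using hx)
      exact_mod_cast congrArg (Int.cast (R := ℂ)) this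
    rw [h2, ← h3, h4, ← mul_assoc, ← sq, h5, one_mul]

theorem exists_sqrt_odd {n : ℕ} (hn : Odd n) :
    ∃ s : ℂ, s ^ 2 = ((ZMod.χ₄ n * n : ℤ) : ℂ) ∧ ∀ (τ : ℂ ≃ₐ[ℚ] ℂ) (x : ℕ), x.Coprime n →
      ActsBy τ n x → τ s = (jacobiSym x n : ℂ) * s := by
  induction n using Nat.recOnMul with
  | zero => simp at hn
  | one => exact ⟨1, by simp, fun τ x _ _ => by simp⟩
  | prime p hp =>
    refine exists_sqrt_prime hp ?_
    rintro rfl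
    exact absurd hn (by decide)
  | mul a b iha ihb =>
    have hab := Nat.odd_mul.1 hn
    obtain ⟨s, hs, hsτ⟩ := iha hab.1
    obtain ⟨t, ht, htτ⟩ := ihb hab.2
    refine ⟨s * t, ?_, fun τ x hx hτ => ?_⟩
    · rw [mul_pow, hs, ht]
      push_cast
      rw [map_mul]
      push_cast
      ring
    · rw [map_mul, hsτ τ x (hx.coprime_dvd_right (Dvd.intro _ rfl)) (hτ.of_dvd (Dvd.intro _ rfl)),
        htτ τ x (hx.coprime_dvd_right (Dvd.intro_left _ rfl)) (hτ.of_dvd (Dvd.intro_left _ rfl)),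
        jacobiSym.mul_right' _ hab.1.pos.ne' hab.2.pos.ne']
      push_cast
      ring

theorem aut_I {τ : ℂ ≃ₐ[ℚ] ℂ} {x : ℕ} (hx : Odd x) (hτ : ActsBy τ 4 x) :
    τ Complex.I = (ZMod.χ₄ x : ℂ) * Complex.I := by
  rw [hτ _ Complex.I_pow_four, ZMod.χ₄_nat_eq_if_mod_four]
  have h2 : x % 2 = 1 := Nat.odd_iff.1 hx
  have h4 : x = 4 * (x / 4) + x % 4 := (Nat.div_add_mod x 4).symm
  rw [h4, pow_add, pow_mul, Complex.I_pow_four, one_pow, one_mul, ← h4]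
  have : x % 4 = 1 ∨ x % 4 = 3 := by omega
  rcases this with h | h <;> simp [h, h2, Complex.I_pow_three]

theorem exists_sqrt_two :
    ∃ s : ℂ, s ^ 2 = 2 ∧ ∀ (τ : ℂ ≃ₐ[ℚ] ℂ) (x : ℕ), Odd x → ActsBy τ 8 x →
      τ s = (ZMod.χ₈ x : ℂ) * s := by
  have hp := Complex.isPrimitiveRoot_exp 8 (by norm_num)
  set ζ := Complex.exp (2 * Real.pi * Complex.I / (8 : ℕ))
  have h8 : ζ ^ 8 = 1 := hp.pow_eq_one
  have h4 : ζ ^ 4 = -1 := by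
    have h : (ζ ^ 4) ^ 2 = 1 := by rw [← pow_mul, h8]
    rcases sq_eq_sq_iff_eq_or_eq_neg.1 (h.trans (one_pow 2).symm) with h | h
    · exact absurd ((hp.pow_eq_one_iff_dvd 4).1 h) (by norm_num)
    · exact h
  -- For ζ = exp(πi/4) one has -ζ³ = ζ⁻¹, so this is 2 cos(π/4).
  refine ⟨ζ - ζ ^ 3, ?_, fun τ x hx hτ => ?_⟩
  · linear_combination (ζ ^ 2 - 2) * h4
  · have hx8 : τ ζ = ζ ^ (x % 8) := by
      rw [hτ ζ h8]
      conv_lhs => rw [← Nat.div_add_mod x 8, pow_add, pow_mul, h8, one_pow, one_mul]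
    rw [map_sub, map_pow, hx8, ZMod.χ₈_nat_eq_if_mod_eight]
    have h2 : x % 2 = 1 := Nat.odd_iff.1 hx
    have : x % 8 = 1 ∨ x % 8 = 3 ∨ x % 8 = 5 ∨ x % 8 = 7 := by omega
    rcases this with h | h | h | h <;> simp only [h, h2] <;> norm_num
    · linear_combination (ζ ^ 5 - ζ) * h4
    · linear_combination (ζ - ζ ^ 11 + ζ ^ 7 - ζ ^ 3) * h4
    · linear_combination (ζ ^ 3 - ζ ^ 17 + ζ ^ 13 - ζ ^ 9 + ζ ^ 5 - ζ) * h4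

/-- Quadratic reciprocity with its sign absorbed: the signed number is 1 modulo 4. -/
theorem jacobiSym_chi_mul_self {n y : ℕ} (hn : Odd n) (hy : Odd y) :
    jacobiSym (ZMod.χ₄ n * n) y = jacobiSym y n := by
  have hn2 : n % 2 = 1 := Nat.odd_iff.1 hn
  have hy2 : y % 2 = 1 := Nat.odd_iff.1 hy
  rw [ZMod.χ₄_nat_eq_if_mod_four]
  have hn4 : n % 4 = 1 ∨ n % 4 = 3 := by omega
  have hy4 : y % 4 = 1 ∨ y % 4 = 3 := by omega
  rcases hn4 with h | h
  · simp only [hn2, h]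
    norm_num
    exact jacobiSym.quadratic_reciprocity_one_mod_four h hy
  · simp only [hn2, h]
    norm_num
    rw [neg_eq_neg_one_mul, jacobiSym.mul_left, jacobiSym.at_neg_one hy,
      ZMod.χ₄_nat_eq_if_mod_four]
    rcases hy4 with h' | h'
    · simp only [hy2, h']
      norm_num
      exact jacobiSym.quadratic_reciprocity_one_mod_four' hn h'
    · simp only [hy2, h']
      norm_num
      rw [jacobiSym.quadratic_reciprocity_three_mod_four h h', neg_neg]

theorem kronecker_natCast_of_odd {D : ℤ} {x : ℕ} (hx : Odd x) :
    kronecker D x = jacobiSym D x := by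
  have h0 : (x : ℤ) ≠ 0 := by exact_mod_cast hx.pos.ne'
  have h1 : ¬ ((x : ℤ) < 0 ∧ D < 0) := by omega
  have h2 : x.factorization 2 = 0 :=
    Nat.factorization_eq_zero_of_not_dvd hx.not_two_dvd_nat
  rw [kronecker, if_neg h0, if_neg h1, Int.natAbs_natCast, h2, pow_zero, pow_zero, Nat.div_one,
    one_mul, one_mul]

theorem kronecker_chi_mul_self {n x : ℕ} (hn : Odd n) (hx : x ≠ 0) :
    kronecker (ZMod.χ₄ n * n) x = jacobiSym x n := by
  have h0 : (x : ℤ) ≠ 0 := by exact_mod_cast hx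
  have h1 : ¬ ((x : ℤ) < 0 ∧ (ZMod.χ₄ n * n : ℤ) < 0) := by omega
  have hyo : Odd (x / 2 ^ x.factorization 2) :=
    Nat.odd_iff.2 (Nat.two_dvd_ne_zero.1 (Nat.not_dvd_ordCompl Nat.prime_two hx))
  rw [kronecker, if_neg h0, if_neg h1, Int.natAbs_natCast, one_mul,
    jacobiSym_chi_mul_self hn hyo]
  have hx' : (x : ℤ) = 2 ^ x.factorization 2 * ((x / 2 ^ x.factorization 2 : ℕ) : ℤ) := by
    exact_mod_cast (Nat.ordProj_mul_ordCompl_eq_self x 2).symm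
  conv_rhs => rw [hx', jacobiSym.mul_left, jacobiSym.pow_left, jacobiSym.at_two hn]
  congr 2
  rw [ZMod.χ₈_nat_eq_if_mod_eight, ZMod.χ₄_nat_eq_if_mod_four]
  have hn2 : n % 2 = 1 := Nat.odd_iff.1 hn
  by_cases h4 : n % 4 = 1
  · simp only [hn2, h4]
    norm_num
    rw [if_neg (by omega)]
    congr 1
    apply propext
    omega
  · simp only [hn2, h4]
    norm_num
    rw [if_neg (by omega)]
    congr 1
    apply propext
    omega

/-- A square root of `a` on which automorphisms act through the Kronecker symbol of `Δ_a`. -/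
theorem exists_sqrt_kronecker {a : ℤ} (ha : a ≠ -1 ∧ ¬ IsSquare a) :
    ∃ s : ℂ, s ^ 2 = a ∧ ∀ (τ : ℂ ≃ₐ[ℚ] ℂ) (x : ℕ), x ≠ 0 → x.Coprime (disc a).natAbs →
      ActsBy τ (disc a).natAbs x → τ s = (kronecker (disc a) x : ℂ) * s := by
  obtain ⟨m, r, hm, hm1, hr, har, hdisc⟩ := exists_squarefree_part ha
  suffices H : ∃ s : ℂ, s ^ 2 = m ∧ ∀ (τ : ℂ ≃ₐ[ℚ] ℂ) (x : ℕ), x ≠ 0 →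
      x.Coprime (disc a).natAbs →
      ActsBy τ (disc a).natAbs x → τ s = (kronecker (disc a) x : ℂ) * s by
    obtain ⟨s, hs, hτ⟩ := H
    refine ⟨s * r, by rw [mul_pow, hs, har]; push_cast; ring, fun τ x hx0 hx h => ?_⟩
    rw [map_mul, map_intCast, hτ τ x hx0 hx h]
    ring
  -- The sign makes ±j congruent to 1 modulo 4. Thus √m is a Gauss sum root, multiplied by i, by √2
  -- or by both as needed, and the cases below are the three shapes of a fundamental discriminant.
  have hchi : ∀ j : ℤ, j % 2 = 1 →
      (ZMod.χ₄ (j.natAbs : ℕ) * j.natAbs : ℤ) = if j % 4 = 1 then j else -j := by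
    intro j hj
    rw [ZMod.χ₄_nat_eq_if_mod_four]
    rcases abs_cases j with ⟨h, h'⟩ | ⟨h, h'⟩ <;> split_ifs <;> omega
  have hodd : ∀ j : ℤ, j % 2 = 1 → Odd j.natAbs := fun j hj => Nat.odd_iff.2 (by omega)
  have hmul4 : ∀ (x : ℕ) (c : ℤ), Odd x → kronecker (4 * c) x = jacobiSym c x := by
    intro x c hx
    rw [kronecker_natCast_of_odd hx, show (4 : ℤ) = 2 ^ 2 by norm_num, jacobiSym.mul_left,
      jacobiSym.pow_left, jacobiSym.sq_one, one_mul]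
    simpa [Int.gcd] using (Nat.coprime_two_left.2 hx)
  rw [hdisc]
  have hm4 : m % 4 ≠ 0 := by
    intro h0
    have := Int.isUnit_iff.1 (hm 2 (by omega))
    omega
  split_ifs with h1
  · obtain ⟨s, hs, hτ⟩ := exists_sqrt_odd (hodd m (by omega))
    rw [hchi m (by omega), if_pos h1] at hs
    refine ⟨s, hs, fun τ x hx0 hx h => ?_⟩
    have e := kronecker_chi_mul_self (hodd m (by omega)) hx0
    rw [hchi m (by omega), if_pos h1] at e
    rw [hτ τ x hx h, e]
  · have hxodd : ∀ x : ℕ, x.Coprime (4 * m).natAbs → Odd x := fun x hx => by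
      refine Nat.coprime_two_right.1 (hx.coprime_dvd_right ?_)
      rw [Int.natAbs_mul]
      exact Dvd.dvd.mul_right (by decide) _
    have hIsq : ∀ s : ℂ, (Complex.I * s) ^ 2 = -(s ^ 2) := fun s => by
      rw [mul_pow, Complex.I_sq]; ring
    by_cases h3 : m % 2 = 1
    · obtain ⟨s, hs, hτ⟩ := exists_sqrt_odd (hodd m h3)
      rw [hchi m h3, if_neg h1] at hs
      refine ⟨Complex.I * s, by rw [hIsq, hs]; simp, fun τ x hx0 hx h => ?_⟩
      have hxo := hxodd x hx
      have e := jacobiSym_chi_mul_self (hodd m h3) hxo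
      rw [hchi m h3, if_neg h1] at e
      have hdm : m.natAbs ∣ (4 * m).natAbs := by rw [Int.natAbs_mul]; exact Dvd.intro_left _ rfl
      have hd4 : 4 ∣ (4 * m).natAbs := by rw [Int.natAbs_mul]; exact Dvd.intro _ rfl
      rw [map_mul, hτ τ x (hx.coprime_dvd_right hdm) (h.of_dvd hdm), aut_I hxo (h.of_dvd hd4),
        hmul4 _ _ hxo, show m = -1 * (-m) by ring, jacobiSym.mul_left, jacobiSym.at_neg_one hxo, e]
      rw [show (-1 * -m) = m by ring]
      push_cast
      ring
    · obtain ⟨j, rfl⟩ : ∃ j, m = 2 * j := ⟨m / 2, by omega⟩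
      have hj : j % 2 = 1 := by omega
      obtain ⟨s, hs, hτ⟩ := exists_sqrt_odd (hodd j hj)
      obtain ⟨w, hw, hwτ⟩ := exists_sqrt_two
      have hdj : j.natAbs ∣ (4 * (2 * j)).natAbs := by
        rw [← mul_assoc, Int.natAbs_mul]; exact Dvd.intro_left _ rfl
      have hd4 : 4 ∣ (4 * (2 * j)).natAbs := by rw [Int.natAbs_mul]; exact Dvd.intro _ rfl
      have hd8 : 8 ∣ (4 * (2 * j)).natAbs := by
        rw [← mul_assoc, Int.natAbs_mul]; exact Dvd.intro _ rfl
      rw [hchi j hj] at hs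
      split_ifs at hs with hj4
      · refine ⟨w * s, by rw [mul_pow, hw, hs]; push_cast; ring, fun τ x hx0 hx h => ?_⟩
        have hxo := hxodd x hx
        have e := jacobiSym_chi_mul_self (hodd j hj) hxo
        rw [hchi j hj, if_pos hj4] at e
        rw [map_mul, hτ τ x (hx.coprime_dvd_right hdj) (h.of_dvd hdj), hwτ τ x hxo (h.of_dvd hd8),
          hmul4 _ _ hxo, jacobiSym.mul_left, jacobiSym.at_two hxo, e]
        push_cast
        ring
      · refine ⟨w * (Complex.I * s), by rw [mul_pow, hIsq, hw, hs]; push_cast; ring,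
          fun τ x hx0 hx h => ?_⟩
        have hxo := hxodd x hx
        have e := jacobiSym_chi_mul_self (hodd j hj) hxo
        rw [hchi j hj, if_neg hj4] at e
        rw [map_mul, map_mul, hτ τ x (hx.coprime_dvd_right hdj) (h.of_dvd hdj),
          hwτ τ x hxo (h.of_dvd hd8), aut_I hxo (h.of_dvd hd4), hmul4 _ _ hxo, jacobiSym.mul_left,
          jacobiSym.at_two hxo, show j = -1 * (-j) by ring, jacobiSym.mul_left,
          jacobiSym.at_neg_one hxo, e, show (-1 * -j) = j by ring]
        push_cast
        ring

/-! ### The shape of the discriminant -/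

theorem disc_ne_zero (a : ℤ) : disc a ≠ 0 := NumberField.discr_ne_zero _

theorem natAbs_disc_pos (a : ℤ) : 0 < (disc a).natAbs := Int.natAbs_pos.2 (disc_ne_zero a)

instance (a : ℤ) : NeZero (disc a).natAbs := ⟨(natAbs_disc_pos a).ne'⟩

/-- The three shapes of a fundamental discriminant. -/
theorem disc_cases {a : ℤ} (ha : a ≠ -1 ∧ ¬ IsSquare a) : ∃ m : ℤ, m % 2 = 1 ∧ Squarefree m ∧
    ((disc a = m ∧ m % 4 = 1 ∧ m ≠ 1) ∨ (disc a = 4 * m ∧ m % 4 = 3) ∨ disc a = 8 * m) := by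
  obtain ⟨m, r, hm, hm1, -, -, hd⟩ := exists_squarefree_part ha
  have hm4 : m % 4 ≠ 0 := by
    intro h0
    have := Int.isUnit_iff.1 (hm 2 (by omega))
    omega
  split_ifs at hd with h1
  · exact ⟨m, by omega, hm, Or.inl ⟨hd, h1, hm1⟩⟩
  · by_cases h2 : m % 2 = 1
    · exact ⟨m, h2, hm, Or.inr (Or.inl ⟨hd, by omega⟩)⟩
    · refine ⟨m / 2, by omega, hm.squarefree_of_dvd ⟨2, by omega⟩, Or.inr (Or.inr (by omega))⟩

theorem three_le_natAbs_disc {a : ℤ} (ha : a ≠ -1 ∧ ¬ IsSquare a) : 3 ≤ (disc a).natAbs := by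
  obtain ⟨m, hm2, -, ⟨h, h4, h1⟩ | ⟨h, -⟩ | h⟩ := disc_cases ha <;> omega

theorem four_dvd_disc_of_two_dvd {a : ℤ} (ha : a ≠ -1 ∧ ¬ IsSquare a) (h2 : 2 ∣ (disc a).natAbs) :
    4 ∣ (disc a).natAbs := by
  obtain ⟨m, hm2, -, ⟨h, -⟩ | ⟨h, -⟩ | h⟩ := disc_cases ha <;> omega

theorem disc_emod_four_of_odd {a : ℤ} (ha : a ≠ -1 ∧ ¬ IsSquare a) (h2 : ¬ 2 ∣ (disc a).natAbs) :
    disc a % 4 = 1 := by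
  obtain ⟨m, hm2, -, ⟨h, h4, -⟩ | ⟨h, -⟩ | h⟩ := disc_cases ha <;> omega

/-! ### Square roots of `a` in cyclotomic fields -/

theorem actsBy_iff_cyc_eq {q : ℕ} [NeZero q] {τ : ℂ ≃ₐ[ℚ] ℂ} {x : ℕ} :
    ActsBy τ q x ↔ (cyc q τ : ZMod q) = x := (cyc_eq_iff τ x).symm

theorem aut_fixes_cycloField {N : ℕ} [NeZero N] {τ : ℂ ≃ₐ[ℚ] ℂ} (h : cyc N τ = 1) {x : ℂ}
    (hx : x ∈ cycloField N) : τ x = x :=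
  aut_eq_on_cycloField (τ := 1) (by rw [h, map_one]) hx

/-- An automorphism trivial on the |Δ_a|-th roots of unity acts on √a by the Kronecker symbol at 1,
which is 1. -/
theorem mem_cycloField_disc {a : ℤ} (ha : a ≠ -1 ∧ ¬ IsSquare a) {x : ℂ} (hx : x ^ 2 = a) :
    x ∈ cycloField (disc a).natAbs := by
  obtain ⟨s, hs, hτ⟩ := exists_sqrt_kronecker ha
  have hmem : s ∈ cycloField (disc a).natAbs := by
    refine mem_of_forall_aut_fixed (isIntegral_of_pow_eq_intCast two_pos hs) fun τ hfix => ?_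
    rw [hτ τ 1 one_ne_zero (Nat.coprime_one_left _) fun ζ hζ => by
      rw [pow_one]; exact hfix ζ (subset_adjoin ℚ _ hζ)]
    have : kronecker (disc a) (1 : ℕ) = 1 := by
      rw [kronecker_natCast_of_odd odd_one]; simp
    rw [this, Int.cast_one, one_mul]
  rcases sq_eq_sq_iff_eq_or_eq_neg.1 (hx.trans hs.symm) with h | h
  · rw [h]; exact hmem
  · rw [h]; exact neg_mem hmem

/-- The action on square roots of `a`, in terms of the action on roots of unity. -/
theorem aut_sqrt {a : ℤ} (ha : a ≠ -1 ∧ ¬ IsSquare a) {τ : ℂ ≃ₐ[ℚ] ℂ} {x : ℕ}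
    (hx0 : x ≠ 0) (hx : x.Coprime (disc a).natAbs) (h : ActsBy τ (disc a).natAbs x) {z : ℂ}
    (hz : z ^ 2 = a) : τ z = (kronecker (disc a) x : ℂ) * z := by
  obtain ⟨s, hs, hτ⟩ := exists_sqrt_kronecker ha
  rcases sq_eq_sq_iff_eq_or_eq_neg.1 (hz.trans hs.symm) with e | e
  · rw [e, hτ τ x hx0 hx h]
  · rw [e, map_neg, hτ τ x hx0 hx h]; ring

theorem jacobiSym_of_modEq_one {x n : ℕ} (h : x ≡ 1 [MOD n]) : jacobiSym x n = 1 := by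
  have h1 : (x : ℤ) % n = 1 % n := by
    have := (Int.natCast_modEq_iff).2 h
    simpa [Int.ModEq] using this
  rw [jacobiSym.mod_left, h1, ← jacobiSym.mod_left, jacobiSym.one_left]

theorem jacobiSym_of_modEq_four {m : ℤ} {x : ℕ} (hm : m % 2 = 1) (hx : x % 4 = 1)
    (h : x ≡ 1 [MOD m.natAbs]) : jacobiSym m x = 1 := by
  have hn : Odd m.natAbs := Nat.odd_iff.2 (by omega)
  have hxo : Odd x := Nat.odd_iff.2 (by omega)
  have e := jacobiSym_chi_mul_self hn hxo
  rw [jacobiSym_of_modEq_one h] at e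
  have hneg : jacobiSym (-1) x = 1 := by
    rw [jacobiSym.at_neg_one hxo, ZMod.χ₄_nat_eq_if_mod_four]
    simp [hx, Nat.odd_iff.1 hxo]
  rw [ZMod.χ₄_nat_eq_if_mod_four] at e
  have hcases : (if m.natAbs % 2 = 0 then (0 : ℤ) else if m.natAbs % 4 = 1 then 1 else -1) *
      m.natAbs = m ∨ (if m.natAbs % 2 = 0 then (0 : ℤ) else if m.natAbs % 4 = 1 then 1 else -1) *
      m.natAbs = -1 * m := by
    split_ifs <;> omega
  rcases hcases with h' | h' <;> rw [h'] at e
  · exact e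
  · rwa [jacobiSym.mul_left, hneg, one_mul] at e

theorem kronecker_four_mul {c : ℤ} {x : ℕ} (hx : Odd x) :
    kronecker (4 * c) x = jacobiSym c x := by
  rw [kronecker_natCast_of_odd hx, show (4 : ℤ) = 2 ^ 2 by norm_num, jacobiSym.mul_left,
    jacobiSym.pow_left, jacobiSym.sq_one, one_mul]
  simpa [Int.gcd] using (Nat.coprime_two_left.2 hx)

/-- Modulo `N` with `ν₂(N) < ν₂(Δ_a)` the square roots of `a` are not cyclotomic. -/
theorem not_mem_cycloField_of_val_lt {a : ℤ} (ha : a ≠ -1 ∧ ¬ IsSquare a) {N : ℕ} [NeZero N]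
    (h : padicValNat 2 N < padicValNat 2 (disc a).natAbs) : ¬ ∃ x ∈ cycloField N, x ^ 2 = (a : ℂ) := by
  rintro ⟨z, hzN, hz⟩
  have : Fact (Nat.Prime 2) := ⟨Nat.prime_two⟩
  obtain ⟨N', hN'⟩ : 2 ^ padicValNat 2 N ∣ N := pow_padicValNat_dvd
  have hN'odd : N' % 2 = 1 := by
    by_contra hc
    have h2 : 2 ∣ N' := by omega
    obtain ⟨c, rfl⟩ := h2
    refine pow_succ_padicValNat_not_dvd (p := 2) (NeZero.ne N) ⟨c, ?_⟩
    rw [pow_succ, mul_assoc]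
    exact hN'
  obtain ⟨m, hm2, -, hd⟩ := disc_cases ha
  have hmodd : ¬ 2 ∣ m.natAbs := by omega
  have hv : ∀ e : ℕ, (disc a).natAbs = 2 ^ e * m.natAbs →
      padicValNat 2 (disc a).natAbs = e := by
    intro e he
    rw [he, padicValNat.mul (by positivity) (by omega), padicValNat.prime_pow,
      padicValNat.eq_zero_of_not_dvd hmodd, add_zero]
  obtain ⟨e, he, hde⟩ : ∃ e, (e = 2 ∧ disc a = 4 * m ∧ m % 4 = 3 ∨ e = 3 ∧ disc a = 8 * m) ∧
      (disc a).natAbs = 2 ^ e * m.natAbs := by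
    rcases hd with ⟨h1, -, -⟩ | ⟨h1, h2⟩ | h1
    · have := hv 0 (by rw [h1]; simp)
      omega
    · exact ⟨2, Or.inl ⟨rfl, h1, h2⟩, by rw [h1, Int.natAbs_mul]; rfl⟩
    · exact ⟨3, Or.inr ⟨rfl, h1⟩, by rw [h1, Int.natAbs_mul]; rfl⟩
  rw [hv e hde] at h
  obtain ⟨f, rfl⟩ : ∃ f, e = f + 1 := ⟨e - 1, by omega⟩
  set c := N' * m.natAbs with hc
  have hcodd : c % 2 = 1 := by rw [hc, Nat.mul_mod, hN'odd, show m.natAbs % 2 = 1 by omega]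
  -- x is 1 modulo N and modulo the odd part of Δ_a, but 1 + 2^f modulo 2^{f+1}, the full 2-part of
  -- Δ_a. So x is 3 mod 4 or 5 mod 8, the Kronecker symbol is -1, and an automorphism of type x
  -- would both fix and negate √a.
  set x := 1 + 2 ^ f * c with hx
  have hxN : N ∣ 2 ^ f * c := by
    rw [hN', hc, ← mul_assoc]
    exact Dvd.dvd.mul_right (mul_dvd_mul_right (pow_dvd_pow 2 (by omega)) N') _
  have hxm : x ≡ 1 [MOD m.natAbs] := by
    have : m.natAbs ∣ 2 ^ f * c := ⟨2 ^ f * N', by rw [hc]; ring⟩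
    calc x ≡ 1 + 0 [MOD m.natAbs] := (Nat.ModEq.refl 1).add (Nat.modEq_zero_iff_dvd.2 this)
      _ = 1 := rfl
  have hxodd : Odd x := by
    refine Nat.odd_iff.2 ?_
    have : f = 1 ∨ f = 2 := by omega
    rcases this with rfl | rfl <;> omega
  have hkron : kronecker (disc a) x = -1 := by
    rcases he with ⟨e2, hda, hm3⟩ | ⟨e3, hda⟩
    · have hf : f = 1 := by omega
      subst hf
      have hn : Odd m.natAbs := Nat.odd_iff.2 (by omega)
      have hx4 : x % 4 = 3 := by omega
      rw [hda, kronecker_four_mul hxodd, show m = -1 * -m by ring, jacobiSym.mul_left,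
        jacobiSym.at_neg_one hxodd, ZMod.χ₄_nat_eq_if_mod_four]
      have e := jacobiSym_chi_mul_self hn hxodd
      rw [jacobiSym_of_modEq_one hxm, ZMod.χ₄_nat_eq_if_mod_four] at e
      have h' : (if m.natAbs % 2 = 0 then (0 : ℤ) else if m.natAbs % 4 = 1 then 1 else -1) *
        m.natAbs = -m := by split_ifs <;> omega
      rw [h'] at e
      rw [e]
      simp [hx4, Nat.odd_iff.1 hxodd]
    · have hf : f = 2 := by omega
      subst hf
      have hx8 : x % 8 = 5 := by omega
      rw [hda, show (8 * m) = 4 * (2 * m) by ring, kronecker_four_mul hxodd, jacobiSym.mul_left,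
        jacobiSym_of_modEq_four hm2 (by omega) hxm, jacobiSym.at_two hxodd,
        ZMod.χ₈_nat_eq_if_mod_eight]
      simp [hx8, Nat.odd_iff.1 hxodd]
  have hxco : x.Coprime (disc a).natAbs := by
    rw [hde]
    refine Nat.Coprime.mul_right (Nat.Coprime.pow_right _ (Nat.coprime_two_right.2 hxodd)) ?_
    have := hxm.gcd_eq
    rw [Nat.Coprime, this, Nat.gcd_one_left]
  have hxcoN : x.Coprime N := by
    have h1 : x ≡ 1 [MOD N] := by
      calc x ≡ 1 + 0 [MOD N] := (Nat.ModEq.refl 1).add (Nat.modEq_zero_iff_dvd.2 hxN)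
        _ = 1 := rfl
    rw [Nat.Coprime, h1.gcd_eq, Nat.gcd_one_left]
  let M := N * (disc a).natAbs
  have : NeZero M := ⟨mul_ne_zero (NeZero.ne N) (NeZero.ne _)⟩
  obtain ⟨τ, hτ⟩ := cyc_surjective M (ZMod.unitOfCoprime x (hxcoN.mul_right hxco))
  have hact : ActsBy τ M x := actsBy_iff_cyc_eq.2 (by rw [hτ, ZMod.coe_unitOfCoprime])
  have h1 : τ z = z := by
    refine aut_fixes_cycloField (N := N) (Units.ext ?_) hzN
    rw [actsBy_iff_cyc_eq.1 (hact.of_dvd (Dvd.intro _ rfl)), Units.val_one, ← Nat.cast_one,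
      ZMod.natCast_eq_natCast_iff]
    calc x ≡ 1 + 0 [MOD N] := (Nat.ModEq.refl 1).add (Nat.modEq_zero_iff_dvd.2 hxN)
      _ = 1 := rfl
  have h2 := aut_sqrt ha hxodd.pos.ne' hxco (hact.of_dvd (Dvd.intro_left _ rfl)) hz
  rw [h1, hkron] at h2
  have hz0 : z = 0 := by
    push_cast at h2
    linear_combination (1 / 2 : ℂ) * h2
  rw [hz0, zero_pow two_ne_zero] at hz
  exact ne_zero_of_not_isSquare ha (by exact_mod_cast hz.symm)

/-! ### Explicit description of the subgroup -/

theorem coe_unitsMap {q d : ℕ} [NeZero d] (h : q ∣ d) (u : (ZMod d)ˣ) :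
    ((ZMod.unitsMap h u : (ZMod q)ˣ) : ZMod q) = ((u : ZMod d).val : ZMod q) := by
  rw [ZMod.unitsMap_def, Units.coe_map, MonoidHom.coe_coe, ZMod.castHom_apply, ZMod.cast_eq_val]

/-- Common criterion for membership: once the class is lifted to a modulus N divisible by k, with
trivial image modulo k, only a cyclotomic √a can obstruct. -/
theorem unitsMap_mem_kummerSubgroup {a : ℤ} (ha : a ≠ -1 ∧ ¬ IsSquare a) {q k N : ℕ} [NeZero q]
    [NeZero N] (hk : Squarefree k) (hq : q ∣ N) (hkN : k ∣ N) {y : (ZMod N)ˣ}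
    (hy : ZMod.unitsMap hkN y = 1)
    (h2 : 2 ∣ k → ∀ τ : ℂ ≃ₐ[ℚ] ℂ, cyc N τ = y → ∀ x ∈ cycloField N, x ^ 2 = (a : ℂ) → τ x = x) :
    ZMod.unitsMap hq y ∈ kummerSubgroup a q k := by
  have : NeZero k := ⟨hk.ne_zero⟩
  obtain ⟨τ₀, hτ₀⟩ := cyc_surjective N y
  obtain ⟨τ, hτ, hc⟩ := exists_aut_fixing_kummerField ha hk hkN τ₀
    (cyc_eq_one_iff.1 (by rw [← unitsMap_cyc hkN, hτ₀, hy])) (fun h => h2 h τ₀ hτ₀)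
  exact mem_kummerSubgroup.2 ⟨τ, hτ, by rw [← unitsMap_cyc hq, hc, hτ₀]⟩

theorem exists_unit_lcm {q L : ℕ} [NeZero q] [NeZero L] (b : (ZMod q)ˣ)
    (hb : ZMod.unitsMap (Nat.gcd_dvd_left q L) b = 1) :
    ∃ y : (ZMod (q.lcm L))ˣ, ZMod.unitsMap (Nat.dvd_lcm_left q L) y = b ∧
      ZMod.unitsMap (Nat.dvd_lcm_right q L) y = 1 := by
  have : NeZero (q.lcm L) := ⟨Nat.lcm_ne_zero (NeZero.ne q) (NeZero.ne L)⟩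
  have hmod : (b : ZMod q).val ≡ 1 [MOD q.gcd L] := by
    have h1 := congrArg Units.val hb
    rwa [coe_unitsMap, Units.val_one, ← Nat.cast_one, ZMod.natCast_eq_natCast_iff] at h1
  obtain ⟨x, hxq, hxL⟩ := Nat.chineseRemainder' hmod
  have hcq : x.Coprime q := by
    have := ZMod.val_coe_unit_coprime b
    rwa [Nat.Coprime, hxq.gcd_eq]
  have hcL : x.Coprime L := by rw [Nat.Coprime, hxL.gcd_eq, Nat.gcd_one_left]
  have hco : x.Coprime (q.lcm L) := (hcq.mul_right hcL).coprime_dvd_right (Nat.lcm_dvd_mul q L)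
  have hval : ∀ {n : ℕ}, n ∣ q.lcm L →
      (((ZMod.unitOfCoprime x hco : ZMod (q.lcm L)).val : ℕ) : ZMod n) = x := by
    intro n hn
    rw [ZMod.coe_unitOfCoprime, ZMod.val_natCast, ZMod.natCast_eq_natCast_iff]
    exact (Nat.mod_modEq _ _).of_dvd hn
  refine ⟨ZMod.unitOfCoprime x hco, Units.ext ?_, Units.ext ?_⟩
  · rw [coe_unitsMap, hval (Nat.dvd_lcm_left q L), ← ZMod.natCast_zmod_val (b : ZMod q),
      ZMod.natCast_eq_natCast_iff]
    exact hxq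
  · rw [coe_unitsMap, hval (Nat.dvd_lcm_right q L), Units.val_one, ← Nat.cast_one,
      ZMod.natCast_eq_natCast_iff]
    exact hxL

/-- Such a class lifts to one that is trivial modulo lcm(k, |Δ_a|), which fixes both ζ_k and √a.
This explicit subgroup is where the cancellation in the exponential sums comes from. -/
theorem mem_kummerSubgroup_of_eq_one {a : ℤ} (ha : a ≠ -1 ∧ ¬ IsSquare a) {q k : ℕ} [NeZero q]
    (hk : Squarefree k) {b : (ZMod q)ˣ}
    (hb : ZMod.unitsMap (Nat.gcd_dvd_left q (k.lcm (disc a).natAbs)) b = 1) :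
    b ∈ kummerSubgroup a q k := by
  have : NeZero k := ⟨hk.ne_zero⟩
  set L := k.lcm (disc a).natAbs
  have : NeZero L := ⟨Nat.lcm_ne_zero (NeZero.ne k) (NeZero.ne _)⟩
  have : NeZero (q.lcm L) := ⟨Nat.lcm_ne_zero (NeZero.ne q) (NeZero.ne L)⟩
  obtain ⟨y, rfl, hyL⟩ := exists_unit_lcm b hb
  have hred : ∀ {n : ℕ} (h : n ∣ L), ZMod.unitsMap (h.trans (Nat.dvd_lcm_right q L)) y = 1 := by
    intro n h
    rw [← ZMod.unitsMap_comp h (Nat.dvd_lcm_right q L), MonoidHom.comp_apply, hyL, map_one]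
  refine unitsMap_mem_kummerSubgroup ha hk (Nat.dvd_lcm_left q L)
    ((Nat.dvd_lcm_left k _).trans (Nat.dvd_lcm_right q L)) (hred (Nat.dvd_lcm_left _ _)) ?_
  rintro - τ hτ x - hx
  refine aut_fixes_cycloField (N := (disc a).natAbs) ?_ (mem_cycloField_disc ha hx)
  rw [← unitsMap_cyc ((Nat.dvd_lcm_right k _).trans (Nat.dvd_lcm_right q L)), hτ,
    hred (Nat.dvd_lcm_right _ _)]

theorem unitsMap_eq_one_of_mem {a : ℤ} {q k : ℕ} [NeZero q] {b : (ZMod q)ˣ}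
    (hb : b ∈ kummerSubgroup a q k) : ZMod.unitsMap (Nat.gcd_dvd_left q k) b = 1 := by
  have : NeZero (q.gcd k) := ⟨(Nat.gcd_pos_of_pos_left k (NeZero.pos q)).ne'⟩
  obtain ⟨τ, hτ, rfl⟩ := mem_kummerSubgroup.1 hb
  rw [unitsMap_cyc, cyc_eq_one_iff]
  intro ζ hζ
  obtain ⟨c, hc⟩ := Nat.gcd_dvd_right q k
  refine hτ ζ (subset_adjoin ℚ _ (Or.inl ?_))
  rw [hc, pow_mul, hζ, one_pow]

theorem mem_kummerSubgroup_of_sqrt_not_mem {a : ℤ} (ha : a ≠ -1 ∧ ¬ IsSquare a) {d k : ℕ} [NeZero d]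
    (hk : Squarefree k) (h : ¬ ∃ x ∈ cycloField (d.lcm k), x ^ 2 = (a : ℂ)) {b : (ZMod d)ˣ} :
    b ∈ kummerSubgroup a d k ↔ ZMod.unitsMap (Nat.gcd_dvd_left d k) b = 1 := by
  have : NeZero k := ⟨hk.ne_zero⟩
  have : NeZero (d.lcm k) := ⟨Nat.lcm_ne_zero (NeZero.ne d) (NeZero.ne k)⟩
  refine ⟨unitsMap_eq_one_of_mem, fun hb => ?_⟩
  obtain ⟨y, rfl, hy⟩ := exists_unit_lcm b hb
  exact unitsMap_mem_kummerSubgroup ha hk _ _ hy fun _ _ _ x hx hxa => absurd ⟨x, hx, hxa⟩ h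

/-- For even k the field G_{a,k} contains √a, which is cyclotomic of level d here; fixing it is the
Kronecker condition. -/
theorem mem_kummerSubgroup_of_disc_dvd {a : ℤ} (ha : a ≠ -1 ∧ ¬ IsSquare a) {d k : ℕ} [NeZero d]
    (hk : Squarefree k) (h : (disc a).natAbs ∣ d) {b : (ZMod d)ˣ} :
    b ∈ kummerSubgroup a d k ↔ ZMod.unitsMap (Nat.gcd_dvd_left d k) b = 1 ∧
      (2 ∣ k → kronecker (disc a) (b : ZMod d).val = 1) := by
  have : NeZero k := ⟨hk.ne_zero⟩
  have : NeZero (d.lcm k) := ⟨Nat.lcm_ne_zero (NeZero.ne d) (NeZero.ne k)⟩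
  have hco : ((b : ZMod d).val).Coprime (disc a).natAbs :=
    (ZMod.val_coe_unit_coprime b).coprime_dvd_right h
  have hv0 : (b : ZMod d).val ≠ 0 := by
    intro h0
    rw [h0, Nat.coprime_zero_left] at hco
    have := three_le_natAbs_disc ha
    omega
  have hact : ∀ τ : ℂ ≃ₐ[ℚ] ℂ, cyc d τ = b → ∀ z : ℂ, z ^ 2 = a →
      τ z = (kronecker (disc a) (b : ZMod d).val : ℂ) * z := by
    intro τ hτ z hz
    refine aut_sqrt ha hv0 hco (ActsBy.of_dvd (N := d) ?_ h) hz
    rw [actsBy_iff_cyc_eq, ZMod.natCast_zmod_val, hτ]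
  constructor
  · intro hb
    refine ⟨unitsMap_eq_one_of_mem hb, ?_⟩
    rintro ⟨c, hc⟩
    obtain ⟨τ, hτ, hτb⟩ := mem_kummerSubgroup.1 hb
    obtain ⟨β, hβ⟩ := IsAlgClosed.exists_pow_nat_eq (a : ℂ) (NeZero.pos k)
    have hz : (β ^ c) ^ 2 = (a : ℂ) := by rw [← pow_mul, mul_comm, ← hc, hβ]
    have hfix : τ (β ^ c) = β ^ c :=
      hτ _ (pow_mem (subset_adjoin ℚ _ (Or.inr hβ) : β ∈ kummerField a k) c)
    rw [hact τ hτb _ hz] at hfix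
    have hz0 : β ^ c ≠ 0 := by
      intro h0
      rw [h0, zero_pow two_ne_zero] at hz
      exact ne_zero_of_not_isSquare ha (by exact_mod_cast hz.symm)
    have := mul_right_cancel₀ hz0 (hfix.trans (one_mul _).symm)
    exact_mod_cast this
  · rintro ⟨hb, hkr⟩
    obtain ⟨y, rfl, hy⟩ := exists_unit_lcm b hb
    refine unitsMap_mem_kummerSubgroup ha hk _ _ hy fun h2 τ hτ x _ hxa => ?_
    rw [hact τ (by rw [← unitsMap_cyc (Nat.dvd_lcm_left d k), hτ]) x hxa, hkr h2, Int.cast_one,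
      one_mul]

/-! ### Degrees -/

theorem finrank_kummerField {a : ℤ} (ha : a ≠ -1 ∧ ¬ IsSquare a) {k : ℕ} (hk : Squarefree k) :
    Module.finrank ℚ (kummerField a k) = k.totient * kummerDegree a k k := by
  have h := finrank_compField ha (d := 1) hk
  rw [Nat.lcm_one_left] at h
  rw [← h]
  have : compField a 1 k = kummerField a k := by
    refine sup_eq_right.2 ?_
    rw [cycloField, adjoin_le_iff]
    intro x hx
    have hx' : x ^ 1 = 1 := hx
    rw [pow_one] at hx'
    rw [hx']
    exact one_mem _
  rw [this]

/-- Every prime factor of k divides the Kummer degree, except possibly 2 and the divisors of h_a;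
the factor 2h_a pays for these. -/
theorem le_finrank_kummerField {a : ℤ} (ha : a ≠ -1 ∧ ¬ IsSquare a) {k : ℕ} (hk : Squarefree k) :
    k.totient * k ≤ 2 * powIndex a * Module.finrank ℚ (kummerField a k) := by
  have : NeZero k := ⟨hk.ne_zero⟩
  rw [finrank_kummerField ha hk]
  have hdvd : k ∣ kummerDegree a k k * (2 * powIndex a) := by
    rw [← Nat.prod_primeFactors_of_squarefree hk]
    refine Finset.prod_primes_dvd _ (fun p hp => (Nat.prime_of_mem_primeFactors hp).prime)
      fun p hp => ?_
    have hpp := Nat.prime_of_mem_primeFactors hp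
    rw [Nat.prod_primeFactors_of_squarefree hk]
    by_cases h2 : p = 2
    · subst h2
      exact Dvd.dvd.mul_left (Dvd.intro _ rfl) _
    · by_cases hh : p ∣ powIndex a
      · exact Dvd.dvd.mul_left (Dvd.dvd.mul_left hh _) _
      · refine Dvd.dvd.mul_right (dvd_kummerDegree hk.ne_zero hpp
          (Nat.dvd_of_mem_primeFactors hp) ?_) _
        rintro ⟨x, hx, hxa⟩
        exact pow_ne_of_mem_cycloField ha hpp h2 hh hx hxa
  have hle := Nat.le_of_dvd (Nat.mul_pos (kummerDegree_pos a k k)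
    (Nat.mul_pos two_pos (powIndex_pos ha))) hdvd
  calc k.totient * k ≤ k.totient * (kummerDegree a k k * (2 * powIndex a)) :=
        Nat.mul_le_mul_left _ hle
    _ = _ := by ring

/-- The local factor at `p` of the reciprocal Kummer degree. -/
def kummerWeight (a : ℤ) (p : ℕ) : ℝ := if p ∣ powIndex a then 1 else (p : ℝ)⁻¹

/-- The last factor records that the prime 2 drops out of the degree when k is even and √a lies in
ℚ(ζ_N); as h_a is odd, the weight at 2 is 1/2 and must be doubled. -/
theorem inv_kummerDegree {a : ℤ} (ha : a ≠ -1 ∧ ¬ IsSquare a) {N k : ℕ} [NeZero N]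
    (hk : Squarefree k) (P : Prop) [Decidable P]
    (hP : P ↔ ∃ x ∈ cycloField N, x ^ 2 = (a : ℂ)) :
    ((kummerDegree a N k : ℝ))⁻¹ =
      (∏ p ∈ k.primeFactors, kummerWeight a p) * if 2 ∣ k ∧ P then 2 else 1 := by
  classical
  have h2h : ¬ 2 ∣ powIndex a := not_two_dvd_powIndex ha
  have hpow : ∀ p, p.Prime → p ≠ 2 →
      ((∃ x ∈ cycloField N, x ^ p = (a : ℂ)) ↔ p ∣ powIndex a) := by
    intro p hp hp2
    constructor
    · rintro ⟨x, hx, hxa⟩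
      by_contra hh
      exact pow_ne_of_mem_cycloField ha hp hp2 hh hx hxa
    · intro hh
      obtain ⟨c, hc⟩ := (exists_pow_eq_iff_dvd_powIndex ha hp).2 hh
      exact ⟨c, intCast_mem _ c, by exact_mod_cast hc⟩
  rw [kummerDegree, Nat.cast_prod, ← Finset.prod_inv_distrib, Finset.prod_filter]
  have hone : (if 2 ∣ k ∧ P then (2 : ℝ) else 1) =
      ∏ p ∈ k.primeFactors, if p = 2 ∧ P then (2 : ℝ) else 1 := by
    by_cases h : P
    · simp only [h, and_true]
      rw [Finset.prod_ite_eq']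
      congr 1
      simp [Nat.mem_primeFactors, Nat.prime_two, hk.ne_zero]
    · simp [h]
  rw [hone, ← Finset.prod_mul_distrib]
  refine Finset.prod_congr rfl fun p hp => ?_
  have hpp := Nat.prime_of_mem_primeFactors hp
  have hp0 : (p : ℝ) ≠ 0 := by exact_mod_cast hpp.ne_zero
  by_cases h2 : p = 2
  · subst h2
    rw [kummerWeight, if_neg h2h]
    by_cases h : P
    · rw [if_neg (not_not.2 (hP.1 h)), if_pos ⟨rfl, h⟩]
      norm_num
    · rw [if_pos (fun h' => h (hP.2 h')), if_neg (fun h' => h h'.2), mul_one]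
  · rw [if_neg (fun h' : p = 2 ∧ P => h2 h'.1), mul_one, kummerWeight]
    by_cases hh : p ∣ powIndex a
    · rw [if_neg (not_not.2 ((hpow p hpp h2).2 hh)), if_pos hh]
    · rw [if_pos (fun h' => hh ((hpow p hpp h2).1 h')), if_neg hh]

end

/-! ### Exponential sums over the subgroups: vanishing and bounds. -/

section

open ArithmeticFunction

/-! ### Sums over residue classes -/

theorem sum_moebius_castHom_eq {q : ℕ} [NeZero q] (x : ZMod q) :
    (∑ t ∈ q.divisors, if (t : ℕ) ∣ x.val then (moebius t : ℂ) else 0) =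
      if IsUnit x then 1 else 0 := by
  have h1 : (∑ t ∈ q.divisors, if (t : ℕ) ∣ x.val then (moebius t : ℂ) else 0) =
      ((∑ t ∈ (q.gcd x.val).divisors, moebius t : ℤ) : ℂ) := by
    rw [← Finset.sum_filter]
    push_cast
    refine Finset.sum_congr ?_ fun _ _ => rfl
    ext t
    simp only [Finset.mem_filter, Nat.mem_divisors, Nat.dvd_gcd_iff]
    have : q.gcd x.val ≠ 0 := (Nat.gcd_pos_of_pos_left _ (NeZero.pos q)).ne'
    have hq := NeZero.ne q
    tauto
  have h2 : (∑ t ∈ (q.gcd x.val).divisors, moebius t : ℤ) = if q.gcd x.val = 1 then 1 else 0 := by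
    rw [← coe_mul_zeta_apply, moebius_mul_coe_zeta, one_apply]
  have h3 : IsUnit x ↔ q.gcd x.val = 1 := by
    rw [← ZMod.natCast_zmod_val x, ZMod.isUnit_iff_coprime, ZMod.natCast_zmod_val,
      Nat.coprime_comm]
  rw [h1, h2]
  by_cases h : IsUnit x
  · rw [if_pos h, if_pos (h3.1 h), Int.cast_one]
  · rw [if_neg h, if_neg (fun h' => h (h3.2 h')), Int.cast_zero]

theorem stdAddChar_unit_mul_eq_one_iff {q : ℕ} [NeZero q] (w : (ZMod q)ˣ) (n : ℕ) :
    ZMod.stdAddChar ((w : ZMod q) * (n : ZMod q)) = 1 ↔ q ∣ n := by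
  rw [← AddChar.map_zero_eq_one (ZMod.stdAddChar (N := q)), ZMod.injective_stdAddChar.eq_iff,
    Units.mul_right_eq_zero, ZMod.natCast_eq_zero_iff]

/-- Translation by n multiplies the sum by a root of unity different from 1. -/
theorem sum_eq_zero_of_translate {q : ℕ} [NeZero q] (w : (ZMod q)ˣ) {S : Finset (ZMod q)} {n : ℕ}
    (hn : ¬ q ∣ n) (hS : ∀ x : ZMod q, x + (n : ZMod q) ∈ S ↔ x ∈ S) :
    ∑ x ∈ S, ZMod.stdAddChar ((w : ZMod q) * x) = 0 := by
  have h1 : ∑ x ∈ S, ZMod.stdAddChar ((w : ZMod q) * x) =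
      ∑ x ∈ S, ZMod.stdAddChar ((w : ZMod q) * (x + (n : ZMod q))) :=
    (Finset.sum_equiv (Equiv.addRight (n : ZMod q)) (fun x => (hS x).symm) fun _ _ => rfl).symm
  have h2 : ∑ x ∈ S, ZMod.stdAddChar ((w : ZMod q) * x) =
      ZMod.stdAddChar ((w : ZMod q) * (n : ZMod q)) *
        ∑ x ∈ S, ZMod.stdAddChar ((w : ZMod q) * x) := by
    rw [Finset.mul_sum]
    refine h1.trans (Finset.sum_congr rfl fun x _ => ?_)
    rw [mul_add, AddChar.map_add_eq_mul, mul_comm]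
  by_contra h
  exact hn ((stdAddChar_unit_mul_eq_one_iff w n).1
    (mul_right_cancel₀ h (h2.symm.trans (one_mul _).symm)))

theorem sum_units_eq_sum_zmod {q : ℕ} [NeZero q] (P : ZMod q → Prop) [DecidablePred P]
    (f : ZMod q → ℂ) : (∑ u ∈ Finset.univ.filter (fun u : (ZMod q)ˣ => P (u : ZMod q)), f (u : ZMod q)) =
      ∑ x : ZMod q with P x, (if IsUnit x then 1 else 0) * f x := by
  classical
  have : (∑ x : ZMod q with P x, (if IsUnit x then (1 : ℂ) else 0) * f x) =
      ∑ x : ZMod q with IsUnit x ∧ P x, f x := by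
    simp_rw [ite_mul, one_mul, zero_mul]
    rw [← Finset.sum_filter, Finset.filter_filter]
    refine Finset.sum_congr ?_ fun _ _ => rfl
    ext x
    simp [and_comm]
  rw [this]
  refine Finset.sum_bij (fun u _ => (u : ZMod q)) ?_ ?_ ?_ ?_
  · intro u hu
    simpa using hu
  · intro u _ v _ h
    exact Units.ext h
  · intro x hx
    rw [Finset.mem_filter] at hx
    obtain ⟨u, rfl⟩ := hx.2.1
    exact ⟨u, by simpa using hx.2.2, rfl⟩
  · intro _ _
    rfl

theorem sum_units_congr_eq {q m : ℕ} [NeZero q] (hm : m ∣ q) (f : ZMod q → ℂ) :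
    (∑ u : (ZMod q)ˣ with ZMod.unitsMap hm u = 1, f u) =
      ∑ x : ZMod q with ZMod.castHom hm (ZMod m) x = 1, (if IsUnit x then 1 else 0) * f x := by
  rw [← sum_units_eq_sum_zmod]
  refine Finset.sum_congr ?_ fun _ _ => rfl
  ext u
  simp only [Finset.mem_filter, Finset.mem_univ, true_and, Units.ext_iff]
  rfl

theorem val_modEq_of_castHom {q m : ℕ} [NeZero q] (h : m ∣ q) (x y : ZMod q) :
    ZMod.castHom h (ZMod m) x = ZMod.castHom h (ZMod m) y ↔ x.val ≡ y.val [MOD m] := by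
  rw [ZMod.castHom_apply, ZMod.castHom_apply, ZMod.cast_eq_val, ZMod.cast_eq_val,
    ZMod.natCast_eq_natCast_iff]

/-- Exponential sums over the units that are `1` modulo a divisor `m` of the modulus. -/
theorem sum_units_congr_one {q m : ℕ} [NeZero q] (hm : m ∣ q) (w : (ZMod q)ˣ) :
    ‖∑ u : (ZMod q)ˣ with ZMod.unitsMap hm u = 1,
      ZMod.stdAddChar ((w : ZMod q) * (u : ZMod q))‖ ≤ 1 := by
  classical
  have hq0 := NeZero.ne q
  set S : ℕ → Finset (ZMod q) := fun t =>
    {x : ZMod q | ZMod.castHom hm (ZMod m) x = 1 ∧ t ∣ x.val} with hS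
  have hsum : (∑ u : (ZMod q)ˣ with ZMod.unitsMap hm u = 1,
      ZMod.stdAddChar ((w : ZMod q) * (u : ZMod q))) =
      ∑ t ∈ q.divisors, (moebius t : ℂ) * ∑ x ∈ S t, ZMod.stdAddChar ((w : ZMod q) * x) := by
    rw [sum_units_congr_eq hm fun x => ZMod.stdAddChar ((w : ZMod q) * x)]
    simp_rw [← sum_moebius_castHom_eq, Finset.sum_mul, Finset.mul_sum]
    rw [Finset.sum_comm]
    refine Finset.sum_congr rfl fun t _ => ?_
    simp_rw [ite_mul, zero_mul]
    rw [← Finset.sum_filter, Finset.filter_filter]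
  -- `S t` is stable under translation by lcm(t, m), so its sum vanishes unless q ∣ lcm(t, m). In
  -- that case, if t is prime to m then t = q/m and `S t` has at most one point; otherwise `S t` is
  -- empty, as anything 1 modulo m is prime to m.
  have hterm : ∀ t ∈ q.divisors, ‖(moebius t : ℂ) * ∑ x ∈ S t,
      ZMod.stdAddChar ((w : ZMod q) * x)‖ ≤ if t = q / m then 1 else 0 := by
    intro t ht
    have htq := Nat.dvd_of_mem_divisors ht
    have hmu : ‖(moebius t : ℂ)‖ ≤ 1 := by
      rw [Complex.norm_intCast]
      exact_mod_cast abs_moebius_le_one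
    by_cases hlcm : q ∣ t.lcm m
    · by_cases hco : t.Coprime m
      · have htm : t = q / m := by
          rw [hco.lcm_eq_mul] at hlcm
          have h1 : t * m = q := Nat.dvd_antisymm (hco.mul_dvd_of_dvd_of_dvd htq hm) hlcm
          rw [← h1, Nat.mul_div_cancel _ (Nat.pos_of_dvd_of_pos hm (NeZero.pos q))]
        rw [if_pos htm, norm_mul]
        refine mul_le_one₀ hmu (norm_nonneg _) ?_
        have hcard : (S t).card ≤ 1 := by
          refine Finset.card_le_one.2 fun x hx y hy => ?_
          simp only [hS, Finset.mem_filter, Finset.mem_univ, true_and] at hx hy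
          have h1 : x.val ≡ y.val [MOD m] := (val_modEq_of_castHom hm x y).1 (hx.1.trans hy.1.symm)
          have h2 : x.val ≡ y.val [MOD t] :=
            ((Nat.modEq_zero_iff_dvd).2 hx.2).trans ((Nat.modEq_zero_iff_dvd).2 hy.2).symm
          have h3 : x.val ≡ y.val [MOD q] := by
            rw [Nat.modEq_iff_dvd] at h1 h2 ⊢
            have := lcm_dvd h2 h1
            rw [← Int.coe_lcm, Int.lcm_natCast_natCast] at this
            exact (Int.natCast_dvd_natCast.2 hlcm).trans this
          exact ZMod.val_injective q (h3.eq_of_lt_of_lt (ZMod.val_lt x) (ZMod.val_lt y))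
        refine (norm_sum_le _ _).trans ?_
        simp only [AddChar.norm_apply, Finset.sum_const, nsmul_eq_mul, mul_one]
        exact_mod_cast hcard
      · have hempty : S t = ∅ := by
          refine Finset.eq_empty_of_forall_notMem fun x hx => hco ?_
          simp only [hS, Finset.mem_filter, Finset.mem_univ, true_and] at hx
          have h1 : x.val ≡ 1 [MOD m] := by
            rw [← ZMod.natCast_eq_natCast_iff, Nat.cast_one, ← hx.1, ZMod.castHom_apply,
              ZMod.cast_eq_val]
          have h2 : x.val.Coprime m := by rw [Nat.Coprime, h1.gcd_eq, Nat.gcd_one_left]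
          exact h2.coprime_dvd_left hx.2
        rw [hempty, Finset.sum_empty, mul_zero, norm_zero]
        split_ifs <;> norm_num
    · rw [sum_eq_zero_of_translate w hlcm, mul_zero, norm_zero]
      · split_ifs <;> norm_num
      · intro x
        simp only [hS, Finset.mem_filter, Finset.mem_univ, true_and]
        have h1 : ZMod.castHom hm (ZMod m) (x + ((t.lcm m : ℕ) : ZMod q)) = ZMod.castHom hm (ZMod m) x := by
          rw [map_add, map_natCast, (ZMod.natCast_eq_zero_iff _ _).2 (Nat.dvd_lcm_right t m),
            add_zero]
        have h2 : t ∣ (x + ((t.lcm m : ℕ) : ZMod q)).val ↔ t ∣ x.val := by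
          have e : ∀ y : ZMod q, t ∣ y.val ↔ ZMod.castHom htq (ZMod t) y = 0 := by
            intro y
            rw [ZMod.castHom_apply, ZMod.cast_eq_val, ZMod.natCast_eq_zero_iff]
          rw [e, e, map_add, map_natCast, (ZMod.natCast_eq_zero_iff _ _).2 (Nat.dvd_lcm_left t m),
            add_zero]
        rw [h1, h2]
  rw [hsum]
  refine (norm_sum_le _ _).trans ((Finset.sum_le_sum hterm).trans ?_)
  rw [Finset.sum_ite_eq']
  split_ifs <;> norm_num

/-- As p² ∣ q, the class of q/p is nilpotent modulo q, so translation by it preserves units; as m ∣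
q/p, it also preserves the congruence modulo m. -/
theorem sum_units_congr_one_eq_zero {q m p : ℕ} [NeZero q] (hm : m ∣ q) (w : (ZMod q)ˣ)
    (hp : p.Prime) (hpq : p * p ∣ q) (hmp : m ∣ q / p) :
    ∑ u : (ZMod q)ˣ with ZMod.unitsMap hm u = 1,
      ZMod.stdAddChar ((w : ZMod q) * (u : ZMod q)) = 0 := by
  classical
  obtain ⟨c, hc⟩ := hpq
  have hq0 := NeZero.ne q
  have hqp : q / p = p * c := by rw [hc, mul_assoc, Nat.mul_div_cancel_left _ hp.pos]
  have hnd : ¬ q ∣ q / p := by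
    intro h
    have hlt : q / p < q := Nat.div_lt_self (NeZero.pos q) hp.one_lt
    have hpos : 0 < q / p := Nat.div_pos (Nat.le_of_dvd (NeZero.pos q) ⟨p * c, by rw [hc]; ring⟩) hp.pos
    exact absurd (Nat.le_of_dvd hpos h) (not_le.2 hlt)
  rw [sum_units_congr_eq hm fun x => ZMod.stdAddChar ((w : ZMod q) * x)]
  simp_rw [ite_mul, one_mul, zero_mul]
  rw [← Finset.sum_filter, Finset.filter_filter]
  refine sum_eq_zero_of_translate w hnd fun x => ?_
  simp only [Finset.mem_filter, Finset.mem_univ, true_and]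
  have e1 : ZMod.castHom hm (ZMod m) (x + ((q / p : ℕ) : ZMod q)) = ZMod.castHom hm (ZMod m) x := by
    rw [map_add, map_natCast, (ZMod.natCast_eq_zero_iff _ _).2 hmp, add_zero]
  have e2 : IsUnit (x + ((q / p : ℕ) : ZMod q)) ↔ IsUnit x := by
    have hn : IsNilpotent ((q / p : ℕ) : ZMod q) := by
      refine ⟨2, ?_⟩
      rw [← Nat.cast_pow, ZMod.natCast_eq_zero_iff, hqp, hc]
      exact ⟨c, by ring⟩
    constructor
    · intro h
      have := hn.neg.isUnit_add_left_of_commute h (Commute.all _ _)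
      simpa using this
    · intro h
      exact hn.isUnit_add_left_of_commute h (Commute.all _ _)
  rw [e1, e2]

/-! ### Sums over subgroups -/

/-- Both sides equal the double sum of f(φ(x)y) over x ∈ H and y ∈ φ(H). -/
theorem sum_subgroup_map {G G' : Type*} [CommGroup G] [CommGroup G'] [Fintype G] [Fintype G']
    [DecidableEq G'] (φ : G →* G') (H : Subgroup G) [DecidablePred (· ∈ H)]
    [DecidablePred (· ∈ H.map φ)] (f : G' → ℂ) :
    (Nat.card (H.map φ) : ℂ) * ∑ x : G with x ∈ H, f (φ x) =
      (Nat.card H : ℂ) * ∑ y : G' with y ∈ H.map φ, f y := by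
  have hswap : ∀ y ∈ H.map φ, ∑ x : G with x ∈ H, f (φ x) = ∑ x : G with x ∈ H, f (φ x * y) := by
    rintro y ⟨h, hh, rfl⟩
    symm
    refine Finset.sum_equiv (Equiv.mulRight h) (fun x => ?_) fun x _ => ?_
    · simp [Subgroup.mul_mem_cancel_right H hh]
    · simp
  have hswap2 : ∀ x ∈ H, ∑ y : G' with y ∈ H.map φ, f (φ x * y) =
      ∑ y : G' with y ∈ H.map φ, f y := by
    intro x hx
    refine Finset.sum_equiv (Equiv.mulLeft (φ x)) (fun y => ?_) fun y _ => ?_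
    · simp only [Finset.mem_filter, Finset.mem_univ, true_and, Equiv.coe_mulLeft]
      exact (Subgroup.mul_mem_cancel_left _ (Subgroup.mem_map_of_mem φ hx)).symm
    · simp
  have hc1 : (Nat.card (H.map φ) : ℂ) = ∑ y : G' with y ∈ H.map φ, 1 := by
    rw [Nat.card_eq_fintype_card, Fintype.card_subtype]; simp
  have hc2 : (Nat.card H : ℂ) = ∑ x : G with x ∈ H, 1 := by
    rw [Nat.card_eq_fintype_card, Fintype.card_subtype]; simp
  rw [hc1, hc2, Finset.sum_mul, Finset.sum_mul]
  simp_rw [one_mul]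
  rw [Finset.sum_congr rfl fun y hy => hswap y (Finset.mem_filter.1 hy).2, Finset.sum_comm]
  exact Finset.sum_congr rfl fun x hx => hswap2 x (Finset.mem_filter.1 hx).2

/-- Average over the translates of U inside H. -/
theorem norm_sum_subgroup_le {G : Type*} [CommGroup G] [Fintype G] (U H : Subgroup G)
    [DecidablePred (· ∈ U)] [DecidablePred (· ∈ H)] (hUH : U ≤ H) (f : G → ℂ) {B : ℝ}
    (hB : ∀ b : G, ‖∑ u : G with u ∈ U, f (b * u)‖ ≤ B) :
    (Nat.card U : ℝ) * ‖∑ x : G with x ∈ H, f x‖ ≤ Nat.card H * B := by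
  have h1 : (Nat.card U : ℂ) * ∑ x : G with x ∈ H, f x =
      ∑ x : G with x ∈ H, ∑ u : G with u ∈ U, f (x * u) := by
    have hc1 : (Nat.card U : ℂ) = ∑ y : G with y ∈ U, 1 := by
      rw [Nat.card_eq_fintype_card, Fintype.card_subtype]; simp
    rw [hc1, Finset.sum_mul, Finset.sum_comm]
    refine Finset.sum_congr rfl fun u hu => ?_
    rw [one_mul]
    have huH := hUH (Finset.mem_filter.1 hu).2
    symm
    refine Finset.sum_equiv (Equiv.mulRight u) (fun x => ?_) fun x _ => ?_
    · simp [Subgroup.mul_mem_cancel_right H huH]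
    · simp
  have h2 : (Nat.card U : ℝ) * ‖∑ x : G with x ∈ H, f x‖ =
      ‖(Nat.card U : ℂ) * ∑ x : G with x ∈ H, f x‖ := by
    rw [norm_mul, Complex.norm_natCast]
  rw [h2, h1]
  refine (norm_sum_le _ _).trans ((Finset.sum_le_sum fun x _ => hB x).trans (le_of_eq ?_))
  rw [Finset.sum_const, nsmul_eq_mul, Nat.card_eq_fintype_card, Fintype.card_subtype]

theorem card_ker_unitsMap {q m : ℕ} [NeZero q] (h : m ∣ q) :
    Nat.card (ZMod.unitsMap h).ker * m.totient = q.totient := by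
  have : NeZero m := ⟨fun h0 => NeZero.ne q (Nat.eq_zero_of_zero_dvd (h0 ▸ h))⟩
  have h1 := Subgroup.card_eq_card_quotient_mul_card_subgroup (ZMod.unitsMap h).ker
  rw [Nat.card_congr (QuotientGroup.quotientKerEquivOfSurjective _
    (ZMod.unitsMap_surjective h)).toEquiv, Nat.card_eq_fintype_card, Nat.card_eq_fintype_card,
    ZMod.card_units_eq_totient, ZMod.card_units_eq_totient] at h1
  rw [h1, mul_comm]

/-! ### The normalized exponential sums -/

/-- `S_{a,q,k}(z) / [F_{a,q,k} : ℚ]`. -/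
def normSum (a : ℤ) (q k : ℕ) [NeZero q] (z : ZMod q) : ℂ :=
  expSum a q k z / Module.finrank ℚ (compField a q k)

open Classical in
theorem expSum_eq {a : ℤ} {q k : ℕ} [NeZero q] [NeZero k] (z : ZMod q) :
    expSum a q k z = ∑ b : (ZMod q)ˣ with b ∈ kummerSubgroup a q k,
      ZMod.stdAddChar (z * (b : ZMod q)) := by
  rw [expSum, Finset.sum_filter]
  refine Finset.sum_congr rfl fun b _ => ?_
  rw [cInd]
  simp only [fixesIntersection_iff, ite_mul, one_mul, zero_mul]

theorem singTerm_eq (a : Fin 3 → ℤ) (k : Fin 3 → ℕ+) (n : ℕ) (q : ℕ+) :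
    singTerm a k n q = ∑ z : (ZMod (q : ℕ))ˣ,
      ZMod.stdAddChar (-(n : ZMod (q : ℕ)) * (z : ZMod (q : ℕ))) *
        ∏ i, normSum (a i) q (k i) (z : ZMod (q : ℕ)) := by
  rw [singTerm, Finset.mul_sum]
  refine Finset.sum_congr rfl fun z _ => ?_
  simp only [normSum, expSumProd, degProd, Finset.prod_div_distrib, Nat.cast_prod]
  ring

theorem finrank_kummerField_pos (a : ℤ) (k : ℕ) [NeZero k] :
    0 < Module.finrank ℚ (kummerField a k) := Module.finrank_pos

/-- The normalized sum is a mean over the subgroup divided by [G:ℚ], and means are compatible with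
surjections. Hence it depends only on the fraction z/q, also when that is not in lowest terms. -/
theorem normSum_eq_of_dvd {a : ℤ} {q d k : ℕ} [NeZero q] [NeZero d] [NeZero k] (h : q ∣ d)
    {z : ZMod q} {w : ZMod d}
    (hzw : ∀ b : (ZMod d)ˣ, ZMod.stdAddChar (w * (b : ZMod d)) =
      ZMod.stdAddChar (z * ((ZMod.unitsMap h b : (ZMod q)ˣ) : ZMod q))) :
    normSum a d k w = normSum a q k z := by
  classical
  rw [normSum, normSum, expSum_eq, expSum_eq, ← card_kummerSubgroup_mul_finrank,
    ← card_kummerSubgroup_mul_finrank]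
  have key := sum_subgroup_map (ZMod.unitsMap h) (kummerSubgroup a d k)
    fun y => ZMod.stdAddChar (z * (y : ZMod q))
  simp_rw [hzw]
  have e1 : (∑ y : (ZMod q)ˣ with y ∈ (kummerSubgroup a d k).map (ZMod.unitsMap h),
      ZMod.stdAddChar (z * (y : ZMod q))) = ∑ b : (ZMod q)ˣ with b ∈ kummerSubgroup a q k,
      ZMod.stdAddChar (z * (b : ZMod q)) := by
    refine Finset.sum_congr ?_ fun _ _ => rfl
    ext y
    simp [← kummerSubgroup_map h]
  rw [e1, kummerSubgroup_map h] at key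
  have hG : (Module.finrank ℚ (kummerField a k) : ℂ) ≠ 0 := by
    exact_mod_cast (finrank_kummerField_pos a k).ne'
  have h1 : (Nat.card (kummerSubgroup a d k) : ℂ) ≠ 0 := by exact_mod_cast Nat.card_pos.ne'
  have h2 : (Nat.card (kummerSubgroup a q k) : ℂ) ≠ 0 := by exact_mod_cast Nat.card_pos.ne'
  push_cast
  rw [div_eq_div_iff (mul_ne_zero h1 hG) (mul_ne_zero h2 hG)]
  linear_combination (Module.finrank ℚ (kummerField a k) : ℂ) * key

/-- The averaging subgroup is the kernel of reduction modulo m = gcd(q, lcm(k, |Δ_a|)), whose order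
is φ(q)/φ(m). -/
theorem norm_normSum_le_of_norm_sum_le {a : ℤ} (ha : a ≠ -1 ∧ ¬ IsSquare a) {q k : ℕ} [NeZero q]
    (hk : Squarefree k) (z : (ZMod q)ˣ) {B : ℝ}
    (hB : ∀ w : (ZMod q)ˣ, ‖∑ u : (ZMod q)ˣ with
      ZMod.unitsMap (Nat.gcd_dvd_left q (k.lcm (disc a).natAbs)) u = 1,
      ZMod.stdAddChar ((w : ZMod q) * (u : ZMod q))‖ ≤ B) :
    ‖normSum a q k (z : ZMod q)‖ ≤ B * (q.gcd (k.lcm (disc a).natAbs)).totient /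
      (q.totient * Module.finrank ℚ (kummerField a k)) := by
  classical
  have : NeZero k := ⟨hk.ne_zero⟩
  set hd := Nat.gcd_dvd_left q (k.lcm (disc a).natAbs)
  set m := q.gcd (k.lcm (disc a).natAbs)
  have hUH : (ZMod.unitsMap hd).ker ≤ kummerSubgroup a q k :=
    fun b hb => mem_kummerSubgroup_of_eq_one ha hk hb
  have key := norm_sum_subgroup_le (ZMod.unitsMap hd).ker (kummerSubgroup a q k) hUH
    (fun b : (ZMod q)ˣ => ZMod.stdAddChar ((z : ZMod q) * (b : ZMod q))) (B := B) (by
      intro b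
      refine le_trans (le_of_eq ?_) (hB (z * b))
      congr 1
      refine Finset.sum_congr ?_ fun u _ => ?_
      · ext u
        simp [MonoidHom.mem_ker]
      · push_cast
        rw [mul_assoc])
  have hcard := card_ker_unitsMap hd
  rw [normSum, expSum_eq, ← card_kummerSubgroup_mul_finrank, norm_div, Complex.norm_natCast]
  have hG : 0 < (Module.finrank ℚ (kummerField a k) : ℝ) := by
    exact_mod_cast finrank_kummerField_pos a k
  have hH : 0 < (Nat.card (kummerSubgroup a q k) : ℝ) := by exact_mod_cast Nat.card_pos
  have hq : 0 < (q.totient : ℝ) := by exact_mod_cast Nat.totient_pos.2 (NeZero.pos q)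
  push_cast
  rw [div_le_div_iff₀ (mul_pos hH hG) (mul_pos hq hG)]
  have hcard' : (Nat.card (ZMod.unitsMap hd).ker : ℝ) * m.totient = q.totient := by
    exact_mod_cast hcard
  have hmt : (0 : ℝ) ≤ m.totient := Nat.cast_nonneg _
  calc _ = (Nat.card (ZMod.unitsMap hd).ker *
      ‖∑ b : (ZMod q)ˣ with b ∈ kummerSubgroup a q k, ZMod.stdAddChar ((z : ZMod q) * (b : ZMod q))‖) *
        (m.totient * Module.finrank ℚ (kummerField a k)) := by rw [← hcard']; ring
    _ ≤ (Nat.card (kummerSubgroup a q k) * B) *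
        (m.totient * Module.finrank ℚ (kummerField a k)) :=
        mul_le_mul_of_nonneg_right key (by positivity)
    _ = _ := by ring

theorem norm_normSum_le {a : ℤ} (ha : a ≠ -1 ∧ ¬ IsSquare a) {q k : ℕ} [NeZero q]
    (hk : Squarefree k) (z : (ZMod q)ˣ) :
    ‖normSum a q k (z : ZMod q)‖ ≤ (q.gcd (k.lcm (disc a).natAbs)).totient /
      (q.totient * Module.finrank ℚ (kummerField a k)) := by
  simpa using norm_normSum_le_of_norm_sum_le ha hk z (B := 1) fun w => sum_units_congr_one _ w

theorem normSum_eq_zero {a : ℤ} (ha : a ≠ -1 ∧ ¬ IsSquare a) {q k p : ℕ} [NeZero q]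
    (hk : Squarefree k) (z : (ZMod q)ˣ) (hp : p.Prime) (hpq : p * p ∣ q)
    (hmp : q.gcd (k.lcm (disc a).natAbs) ∣ q / p) : normSum a q k (z : ZMod q) = 0 := by
  have := norm_normSum_le_of_norm_sum_le ha hk z (B := 0) fun w => by
    rw [sum_units_congr_one_eq_zero _ w hp hpq hmp, norm_zero]
  simpa using this

end

/-! ### Bounds for the totient function -/

theorem totient_mul_le (a b : ℕ) : (a * b).totient ≤ a.totient * b := by
  induction b using Nat.recOnMul generalizing a with
  | zero => simp
  | one => simp
  | prime p hp =>
    rw [mul_comm a p, mul_comm _ p]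
    by_cases h : p ∣ a
    · rw [Nat.totient_mul_of_prime_of_dvd hp h]
    · rw [Nat.totient_mul_of_prime_of_not_dvd hp h]
      exact Nat.mul_le_mul_right _ (Nat.sub_le _ _)
  | mul x y hx hy =>
    rw [← mul_assoc]
    calc (a * x * y).totient ≤ (a * x).totient * y := hy _
      _ ≤ a.totient * x * y := Nat.mul_le_mul_right _ (hx _)
      _ = _ := by ring

/-- This yields φ(q) ≫ q^{3/4}. Locally p³ ≤ (p-1)⁴ for p ≥ 5, while the factors 8 and 2 compensate
at the primes 2 and 3. -/
theorem pow_three_le_totient_pow_four (q : ℕ) : q ^ 3 ≤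
    (if 2 ∣ q then 8 else 1) * (if 3 ∣ q then 2 else 1) * q.totient ^ 4 := by
  induction q using Nat.recOnPosPrimePosCoprime with
  | zero => simp
  | one => simp
  | prime_pow p n hp hn =>
    obtain ⟨m, rfl⟩ : ∃ m, n = m + 1 := ⟨n - 1, by omega⟩
    have hle : p ^ 3 ≤ (if 2 ∣ p then 8 else 1) * (if 3 ∣ p then 2 else 1) * (p - 1) ^ 4 := by
      rcases hp.eq_two_or_odd with h2 | h2
      · subst h2; decide
      · by_cases h3 : p = 3
        · subst h3; decide
        · have h5 : 5 ≤ p := by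
            have := hp.two_le
            omega
          obtain ⟨t, rfl⟩ : ∃ t, p = t + 5 := ⟨p - 5, by omega⟩
          have h1 : (t + 5) ^ 3 ≤ (t + 5 - 1) ^ 4 := by
            rw [show t + 5 - 1 = t + 4 by omega]
            nlinarith [Nat.zero_le t, Nat.zero_le (t ^ 2), Nat.zero_le (t ^ 3), Nat.zero_le (t ^ 4)]
          refine h1.trans (Nat.le_mul_of_pos_left _ ?_)
          split_ifs <;> norm_num
    have e : ∀ r : ℕ, r.Prime → (r ∣ p ^ (m + 1) ↔ r ∣ p) := fun r hr =>
      ⟨fun h => hr.dvd_of_dvd_pow h, fun h => h.trans (dvd_pow_self p m.succ_ne_zero)⟩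
    rw [Nat.totient_prime_pow hp hn]
    simp only [e 2 Nat.prime_two, e 3 Nat.prime_three]
    rw [Nat.add_sub_cancel]
    have hpm : (p ^ m) ^ 3 ≤ (p ^ m) ^ 4 :=
      Nat.pow_le_pow_right (pow_pos hp.pos m) (by norm_num)
    calc (p ^ (m + 1)) ^ 3 = (p ^ m) ^ 3 * p ^ 3 := by ring
      _ ≤ (p ^ m) ^ 4 * ((if 2 ∣ p then 8 else 1) * (if 3 ∣ p then 2 else 1) * (p - 1) ^ 4) :=
        Nat.mul_le_mul hpm hle
      _ = _ := by ring
  | coprime a b ha hb hab iha ihb =>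
    rw [Nat.totient_mul hab]
    have key : ∀ r c : ℕ, r.Prime → (if r ∣ a * b then c else 1) =
        (if r ∣ a then c else 1) * (if r ∣ b then c else 1) := by
      intro r c hr
      by_cases h1 : r ∣ a
      · have h2 : ¬ r ∣ b := fun h2 => hr.one_lt.ne'
          (Nat.dvd_one.1 (hab ▸ Nat.dvd_gcd h1 h2))
        simp [h1, h2, hr.dvd_mul]
      · by_cases h2 : r ∣ b <;> simp [h1, h2, hr.dvd_mul]
    rw [key 2 8 Nat.prime_two, key 3 2 Nat.prime_three]
    calc (a * b) ^ 3 = a ^ 3 * b ^ 3 := by ring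
      _ ≤ _ := Nat.mul_le_mul iha ihb
      _ = _ := by ring

theorem rpow_le_two_mul_totient (q : ℕ) : (q : ℝ) ^ (3 / 4 : ℝ) ≤ 2 * (q.totient : ℝ) := by
  have h1 : q ^ 3 ≤ 16 * q.totient ^ 4 := by
    refine (pow_three_le_totient_pow_four q).trans (Nat.mul_le_mul_right _ ?_)
    split_ifs <;> norm_num
  have h2 : (q : ℝ) ^ 3 ≤ (2 * (q.totient : ℝ)) ^ 4 := by
    have : (q : ℝ) ^ 3 ≤ 16 * (q.totient : ℝ) ^ 4 := by exact_mod_cast h1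
    calc (q : ℝ) ^ 3 ≤ 16 * (q.totient : ℝ) ^ 4 := this
      _ = _ := by ring
  have h3 := Real.rpow_le_rpow (by positivity) h2 (by norm_num : (0 : ℝ) ≤ 1 / 4)
  rw [← Real.rpow_natCast, ← Real.rpow_natCast, ← Real.rpow_mul (by positivity),
    ← Real.rpow_mul (by positivity)] at h3
  norm_num at h3
  exact h3

theorem rpow_neg_totient_le {q : ℕ} (hq : 0 < q) {e : ℝ} (he : 0 ≤ e) :
    (q.totient : ℝ) ^ (-e) ≤ 2 ^ e * (q : ℝ) ^ (-(3 / 4 * e)) := by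
  have hq' : (0 : ℝ) < q := by exact_mod_cast hq
  have hφ : (0 : ℝ) < q.totient := by exact_mod_cast Nat.totient_pos.2 hq
  have h1 := Real.rpow_le_rpow (by positivity) (rpow_le_two_mul_totient q) he
  rw [← Real.rpow_mul hq'.le, Real.mul_rpow (by norm_num) hφ.le] at h1
  rw [Real.rpow_neg hφ.le, Real.rpow_neg hq'.le, ← div_eq_mul_inv, inv_eq_one_div,
    div_le_div_iff₀ (by positivity) (by positivity), one_mul]
  exact h1

/-! ### Bounds for the normalized exponential sums -/

theorem inv_finrank_kummerField_le {a : ℤ} (ha : a ≠ -1 ∧ ¬ IsSquare a) {k : ℕ}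
    (hk : Squarefree k) : (Module.finrank ℚ (kummerField a k) : ℝ)⁻¹ ≤
      2 * powIndex a / (k.totient * k) := by
  have : NeZero k := ⟨hk.ne_zero⟩
  have hG : (0 : ℝ) < Module.finrank ℚ (kummerField a k) := by
    exact_mod_cast finrank_kummerField_pos a k
  have hk' : (0 : ℝ) < k := by exact_mod_cast NeZero.pos k
  have hφ : (0 : ℝ) < k.totient := by exact_mod_cast Nat.totient_pos.2 (NeZero.pos k)
  rw [inv_eq_one_div, div_le_div_iff₀ hG (by positivity), one_mul]
  exact_mod_cast le_finrank_kummerField ha hk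

theorem norm_normSum_le_inv {a : ℤ} {q k : ℕ} [NeZero q] [NeZero k] (z : ZMod q) :
    ‖normSum a q k z‖ ≤ (Module.finrank ℚ (kummerField a k) : ℝ)⁻¹ := by
  classical
  have hG : (0 : ℝ) < Module.finrank ℚ (kummerField a k) := by
    exact_mod_cast finrank_kummerField_pos a k
  have hH : (0 : ℝ) < Nat.card (kummerSubgroup a q k) := by exact_mod_cast Nat.card_pos
  rw [normSum, expSum_eq, ← card_kummerSubgroup_mul_finrank, norm_div, Complex.norm_natCast]
  have h1 : ‖∑ b : (ZMod q)ˣ with b ∈ kummerSubgroup a q k,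
      ZMod.stdAddChar (z * (b : ZMod q))‖ ≤ Nat.card (kummerSubgroup a q k) := by
    refine (norm_sum_le _ _).trans (le_of_eq ?_)
    simp only [AddChar.norm_apply, Finset.sum_const, nsmul_eq_mul, mul_one]
    rw [Nat.card_eq_fintype_card, Fintype.card_subtype]
  push_cast
  rw [inv_eq_one_div, div_le_div_iff₀ (mul_pos hH hG) hG, one_mul]
  exact mul_le_mul_of_nonneg_right h1 hG.le

theorem inv_finrank_kummerField_le_rpow {a : ℤ} (ha : a ≠ -1 ∧ ¬ IsSquare a) {k : ℕ}
    (hk : Squarefree k) : (Module.finrank ℚ (kummerField a k) : ℝ)⁻¹ ≤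
      4 * powIndex a * (k : ℝ) ^ (-(9 / 8) : ℝ) := by
  have hk0 := Nat.pos_of_ne_zero hk.ne_zero
  have hk' : (1 : ℝ) ≤ k := by exact_mod_cast hk0
  have hφ : (0 : ℝ) < k.totient := by exact_mod_cast Nat.totient_pos.2 hk0
  refine (inv_finrank_kummerField_le ha hk).trans ?_
  have h1 := rpow_neg_totient_le hk0 (e := 1) zero_le_one
  rw [Real.rpow_neg_one, Real.rpow_one] at h1
  have h2 : 2 * powIndex a / (k.totient * k : ℝ) = 2 * powIndex a * (k.totient : ℝ)⁻¹ *
      (k : ℝ) ^ (-1 : ℝ) := by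
    rw [Real.rpow_neg_one]
    field_simp
  rw [h2]
  calc _ ≤ 2 * powIndex a * (2 * (k : ℝ) ^ (-(3 / 4 * 1) : ℝ)) * (k : ℝ) ^ (-1 : ℝ) := by gcongr
    _ = 4 * powIndex a * ((k : ℝ) ^ (-(3 / 4 * 1) : ℝ) * (k : ℝ) ^ (-1 : ℝ)) := by ring
    _ = 4 * powIndex a * (k : ℝ) ^ (-(7 / 4) : ℝ) := by
      rw [← Real.rpow_add (by linarith)]
      norm_num
    _ ≤ _ := by
      gcongr 4 * powIndex a * ?_
      exact Real.rpow_le_rpow_of_exponent_le hk' (by norm_num)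

/-- Writing φ(gcd(q,k)) ≤ φ(q)^{1/6} φ(k)^{5/6} shares the saving between q and k. Three factors
φ(q)^{-5/6} and φ(q) values of z leave φ(q)^{-3/2} ≪ q^{-9/8}, while φ(k)^{-1/6}k^{-1} ≪ k^{-9/8}:
both are summable. -/
theorem norm_normSum_le_rpow {a : ℤ} (ha : a ≠ -1 ∧ ¬ IsSquare a) {q k : ℕ} [NeZero q]
    (hk : Squarefree k) (z : (ZMod q)ˣ) :
    ‖normSum a q k (z : ZMod q)‖ ≤ 4 * (powIndex a * (disc a).natAbs) *
      (q.totient : ℝ) ^ (-(5 / 6) : ℝ) * (k : ℝ) ^ (-(9 / 8) : ℝ) := by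
  have hk0 := Nat.pos_of_ne_zero hk.ne_zero
  have hk1 : (0 : ℝ) < k := by exact_mod_cast hk0
  have hφq : (0 : ℝ) < q.totient := by exact_mod_cast Nat.totient_pos.2 (NeZero.pos q)
  have hφk : (0 : ℝ) < k.totient := by exact_mod_cast Nat.totient_pos.2 hk0
  have hm : (q.gcd (k.lcm (disc a).natAbs)).totient ≤ (q.gcd k).totient * (disc a).natAbs := by
    have hdvd : q.gcd (k.lcm (disc a).natAbs) ∣ q.gcd k * (disc a).natAbs := by
      refine (Nat.gcd_dvd_gcd_of_dvd_right q (Nat.lcm_dvd_mul k _)).trans ?_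
      exact (Nat.gcd_mul_right_dvd_mul_gcd q k _).trans
        (mul_dvd_mul_left _ (Nat.gcd_dvd_right _ _))
    have hpos : 0 < (q.gcd k * (disc a).natAbs) :=
      Nat.mul_pos (Nat.gcd_pos_of_pos_left _ (NeZero.pos q)) (natAbs_disc_pos a)
    exact (Nat.le_of_dvd (Nat.totient_pos.2 hpos) (Nat.totient_dvd_of_dvd hdvd)).trans
      (totient_mul_le _ _)
  obtain ⟨g, hgdef⟩ : ∃ g : ℝ, g = ((q.gcd k).totient : ℝ) := ⟨_, rfl⟩
  have hg0 : 0 < g := by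
    rw [hgdef]
    exact_mod_cast Nat.totient_pos.2 (Nat.gcd_pos_of_pos_left k (NeZero.pos q))
  have hgq : g ≤ q.totient := by
    rw [hgdef]
    exact_mod_cast Nat.le_of_dvd (Nat.totient_pos.2 (NeZero.pos q))
      (Nat.totient_dvd_of_dvd (Nat.gcd_dvd_left q k))
  have hgk : g ≤ k.totient := by
    rw [hgdef]
    exact_mod_cast Nat.le_of_dvd (Nat.totient_pos.2 hk0)
      (Nat.totient_dvd_of_dvd (Nat.gcd_dvd_right q k))
  have hg : g ≤ (q.totient : ℝ) ^ (1 / 6 : ℝ) * (k.totient : ℝ) ^ (5 / 6 : ℝ) := by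
    calc g = g ^ (1 / 6 : ℝ) * g ^ (5 / 6 : ℝ) := by
          rw [← Real.rpow_add hg0]; norm_num
      _ ≤ _ := by gcongr
  have hm' : ((q.gcd (k.lcm (disc a).natAbs)).totient : ℝ) ≤ g * (disc a).natAbs := by
    rw [hgdef]
    exact_mod_cast hm
  have h1 := norm_normSum_le ha hk z
  have h2 := inv_finrank_kummerField_le ha hk
  have hG : (0 : ℝ) ≤ (Module.finrank ℚ (kummerField a k) : ℝ)⁻¹ := by positivity
  have h3 := rpow_neg_totient_le hk0 (e := 1 / 6) (by norm_num)
  have h2c : (2 : ℝ) ^ (1 / 6 : ℝ) ≤ 2 := by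
    calc (2 : ℝ) ^ (1 / 6 : ℝ) ≤ 2 ^ (1 : ℝ) :=
          Real.rpow_le_rpow_of_exponent_le (by norm_num) (by norm_num)
      _ = 2 := Real.rpow_one 2
  have e1 : (q.totient : ℝ) ^ (1 / 6 : ℝ) * (q.totient : ℝ)⁻¹ = (q.totient : ℝ) ^ (-(5 / 6) : ℝ) := by
    rw [← Real.rpow_neg_one, ← Real.rpow_add hφq]; norm_num
  have e2 : (k.totient : ℝ) ^ (5 / 6 : ℝ) * (k.totient : ℝ)⁻¹ = (k.totient : ℝ) ^ (-(1 / 6) : ℝ) := by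
    rw [← Real.rpow_neg_one, ← Real.rpow_add hφk]; norm_num
  have e3 : (k : ℝ) ^ (-(3 / 4 * (1 / 6)) : ℝ) * (k : ℝ)⁻¹ = (k : ℝ) ^ (-(9 / 8) : ℝ) := by
    rw [← Real.rpow_neg_one, ← Real.rpow_add hk1]; norm_num
  calc ‖normSum a q k (z : ZMod q)‖
      ≤ (q.gcd (k.lcm (disc a).natAbs)).totient * ((q.totient : ℝ)⁻¹ *
          (Module.finrank ℚ (kummerField a k) : ℝ)⁻¹) := by
        rw [← mul_inv, ← div_eq_mul_inv]; exact h1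
    _ ≤ (((q.totient : ℝ) ^ (1 / 6 : ℝ) * (k.totient : ℝ) ^ (5 / 6 : ℝ)) * (disc a).natAbs) *
          ((q.totient : ℝ)⁻¹ * (2 * powIndex a / (k.totient * k))) := by
        gcongr
        exact hm'.trans (by gcongr)
    _ = 2 * (powIndex a * (disc a).natAbs) * ((q.totient : ℝ) ^ (1 / 6 : ℝ) * (q.totient : ℝ)⁻¹) *
          (((k.totient : ℝ) ^ (5 / 6 : ℝ) * (k.totient : ℝ)⁻¹) * (k : ℝ)⁻¹) := by
        rw [div_eq_mul_inv (2 * (powIndex a : ℝ)), mul_inv]; ring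
    _ ≤ 2 * (powIndex a * (disc a).natAbs) * (q.totient : ℝ) ^ (-(5 / 6) : ℝ) *
          ((2 * (k : ℝ) ^ (-(3 / 4 * (1 / 6)) : ℝ)) * (k : ℝ)⁻¹) := by
        rw [e1, e2]
        gcongr
        exact h3.trans (by gcongr)
    _ = _ := by rw [← e3]; ring

/-- The constant in the bound for the terms of the singular series. -/
def termConst (a : Fin 3 → ℤ) : ℝ := 4 * ∏ i, (4 * (powIndex (a i) * (disc (a i)).natAbs) : ℝ)

theorem norm_singTerm_le {a : Fin 3 → ℤ} (ha : ∀ i, a i ≠ -1 ∧ ¬ IsSquare (a i)) {k : Fin 3 → ℕ+}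
    (hk : ∀ i, Squarefree (k i : ℕ)) (n : ℕ) (q : ℕ+) :
    ‖singTerm a k n q‖ ≤ termConst a * (∏ i, ((k i : ℕ) : ℝ) ^ (-(9 / 8) : ℝ)) *
      ((q : ℕ) : ℝ) ^ (-(9 / 8) : ℝ) := by
  have hφq : (0 : ℝ) < (q : ℕ).totient := by exact_mod_cast Nat.totient_pos.2 q.pos
  set t : ℝ := ((q : ℕ).totient : ℝ)
  rw [singTerm_eq]
  have h1 : ∀ z : (ZMod (q : ℕ))ˣ, ‖ZMod.stdAddChar (-(n : ZMod (q : ℕ)) * (z : ZMod (q : ℕ))) *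
      ∏ i, normSum (a i) q (k i) (z : ZMod (q : ℕ))‖ ≤
      ∏ i, (4 * (powIndex (a i) * (disc (a i)).natAbs) * t ^ (-(5 / 6) : ℝ) *
        ((k i : ℕ) : ℝ) ^ (-(9 / 8) : ℝ)) := by
    intro z
    rw [norm_mul, AddChar.norm_apply, one_mul, norm_prod]
    exact Finset.prod_le_prod (fun _ _ => norm_nonneg _)
      fun i _ => norm_normSum_le_rpow (ha i) (hk i) z
  refine (norm_sum_le _ _).trans ((Finset.sum_le_sum fun z _ => h1 z).trans ?_)
  rw [Finset.sum_const, Finset.card_univ, ZMod.card_units_eq_totient, nsmul_eq_mul]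
  simp only [Finset.prod_mul_distrib, Finset.prod_const, Finset.card_univ, Fintype.card_fin]
  have e1 : t * (t ^ (-(5 / 6) : ℝ)) ^ 3 = t ^ (-(3 / 2) : ℝ) := by
    rw [← Real.rpow_natCast, ← Real.rpow_mul hφq.le]
    nth_rw 1 [← Real.rpow_one t]
    rw [← Real.rpow_add hφq]
    norm_num
  have h2 := rpow_neg_totient_le q.pos (e := 3 / 2) (by norm_num)
  have h4 : (2 : ℝ) ^ (3 / 2 : ℝ) ≤ 4 := by
    calc (2 : ℝ) ^ (3 / 2 : ℝ) ≤ 2 ^ (2 : ℝ) :=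
          Real.rpow_le_rpow_of_exponent_le (by norm_num) (by norm_num)
      _ = 4 := by norm_num
  have e2 : (-(3 / 4 * (3 / 2)) : ℝ) = -(9 / 8) := by norm_num
  rw [e2] at h2
  have h5 : t ^ (-(3 / 2) : ℝ) ≤ 4 * ((q : ℕ) : ℝ) ^ (-(9 / 8) : ℝ) := h2.trans (by gcongr)
  set K : ℝ := ∏ i, ((k i : ℕ) : ℝ) ^ (-(9 / 8) : ℝ)
  have hK : 0 ≤ K := Finset.prod_nonneg fun i _ => by positivity
  have hP : (0 : ℝ) ≤ ∏ i, (powIndex (a i) : ℝ) := Finset.prod_nonneg fun i _ => by positivity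
  have hD : (0 : ℝ) ≤ ∏ i, ((disc (a i)).natAbs : ℝ) := Finset.prod_nonneg fun i _ => by positivity
  calc _ = 4 ^ 3 * ((∏ i, (powIndex (a i) : ℝ)) * ∏ i, ((disc (a i)).natAbs : ℝ)) * K *
        (t * (t ^ (-(5 / 6) : ℝ)) ^ 3) := by ring
    _ ≤ 4 ^ 3 * ((∏ i, (powIndex (a i) : ℝ)) * ∏ i, ((disc (a i)).natAbs : ℝ)) * K *
        (4 * ((q : ℕ) : ℝ) ^ (-(9 / 8) : ℝ)) := by
      rw [e1]
      gcongr
    _ = _ := by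
      simp only [termConst, Finset.prod_mul_distrib, Finset.prod_const, Finset.card_univ,
        Fintype.card_fin]
      ring

/-! ### Absolute convergence -/

theorem summable_pnat_rpow : Summable fun k : ℕ+ => ((k : ℕ) : ℝ) ^ (-(9 / 8) : ℝ) := by
  have h : Summable fun k : ℕ => (k : ℝ) ^ (-(9 / 8) : ℝ) :=
    Real.summable_nat_rpow.2 (by norm_num)
  exact h.comp_injective PNat.coe_injective

theorem summable_norm_singTerm {a : Fin 3 → ℤ} (ha : ∀ i, a i ≠ -1 ∧ ¬ IsSquare (a i))
    {k : Fin 3 → ℕ+} (hk : ∀ i, Squarefree (k i : ℕ)) (n : ℕ) :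
    Summable fun q : ℕ+ => ‖singTerm a k n q‖ :=
  Summable.of_nonneg_of_le (fun _ => norm_nonneg _) (fun q => norm_singTerm_le ha hk n q)
    (summable_pnat_rpow.mul_left _)

theorem summable_norm_pi_prod {α : Type*} {m : ℕ} (f : Fin m → α → ℂ)
    (hf : ∀ i, Summable fun x => ‖f i x‖) :
    (Summable fun k : Fin m → α => ‖∏ i, f i (k i)‖) ∧
      ∑' k : Fin m → α, ∏ i, f i (k i) = ∏ i, ∑' x, f i x := by
  induction m with
  | zero =>
    refine ⟨?_, ?_⟩
    · exact (hasSum_unique _).summable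
    · rw [tsum_eq_single default fun b hb => absurd (Subsingleton.elim b _) hb]
      simp
  | succ m ih =>
    obtain ⟨ih1, ih2⟩ := ih (fun i => f i.succ) fun i => hf i.succ
    let e : α × (Fin m → α) ≃ (Fin (m + 1) → α) := Fin.consEquiv fun _ => α
    have he : ∀ x : α × (Fin m → α), ∏ i, f i (e x i) = f 0 x.1 * ∏ i, f i.succ (x.2 i) := by
      intro x
      rw [Fin.prod_univ_succ]
      rfl
    refine ⟨?_, ?_⟩
    · rw [← e.summable_iff]
      have := (hf 0).mul_norm ih1
      refine this.congr fun x => ?_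
      rw [Function.comp_apply, he]
    · rw [← e.tsum_eq, Fin.prod_univ_succ, ← ih2, tsum_mul_tsum_of_summable_norm (hf 0) ih1]
      exact tsum_congr he

/-- The double family `μ(k₁) μ(k₂) μ(k₃) 𝔖`-term. -/
def doubleTerm (a : Fin 3 → ℤ) (n : ℕ) (k : Fin 3 → ℕ+) (q : ℕ+) : ℂ :=
  (∏ i, (ArithmeticFunction.moebius (k i : ℕ) : ℂ)) * singTerm a k n q

theorem norm_moebius_le_one (k : ℕ) : ‖(ArithmeticFunction.moebius k : ℂ)‖ ≤ 1 := by
  rw [Complex.norm_intCast]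
  exact_mod_cast ArithmeticFunction.abs_moebius_le_one

theorem norm_doubleTerm_le {a : Fin 3 → ℤ} (ha : ∀ i, a i ≠ -1 ∧ ¬ IsSquare (a i)) (n : ℕ)
    (k : Fin 3 → ℕ+) (q : ℕ+) : ‖doubleTerm a n k q‖ ≤
      termConst a * (∏ i, ((k i : ℕ) : ℝ) ^ (-(9 / 8) : ℝ)) * ((q : ℕ) : ℝ) ^ (-(9 / 8) : ℝ) := by
  rw [doubleTerm, norm_mul, norm_prod]
  by_cases hk : ∀ i, Squarefree (k i : ℕ)
  · refine le_trans (mul_le_of_le_one_left (norm_nonneg _) ?_) (norm_singTerm_le ha hk n q)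
    exact Finset.prod_le_one (fun _ _ => norm_nonneg _) fun i _ => norm_moebius_le_one _
  · push Not at hk
    obtain ⟨i, hi⟩ := hk
    rw [Finset.prod_eq_zero (Finset.mem_univ i)
      (by rw [ArithmeticFunction.moebius_eq_zero_of_not_squarefree hi]; simp), zero_mul]
    have : 0 ≤ termConst a := mul_nonneg (by norm_num) (Finset.prod_nonneg fun i _ => by positivity)
    have h2 : (0 : ℝ) ≤ ∏ i, ((k i : ℕ) : ℝ) ^ (-(9 / 8) : ℝ) :=
      Finset.prod_nonneg fun i _ => by positivity
    positivity

theorem summable_norm_doubleTerm {a : Fin 3 → ℤ} (ha : ∀ i, a i ≠ -1 ∧ ¬ IsSquare (a i)) (n : ℕ) :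
    Summable fun x : (Fin 3 → ℕ+) × ℕ+ => ‖doubleTerm a n x.1 x.2‖ := by
  have h1 : Summable fun k : Fin 3 → ℕ+ => ∏ i, ((k i : ℕ) : ℝ) ^ (-(9 / 8) : ℝ) := by
    have hs : Summable fun k : ℕ+ => ‖((((k : ℕ) : ℝ) ^ (-(9 / 8) : ℝ) : ℝ) : ℂ)‖ := by
      refine summable_pnat_rpow.congr fun k => ?_
      rw [Complex.norm_real, Real.norm_of_nonneg (by positivity)]
    refine (summable_norm_pi_prod (fun _ : Fin 3 => _) fun _ => hs).1.congr fun k => ?_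
    rw [← Complex.ofReal_prod, Complex.norm_real,
      Real.norm_of_nonneg (Finset.prod_nonneg fun i _ => by positivity)]
  refine Summable.of_nonneg_of_le (fun _ => norm_nonneg _)
    (fun x => norm_doubleTerm_le ha n x.1 x.2) ?_
  have h2 := (h1.mul_left (termConst a)).mul_of_nonneg summable_pnat_rpow
    (fun k => mul_nonneg (mul_nonneg (by norm_num) (Finset.prod_nonneg fun i _ => by positivity))
      (Finset.prod_nonneg fun i _ => by positivity)) (fun q => by positivity)
  exact h2

theorem factorTerm_eq (a : Fin 3 → ℤ) (n : ℕ) (k : Fin 3 → ℕ+) :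
    factorTerm a n k = ∑' q : ℕ+, doubleTerm a n k q := by
  rw [factorTerm, singSeries, ← tsum_mul_left]
  rfl

theorem summable_norm_factorTerm {a : Fin 3 → ℤ} (ha : ∀ i, a i ≠ -1 ∧ ¬ IsSquare (a i)) (n : ℕ) :
    Summable fun k : Fin 3 → ℕ+ => ‖factorTerm a n k‖ := by
  have h := summable_norm_doubleTerm ha n
  refine Summable.of_nonneg_of_le (fun _ => norm_nonneg _) (fun k => ?_) h.prod
  rw [factorTerm_eq]
  exact norm_tsum_le_tsum_norm (h.prod_factor k)

/-- `∑_k μ(k) S_{a,q,k}(z) / [F_{a,q,k} : ℚ]`. -/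
def densityFourier (a : ℤ) (q : ℕ) [NeZero q] (z : ZMod q) : ℂ :=
  ∑' k : ℕ+, (ArithmeticFunction.moebius (k : ℕ) : ℂ) * normSum a q k z

theorem norm_moebius_mul_le {a : ℤ} (ha : a ≠ -1 ∧ ¬ IsSquare a) {x : ℂ} (k : ℕ+)
    (hx : ‖x‖ ≤ (Module.finrank ℚ (kummerField a k) : ℝ)⁻¹) :
    ‖(ArithmeticFunction.moebius (k : ℕ) : ℂ) * x‖ ≤
      4 * powIndex a * ((k : ℕ) : ℝ) ^ (-(9 / 8) : ℝ) := by
  by_cases hk : Squarefree (k : ℕ)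
  · rw [norm_mul]
    exact (mul_le_of_le_one_left (norm_nonneg _) (norm_moebius_le_one _)).trans
      (hx.trans (inv_finrank_kummerField_le_rpow ha hk))
  · rw [ArithmeticFunction.moebius_eq_zero_of_not_squarefree hk]
    simp only [Int.cast_zero, zero_mul, norm_zero]
    positivity

theorem summable_norm_moebius_mul {a : ℤ} (ha : a ≠ -1 ∧ ¬ IsSquare a) {x : ℕ+ → ℂ}
    (hx : ∀ k, ‖x k‖ ≤ (Module.finrank ℚ (kummerField a k) : ℝ)⁻¹) :
    Summable fun k : ℕ+ => ‖(ArithmeticFunction.moebius (k : ℕ) : ℂ) * x k‖ :=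
  Summable.of_nonneg_of_le (fun _ => norm_nonneg _)
    (fun k => norm_moebius_mul_le ha k (hx k)) (summable_pnat_rpow.mul_left _)

theorem summable_norm_moebius_mul_normSum {a : ℤ} (ha : a ≠ -1 ∧ ¬ IsSquare a) {q : ℕ} [NeZero q]
    (z : ZMod q) :
    Summable fun k : ℕ+ => ‖(ArithmeticFunction.moebius (k : ℕ) : ℂ) * normSum a q k z‖ :=
  summable_norm_moebius_mul ha fun _ => norm_normSum_le_inv z

/-- The sum over `k` of the `q`-th terms of the singular series. -/
def modulusTerm (a : Fin 3 → ℤ) (n q : ℕ) [NeZero q] : ℂ :=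
  ∑ z : (ZMod q)ˣ, ZMod.stdAddChar (-(n : ZMod q) * (z : ZMod q)) *
    ∏ i, densityFourier (a i) q (z : ZMod q)

/-- For fixed q and z the sum over the triple k factors into three sums over a single k. -/
theorem tsum_doubleTerm {a : Fin 3 → ℤ} (ha : ∀ i, a i ≠ -1 ∧ ¬ IsSquare (a i)) (n : ℕ) (q : ℕ+) :
    ∑' k : Fin 3 → ℕ+, doubleTerm a n k q = modulusTerm a n q := by
  have hpi := fun z : ZMod (q : ℕ) => summable_norm_pi_prod
    (fun (i : Fin 3) (k : ℕ+) => (ArithmeticFunction.moebius (k : ℕ) : ℂ) * normSum (a i) q k z)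
    fun i => summable_norm_moebius_mul_normSum (ha i) z
  have h1 : ∀ k : Fin 3 → ℕ+, doubleTerm a n k q = ∑ z : (ZMod (q : ℕ))ˣ,
      ZMod.stdAddChar (-(n : ZMod (q : ℕ)) * (z : ZMod (q : ℕ))) *
        ∏ i, ((ArithmeticFunction.moebius (k i : ℕ) : ℂ) *
          normSum (a i) q (k i) (z : ZMod (q : ℕ))) := by
    intro k
    rw [doubleTerm, singTerm_eq, Finset.mul_sum]
    refine Finset.sum_congr rfl fun z _ => ?_
    rw [Finset.prod_mul_distrib]
    ring
  simp_rw [h1]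
  rw [Summable.tsum_finsetSum fun z _ => (hpi _).1.of_norm.mul_left _, modulusTerm]
  refine Finset.sum_congr rfl fun z _ => ?_
  rw [tsum_mul_left, (hpi _).2]
  rfl

theorem summable_modulusTerm {a : Fin 3 → ℤ} (ha : ∀ i, a i ≠ -1 ∧ ¬ IsSquare (a i)) (n : ℕ) :
    Summable fun q : ℕ+ => modulusTerm a n q := by
  have h := (summable_norm_doubleTerm ha n).of_norm.prod_symm.prod
  exact h.congr fun q => tsum_doubleTerm ha n q

theorem artinFactor_eq_tsum {a : Fin 3 → ℤ} (ha : ∀ i, a i ≠ -1 ∧ ¬ IsSquare (a i)) (n : ℕ) :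
    artinFactor a n = 1 / 2 * ∑' q : ℕ+, modulusTerm a n q := by
  rw [artinFactor]
  congr 1
  simp_rw [factorTerm_eq, ← tsum_doubleTerm ha]
  exact (Summable.tsum_comm (f := fun k q => doubleTerm a n k q)
    (summable_norm_doubleTerm ha n).of_norm).symm

/-! ### Euler products -/

theorem hasProd_one_sub_of_summable {ρ : ℕ → ℝ}
    (h : Summable fun k : ℕ => ‖(ArithmeticFunction.moebius k : ℝ) * ∏ p ∈ k.primeFactors, ρ p‖) :
    HasProd (Set.mulIndicator {p : ℕ | p.Prime} fun p => 1 - ρ p)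
      (∑' k : ℕ, (ArithmeticFunction.moebius k : ℝ) * ∏ p ∈ k.primeFactors, ρ p) := by
  have h1 := EulerProduct.eulerProduct_hasProd_mulIndicator
    (f := fun k : ℕ => (ArithmeticFunction.moebius k : ℝ) * ∏ p ∈ k.primeFactors, ρ p)
    (by simp) (fun {m n} hmn => by
      rw [ArithmeticFunction.isMultiplicative_moebius.map_mul_of_coprime hmn,
        hmn.primeFactors_mul, Finset.prod_union hmn.disjoint_primeFactors]
      push_cast
      ring) h (by simp)
  suffices heq : (Set.mulIndicator {p : ℕ | p.Prime} fun p => 1 - ρ p) =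
      Set.mulIndicator {p : ℕ | p.Prime} fun p => ∑' e : ℕ,
        (ArithmeticFunction.moebius (p ^ e) : ℝ) * ∏ r ∈ (p ^ e).primeFactors, ρ r by
    rw [heq]
    exact h1
  funext p
  by_cases hp : p.Prime
  · rw [Set.mulIndicator_of_mem (show p ∈ {p : ℕ | p.Prime} from hp),
      Set.mulIndicator_of_mem (show p ∈ {p : ℕ | p.Prime} from hp),
      tsum_eq_sum (s := Finset.range 2)]
    · rw [Finset.sum_range_succ, Finset.sum_range_one, pow_zero, pow_one,
        ArithmeticFunction.moebius_apply_prime hp, hp.primeFactors]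
      simp
      ring
    · intro e he
      have he2 : 1 < e := by simpa using he
      rw [ArithmeticFunction.moebius_apply_prime_pow hp (by omega), if_neg (by omega)]
      simp
  · rw [Set.mulIndicator_of_notMem (show p ∉ {p : ℕ | p.Prime} from hp),
      Set.mulIndicator_of_notMem (show p ∉ {p : ℕ | p.Prime} from hp)]

/-- Removing the prime `2` from the product `∏ (1 - ρ p)` doubles it if `ρ 2 = 1/2`, so that the
even numbers contribute minus the whole sum. -/
theorem tsum_moebius_even {ρ : ℕ → ℝ}
    (h : Summable fun k : ℕ => ‖(ArithmeticFunction.moebius k : ℝ) * ∏ p ∈ k.primeFactors, ρ p‖)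
    (h2 : ρ 2 = 1 / 2) (ψ : ℝ) :
    ∑' k : ℕ, (ArithmeticFunction.moebius k : ℝ) * (∏ p ∈ k.primeFactors, ρ p) *
        (if 2 ∣ k then 1 + ψ else 1) =
      (1 - ψ) * ∑' k : ℕ, (ArithmeticFunction.moebius k : ℝ) * ∏ p ∈ k.primeFactors, ρ p := by
  set g : ℕ → ℝ := fun k => (ArithmeticFunction.moebius k : ℝ) * ∏ p ∈ k.primeFactors, ρ p with hg
  set ρ' : ℕ → ℝ := fun p => if p = 2 then 0 else ρ p with hρ'
  have hg' : ∀ k, (ArithmeticFunction.moebius k : ℝ) * ∏ p ∈ k.primeFactors, ρ' p =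
      if 2 ∣ k then 0 else g k := by
    intro k
    by_cases hk0 : k = 0
    · simp [hk0]
    split_ifs with hk
    · rw [Finset.prod_eq_zero (i := 2) (Nat.mem_primeFactors.2 ⟨Nat.prime_two, hk, hk0⟩)
        (by simp [hρ']), mul_zero]
    · rw [hg]
      congr 1
      refine Finset.prod_congr rfl fun p hp => if_neg ?_
      rintro rfl
      exact hk (Nat.dvd_of_mem_primeFactors hp)
  have hs' : Summable fun k : ℕ =>
      ‖(ArithmeticFunction.moebius k : ℝ) * ∏ p ∈ k.primeFactors, ρ' p‖ := by
    refine Summable.of_nonneg_of_le (fun _ => norm_nonneg _) (fun k => ?_) h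
    rw [hg']
    split_ifs
    · rw [norm_zero]
      exact norm_nonneg _
    · exact le_rfl
  have hp := hasProd_one_sub_of_summable h
  have hp' := hasProd_one_sub_of_summable hs'
  have h2' : HasProd (fun p : ℕ => if p = 2 then (1 / 2 : ℝ) else 1) (1 / 2) := by
    have := hasProd_prod_of_ne_finset_one (f := fun p : ℕ => if p = 2 then (1 / 2 : ℝ) else 1)
      (s := {2}) (L := SummationFilter.unconditional ℕ) fun b hb => if_neg (by simpa using hb)
    simpa using this
  have hmul := h2'.mul hp'
  have heq : (fun p : ℕ => (if p = 2 then (1 / 2 : ℝ) else 1) *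
      Set.mulIndicator {p : ℕ | p.Prime} (fun p => 1 - ρ' p) p) =
      Set.mulIndicator {p : ℕ | p.Prime} fun p => 1 - ρ p := by
    funext p
    by_cases hp : p.Prime
    · rw [Set.mulIndicator_of_mem (show p ∈ {p : ℕ | p.Prime} from hp),
        Set.mulIndicator_of_mem (show p ∈ {p : ℕ | p.Prime} from hp)]
      by_cases hp2 : p = 2
      · simp only [hρ', hp2, if_true, h2]
        norm_num
      · simp only [hρ', if_neg hp2, one_mul]
    · rw [Set.mulIndicator_of_notMem (show p ∉ {p : ℕ | p.Prime} from hp),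
        Set.mulIndicator_of_notMem (show p ∉ {p : ℕ | p.Prime} from hp), mul_one,
        if_neg fun h : p = 2 => hp (by rw [h]; exact Nat.prime_two)]
  rw [heq] at hmul
  have hval := hp.unique hmul
  rw [tsum_congr hg'] at hval
  have hs'' := (summable_congr hg').1 hs'.of_norm
  have hterm : ∀ k, g k * (if 2 ∣ k then 1 + ψ else 1) =
      (1 + ψ) * g k - ψ * (if 2 ∣ k then 0 else g k) := by
    intro k
    split_ifs <;> ring
  refine (tsum_congr hterm).trans ?_
  rw [(h.of_norm.mul_left _).tsum_sub (hs''.mul_left _), tsum_mul_left, tsum_mul_left]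
  change (1 + ψ) * ∑' k, g k - _ = (1 - ψ) * ∑' k, g k
  change ∑' k, g k = _ at hval
  linear_combination (2 * ψ) * hval

/-! ### The local factors of Artin's constant -/

/-- The local weight `γ_p`, with `𝒜_a = ∏ (1 - γ_p)`. -/
def artinWeight (a : ℤ) (p : ℕ) : ℝ := kummerWeight a p / ((p : ℝ) - 1)

theorem kummerWeight_nonneg (a : ℤ) (p : ℕ) : 0 ≤ kummerWeight a p := by
  rw [kummerWeight]
  split_ifs <;> positivity

theorem kummerWeight_le_one (a : ℤ) (p : ℕ) : kummerWeight a p ≤ 1 := by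
  rw [kummerWeight]
  split_ifs
  · exact le_rfl
  · exact Nat.cast_inv_le_one p

theorem kummerWeight_two {a : ℤ} (ha : a ≠ -1 ∧ ¬ IsSquare a) : kummerWeight a 2 = 1 / 2 := by
  rw [kummerWeight, if_neg (not_two_dvd_powIndex ha)]
  norm_num

theorem artinWeight_nonneg (a : ℤ) {p : ℕ} (hp : p.Prime) : 0 ≤ artinWeight a p := by
  have : (2 : ℝ) ≤ p := by exact_mod_cast hp.two_le
  exact div_nonneg (kummerWeight_nonneg a p) (by linarith)

theorem artinWeight_le_half {a : ℤ} (ha : a ≠ -1 ∧ ¬ IsSquare a) {p : ℕ} (hp : p.Prime) :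
    artinWeight a p ≤ 1 / 2 := by
  rcases hp.eq_two_or_odd with rfl | hodd
  · rw [artinWeight, kummerWeight_two ha]
    norm_num
  · have h3 : (3 : ℝ) ≤ p := by
      have := hp.two_le
      exact_mod_cast (show 3 ≤ p by omega)
    rw [artinWeight, div_le_iff₀ (by linarith)]
    linarith [kummerWeight_le_one a p]

theorem one_sub_artinWeight_pos {a : ℤ} (ha : a ≠ -1 ∧ ¬ IsSquare a) {p : ℕ} (hp : p.Prime) :
    0 < 1 - artinWeight a p := by
  linarith [artinWeight_le_half ha hp]

theorem artinWeight_of_not_dvd {a : ℤ} {p : ℕ} (h : ¬ p ∣ powIndex a) :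
    artinWeight a p = 1 / ((p : ℝ) * ((p : ℝ) - 1)) := by
  rw [artinWeight, kummerWeight, if_neg h, inv_eq_one_div, div_div]

theorem artinWeight_of_dvd {a : ℤ} {p : ℕ} (h : p ∣ powIndex a) :
    artinWeight a p = 1 / ((p : ℝ) - 1) := by
  rw [artinWeight, kummerWeight, if_pos h]

theorem inv_mul_sub_one_le (p : ℕ) (hp : 2 ≤ p) :
    1 / ((p : ℝ) * ((p : ℝ) - 1)) ≤ 2 * (1 / (p : ℝ) ^ 2) := by
  have : (2 : ℝ) ≤ p := by exact_mod_cast hp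
  rw [mul_one_div, div_le_div_iff₀ (by nlinarith) (by nlinarith)]
  nlinarith

theorem hasProd_artinA {a : ℤ} (ha : a ≠ -1 ∧ ¬ IsSquare a) :
    HasProd (Set.mulIndicator {p : ℕ | p.Prime} fun p => 1 - artinWeight a p) (artinA a) := by
  have h1 : HasProd (Set.mulIndicator ((powIndex a).primeFactors : Set ℕ)
      fun p => 1 - artinWeight a p) (∏ p ∈ (powIndex a).primeFactors, (1 - 1 / ((p : ℝ) - 1))) := by
    rw [← hasProd_subtype_iff_mulIndicator]
    convert Finset.hasProd (powIndex a).primeFactors (fun p : ℕ => 1 - artinWeight a p) using 1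
    exact Finset.prod_congr rfl fun p hp => by
      rw [artinWeight_of_dvd (Nat.dvd_of_mem_primeFactors hp)]
  have h2 : HasProd (Set.mulIndicator {p : ℕ | p.Prime ∧ ¬ p ∣ powIndex a}
      fun p => 1 - artinWeight a p) (∏' p : {p : ℕ // p.Prime ∧ ¬ p ∣ powIndex a},
      (1 - 1 / (((p : ℕ) : ℝ) * (((p : ℕ) : ℝ) - 1)))) := by
    rw [← hasProd_subtype_iff_mulIndicator]
    have hm : Multipliable fun p : {p : ℕ // p.Prime ∧ ¬ p ∣ powIndex a} =>
        (1 - 1 / (((p : ℕ) : ℝ) * (((p : ℕ) : ℝ) - 1))) := by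
      simp_rw [sub_eq_add_neg (1 : ℝ)]
      refine multipliable_one_add_of_summable ?_
      have hs : Summable fun p : {p : ℕ // p.Prime ∧ ¬ p ∣ powIndex a} =>
          2 * (1 / ((p : ℕ) : ℝ) ^ 2) :=
        ((Real.summable_one_div_nat_pow.2 one_lt_two).mul_left 2).subtype _
      refine Summable.of_nonneg_of_le (fun _ => norm_nonneg _) (fun p => ?_) hs
      have h2 := p.2.1.two_le
      have : (2 : ℝ) ≤ (p : ℕ) := by exact_mod_cast h2
      rw [norm_neg, Real.norm_of_nonneg (one_div_nonneg.2 (by nlinarith))]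
      exact inv_mul_sub_one_le _ h2
    refine (hm.hasProd).congr_fun ?_
    intro p
    exact congrArg _ (artinWeight_of_not_dvd p.2.2)
  have h3 := h1.mul h2
  rw [artinA]
  convert h3 using 1
  funext p
  by_cases hp : p.Prime
  · by_cases hd : p ∣ powIndex a
    · rw [Set.mulIndicator_of_mem (show p ∈ {p : ℕ | p.Prime} from hp),
        Set.mulIndicator_of_mem, Set.mulIndicator_of_notMem (fun h => h.2 hd), mul_one]
      exact Nat.mem_primeFactors.2 ⟨hp, hd, (powIndex_pos ha).ne'⟩
    · rw [Set.mulIndicator_of_mem (show p ∈ {p : ℕ | p.Prime} from hp),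
        Set.mulIndicator_of_notMem (fun h => hd (Nat.dvd_of_mem_primeFactors h)),
        Set.mulIndicator_of_mem (show p ∈ {p : ℕ | p.Prime ∧ ¬ p ∣ powIndex a} from ⟨hp, hd⟩),
        one_mul]
  · rw [Set.mulIndicator_of_notMem (show p ∉ {p : ℕ | p.Prime} from hp),
      Set.mulIndicator_of_notMem (fun h => hp (Nat.prime_of_mem_primeFactors h)),
      Set.mulIndicator_of_notMem (fun h => hp h.1), one_mul]

theorem fDagger_eq (a : ℤ) (q : ℕ) :
    fDagger a q = ∏ p ∈ q.primeFactors, (1 - artinWeight a p)⁻¹ := by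
  rw [fDagger, ← Finset.prod_filter_mul_prod_filter_not q.primeFactors (fun p => p ∣ powIndex a)]
  congr 1
  · exact Finset.prod_congr rfl fun p hp => by
      rw [artinWeight_of_dvd (Finset.mem_filter.1 hp).2]
  · exact Finset.prod_congr rfl fun p hp => by
      rw [artinWeight_of_not_dvd (Finset.mem_filter.1 hp).2]

/-- The two cases of the definition are γ/(1-γ) for the two values of the weight; h_a is odd, so p -
2 is nonzero whenever p ∣ h_a. -/
theorem fDDagger_eq {a : ℤ} (ha : a ≠ -1 ∧ ¬ IsSquare a) (q : ℕ) :
    fDDagger a q = ∏ p ∈ q.primeFactors, artinWeight a p / (1 - artinWeight a p) := by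
  rw [fDDagger, ← Finset.prod_filter_mul_prod_filter_not q.primeFactors (fun p => p ∣ powIndex a)]
  congr 1
  · refine Finset.prod_congr rfl fun p hp => ?_
    obtain ⟨hp, hd⟩ := Finset.mem_filter.1 hp
    have h2 := (Nat.prime_of_mem_primeFactors hp).two_le
    have h3 : (3 : ℝ) ≤ p := by
      have : p ≠ 2 := fun h => not_two_dvd_powIndex ha (h ▸ hd)
      exact_mod_cast (show 3 ≤ p by omega)
    have e1 : (p : ℝ) - 1 ≠ 0 := by linarith
    have e2 : (p : ℝ) - 2 ≠ 0 := by linarith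
    have e3 : (1 : ℝ) - 1 / (p - 1) ≠ 0 := by
      rw [one_sub_div e1]
      exact div_ne_zero (by linarith) e1
    rw [artinWeight_of_dvd hd, inv_eq_one_div, div_eq_div_iff e2 e3]
    field_simp
    ring
  · refine Finset.prod_congr rfl fun p hp => ?_
    obtain ⟨hp, hd⟩ := Finset.mem_filter.1 hp
    have h2 : (2 : ℝ) ≤ p := by exact_mod_cast (Nat.prime_of_mem_primeFactors hp).two_le
    have e0 : (p : ℝ) ≠ 0 := by linarith
    have e1 : (p : ℝ) - 1 ≠ 0 := by linarith
    have e2 : (p : ℝ) ^ 2 - p - 1 ≠ 0 := by nlinarith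
    have e3 : (1 : ℝ) - 1 / (p * (p - 1)) ≠ 0 := by
      rw [one_sub_div (mul_ne_zero e0 e1)]
      exact div_ne_zero (by nlinarith) (mul_ne_zero e0 e1)
    rw [artinWeight_of_not_dvd hd, inv_eq_one_div, div_eq_div_iff e2 e3]
    field_simp

/-! ### Moree's density as a product -/

/-- The local factor at `p ∣ q` of Moree's density modulo `q`. -/
def residueWeight (a x : ℤ) (p : ℕ) : ℝ :=
  (1 - if (p : ℤ) ∣ x - 1 then kummerWeight a p else 0) / (1 - artinWeight a p)

theorem artinAMod_eq_zero {a x : ℤ} {q : ℕ} (h : Int.gcd x q ≠ 1) : artinAMod a x q = 0 := by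
  rw [artinAMod, if_neg fun h' => h h'.2, mul_zero]

/-- The gcd condition with h_a becomes the vanishing of a local factor: if p divides x - 1, q and
h_a, then the Kummer weight is 1. -/
theorem artinAMod_eq {a x : ℤ} {q : ℕ} [NeZero q] (h : Int.gcd x q = 1) :
    artinAMod a x q = artinA a / q.totient * ∏ p ∈ q.primeFactors, residueWeight a x p := by
  simp only [artinAMod, residueWeight, h, and_true]
  rw [Finset.prod_div_distrib, fDagger_eq]
  split_ifs with hg
  · have hprod : ∏ p ∈ q.primeFactors with ((p : ℕ) : ℤ) ∣ x - 1, (1 - 1 / (p : ℝ)) =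
        ∏ p ∈ q.primeFactors, (1 - if (p : ℤ) ∣ x - 1 then kummerWeight a p else 0) := by
      rw [Finset.prod_filter]
      refine Finset.prod_congr rfl fun p hp => ?_
      split_ifs with hpx
      · have hpq := Nat.mem_primeFactors.1 hp
        rw [kummerWeight, if_neg, inv_eq_one_div]
        intro hh
        have : p ∣ Nat.gcd (Int.gcd (x - 1) q) (powIndex a) :=
          Nat.dvd_gcd (Int.natCast_dvd_natCast.1
            (Int.dvd_coe_gcd hpx (Int.natCast_dvd_natCast.2 hpq.2.1))) hh
        rw [hg] at this
        exact hpq.1.one_lt.ne' (Nat.dvd_one.1 this)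
      · rw [sub_zero]
    rw [hprod, Finset.prod_inv_distrib]
    ring
  · obtain ⟨p, hp, hpg⟩ := Nat.exists_prime_and_dvd hg
    have h1 := hpg.trans (Nat.gcd_dvd_left _ _)
    have hpx : (p : ℤ) ∣ x - 1 := (Int.natCast_dvd_natCast.2 h1).trans (Int.gcd_dvd_left _ _)
    have hpq : p ∣ q := Int.natCast_dvd_natCast.1
      ((Int.natCast_dvd_natCast.2 h1).trans (Int.gcd_dvd_right _ _))
    have h0 : ∏ p ∈ q.primeFactors, (1 - if (p : ℤ) ∣ x - 1 then kummerWeight a p else 0) = 0 := by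
      refine Finset.prod_eq_zero (i := p) (Nat.mem_primeFactors.2 ⟨hp, hpq, NeZero.ne q⟩) ?_
      rw [if_pos hpx, kummerWeight, if_pos (hpg.trans (Nat.gcd_dvd_right _ _)), sub_self]
    rw [h0]
    simp

/-- A modulus for which Moree's density is `𝒜_a(x mod q)` times `1` minus a character: either
`Δ_a ∣ d`, or the `2`-part of `Δ_a` divides neither `d` nor `2`. -/
def IsSaturated (a : ℤ) (d : ℕ) : Prop :=
  (disc a).natAbs ∣ d ∨ max (padicValNat 2 d) 1 < padicValNat 2 (disc a).natAbs

/-- The quadratic character of `ℚ(√a)` if it is defined modulo `d`, and `0` otherwise. -/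
def discChar (a : ℤ) (d : ℕ) (x : ℤ) : ℝ :=
  if (disc a).natAbs ∣ d then (kronecker (disc a) x : ℝ) else 0

theorem moebius_eq_zero_of_four_dvd {m : ℕ} (h : 4 ∣ m) : ArithmeticFunction.moebius m = 0 := by
  refine ArithmeticFunction.moebius_eq_zero_of_not_squarefree fun hs => ?_
  have := Nat.isUnit_iff.1 (hs 2 (by simpa using h))
  omega

theorem betaDisc_of_dvd {a : ℤ} {d : ℕ} (h : (disc a).natAbs ∣ d) : betaDisc a d = disc a := by
  have h0 : disc a ≠ 0 := disc_ne_zero a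
  have hg : (Int.gcd d (disc a) : ℤ) = |disc a| := by
    rw [Int.gcd, Int.natAbs_natCast, Nat.gcd_eq_right h, Int.natCast_natAbs]
  simp only [betaDisc, hg]
  rcases abs_choice (disc a) with h1 | h1
  · rw [h1, Int.ediv_self h0]
    norm_num
  · rw [h1, Int.ediv_neg, Int.ediv_self h0]
    norm_num

/-- If Δ_a ∣ d, then g = |Δ_a| and the correction involves only μ(2) = -1 and the symbol of Δ_a.
Otherwise |Δ_a|/g is even, so the argument of μ is divisible by 4. -/
theorem moreeDelta_of_isSaturated {a : ℤ} {d : ℕ} (hd : IsSaturated a d) (x : ℤ) :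
    moreeDelta a x d = artinAMod a x d * (1 - discChar a d x) := by
  rw [moreeDelta, discChar]
  congr 1
  split_ifs with h
  · rw [betaDisc_of_dvd h, Nat.gcd_eq_right h, Nat.mul_div_cancel _ (natAbs_disc_pos a),
      Nat.div_self (natAbs_disc_pos a), ArithmeticFunction.moebius_apply_prime Nat.prime_two]
    simp [fDDagger]
    ring
  · rw [moebius_eq_zero_of_four_dvd]
    · simp
    · have hlt := hd.resolve_left h
      have h0 : (disc a).natAbs ≠ 0 := (natAbs_disc_pos a).ne'
      have hg0 : d.gcd (disc a).natAbs ≠ 0 := (Nat.gcd_pos_of_pos_right _ (natAbs_disc_pos a)).ne'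
      have : Fact (Nat.Prime 2) := ⟨Nat.prime_two⟩
      obtain ⟨c, hc⟩ := Nat.gcd_dvd_right d (disc a).natAbs
      have hc0 : c ≠ 0 := by
        rintro rfl
        simp at hc
        exact h0 (by simpa using hc)
      have hval : padicValNat 2 (disc a).natAbs =
          padicValNat 2 (d.gcd (disc a).natAbs) + padicValNat 2 c := by
        conv_lhs => rw [hc]
        exact padicValNat.mul hg0 hc0
      have hle : padicValNat 2 (d.gcd (disc a).natAbs) ≤ padicValNat 2 d ∨ d = 0 := by
        rcases eq_or_ne d 0 with hd0 | hd0
        · exact Or.inr hd0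
        · exact Or.inl ((padicValNat_dvd_iff_le hd0).1
            (pow_padicValNat_dvd.trans (Nat.gcd_dvd_left _ _)))
      have hle := hle.resolve_right fun hd0 => h (hd0 ▸ dvd_zero _)
      have h2c : 2 ∣ c := by
        rw [dvd_iff_padicValNat_ne_zero hc0]
        omega
      rw [Nat.mul_div_assoc _ (Nat.gcd_dvd_right _ _)]
      rw [Nat.div_eq_of_eq_mul_right (Nat.pos_of_ne_zero hg0) hc]
      obtain ⟨e, rfl⟩ := h2c
      exact ⟨e, by ring⟩

/-! ### The degrees and the conditions on residues as products -/

theorem totient_squarefree {k : ℕ} (hk : Squarefree k) :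
    (k.totient : ℝ) = ∏ p ∈ k.primeFactors, ((p : ℝ) - 1) := by
  have h := Nat.totient_mul_prod_primeFactors k
  rw [Nat.prod_primeFactors_of_squarefree hk, mul_comm] at h
  rw [Nat.eq_of_mul_eq_mul_left (Nat.pos_of_ne_zero hk.ne_zero) h, Nat.cast_prod]
  exact Finset.prod_congr rfl fun p hp =>
    by rw [Nat.cast_sub (Nat.prime_of_mem_primeFactors hp).one_le, Nat.cast_one]

theorem totient_lcm_squarefree {d k : ℕ} (hk : Squarefree k) :
    ((d.lcm k).totient : ℝ) =
      d.totient * ∏ p ∈ k.primeFactors, if p ∣ d then 1 else ((p : ℝ) - 1) := by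
  obtain ⟨m, hm⟩ := Nat.gcd_dvd_right d k
  have hk0 := hk.ne_zero
  have hg0 : 0 < d.gcd k := Nat.gcd_pos_of_pos_right _ (Nat.pos_of_ne_zero hk0)
  have hgs : Squarefree (d.gcd k) := hk.squarefree_of_dvd (Nat.gcd_dvd_right d k)
  have hms : Squarefree m := hk.squarefree_of_dvd ⟨d.gcd k, by rw [mul_comm]; exact hm⟩
  have hcop : d.Coprime m := by
    refine Nat.Coprime.symm (Nat.coprime_of_dvd fun p hp hpm hpd => ?_)
    have h1 : p ∣ d.gcd k := Nat.dvd_gcd hpd (hpm.trans ⟨d.gcd k, by rw [mul_comm]; exact hm⟩)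
    have h2 : p * p ∣ k := by
      rw [hm]
      exact mul_dvd_mul h1 hpm
    exact hp.one_lt.ne' (Nat.isUnit_iff.1 (hk p h2))
  have hlcm : d.lcm k = d * m := by
    rw [Nat.lcm, Nat.div_eq_of_eq_mul_right hg0]
    conv_lhs => rw [hm]
    ring
  have hpf : k.primeFactors = (d.gcd k).primeFactors ∪ m.primeFactors := by
    conv_lhs => rw [hm]
    exact Nat.primeFactors_mul hg0.ne' hms.ne_zero
  rw [hlcm, Nat.totient_mul hcop, Nat.cast_mul, totient_squarefree hms, hpf,
    Finset.prod_union (hcop.coprime_dvd_left (Nat.gcd_dvd_left d k)).disjoint_primeFactors]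
  have h1 : ∏ p ∈ (d.gcd k).primeFactors, (if p ∣ d then 1 else ((p : ℝ) - 1)) = 1 :=
    Finset.prod_eq_one fun p hp =>
      if_pos ((Nat.dvd_of_mem_primeFactors hp).trans (Nat.gcd_dvd_left d k))
  rw [h1, one_mul]
  congr 1
  refine Finset.prod_congr rfl fun p hp => (if_neg fun hpd => ?_).symm
  have := Nat.dvd_gcd hpd (Nat.dvd_of_mem_primeFactors hp)
  rw [hcop] at this
  exact (Nat.prime_of_mem_primeFactors hp).one_lt.ne' (Nat.dvd_one.1 this)

theorem unitsMap_gcd_eq_one_iff {d k : ℕ} [NeZero d] (hk : Squarefree k) (b : (ZMod d)ˣ) :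
    ZMod.unitsMap (Nat.gcd_dvd_left d k) b = 1 ↔
      ∀ p ∈ k.primeFactors, p ∣ d → (p : ℤ) ∣ ((b : ZMod d).val : ℤ) - 1 := by
  have hgs : Squarefree (d.gcd k) := hk.squarefree_of_dvd (Nat.gcd_dvd_right d k)
  rw [← Units.val_inj, coe_unitsMap, Units.val_one, ← sub_eq_zero]
  have hcast : (((b : ZMod d).val : ZMod (d.gcd k)) - 1) =
      ((((b : ZMod d).val : ℤ) - 1 : ℤ) : ZMod (d.gcd k)) := by push_cast; rfl
  rw [hcast, ZMod.intCast_zmod_eq_zero_iff_dvd]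
  constructor
  · intro h p hp hpd
    exact (Int.natCast_dvd_natCast.2
      (Nat.dvd_gcd hpd (Nat.dvd_of_mem_primeFactors hp))).trans h
  · intro h
    rw [Int.natCast_dvd, ← Nat.prod_primeFactors_of_squarefree hgs]
    refine Finset.prod_primes_dvd _ (fun p hp => (Nat.prime_of_mem_primeFactors hp).prime)
      fun p hp => ?_
    have hpg := Nat.dvd_of_mem_primeFactors hp
    rw [← Int.natCast_dvd]
    exact h p (Nat.mem_primeFactors.2 ⟨Nat.prime_of_mem_primeFactors hp,
      hpg.trans (Nat.gcd_dvd_right d k), hk.ne_zero⟩) (hpg.trans (Nat.gcd_dvd_left d k))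

/-- The weight of the prime `p` in the Euler product for the density of the class `x mod d`. -/
def classWeight (a : ℤ) (d : ℕ) (x : ℤ) (p : ℕ) : ℝ :=
  kummerWeight a p * if p ∣ d then (if (p : ℤ) ∣ x - 1 then 1 else 0) else ((p : ℝ) - 1)⁻¹

theorem sub_one_pos_of_prime {p : ℕ} (hp : p.Prime) : (0 : ℝ) < (p : ℝ) - 1 := by
  have : (2 : ℝ) ≤ p := by exact_mod_cast hp.two_le
  linarith

theorem classWeight_nonneg (a : ℤ) (d : ℕ) (x : ℤ) {p : ℕ} (hp : p.Prime) :
    0 ≤ classWeight a d x p := by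
  have := sub_one_pos_of_prime hp
  refine mul_nonneg (kummerWeight_nonneg a p) ?_
  split_ifs <;> positivity

theorem prod_classWeight (a : ℤ) (d : ℕ) (x : ℤ) (k : ℕ) :
    ∏ p ∈ k.primeFactors, classWeight a d x p =
      (∏ p ∈ k.primeFactors, kummerWeight a p) *
        ((if ∀ p ∈ k.primeFactors, p ∣ d → (p : ℤ) ∣ x - 1 then 1 else 0) *
          (∏ p ∈ k.primeFactors, if p ∣ d then 1 else ((p : ℝ) - 1))⁻¹) := by
  simp only [classWeight]
  rw [Finset.prod_mul_distrib]
  congr 1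
  split_ifs with h
  · rw [one_mul, ← Finset.prod_inv_distrib]
    refine Finset.prod_congr rfl fun p hp => ?_
    split_ifs with h1 h2
    · simp
    · exact absurd (h p hp h1) h2
    · rfl
  · push Not at h
    obtain ⟨p, hp, hpd, hpx⟩ := h
    rw [zero_mul]
    exact Finset.prod_eq_zero hp (by rw [if_pos hpd, if_neg hpx])

theorem inv_finrank_compField {a : ℤ} (ha : a ≠ -1 ∧ ¬ IsSquare a) {d k : ℕ} [NeZero d]
    (hk : Squarefree k) (P : Prop) [Decidable P]
    (hP : P ↔ ∃ x ∈ cycloField (d.lcm k), x ^ 2 = (a : ℂ)) :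
    (Module.finrank ℚ (compField a d k) : ℝ)⁻¹ = (d.totient : ℝ)⁻¹ *
      ((∏ p ∈ k.primeFactors, kummerWeight a p) *
        (∏ p ∈ k.primeFactors, if p ∣ d then 1 else ((p : ℝ) - 1))⁻¹) *
      if 2 ∣ k ∧ P then 2 else 1 := by
  have : NeZero k := ⟨hk.ne_zero⟩
  have : NeZero (d.lcm k) := ⟨Nat.lcm_ne_zero (NeZero.ne d) (NeZero.ne k)⟩
  rw [finrank_compField ha hk, Nat.cast_mul, mul_inv, totient_lcm_squarefree hk,
    inv_kummerDegree ha hk P hP, mul_inv]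
  ring

/-- Periodicity is read off from the Galois side: x and y describe the same automorphism on the
|Δ_a|-th roots of unity, hence the same action on √a. -/
theorem kronecker_eq_of_modEq {a : ℤ} (ha : a ≠ -1 ∧ ¬ IsSquare a) {x y : ℕ} (hx0 : x ≠ 0)
    (hy0 : y ≠ 0) (hx : x.Coprime (disc a).natAbs) (hxy : x ≡ y [MOD (disc a).natAbs]) :
    kronecker (disc a) x = kronecker (disc a) y := by
  obtain ⟨s, hs, hτ⟩ := exists_sqrt_kronecker ha
  obtain ⟨τ, h⟩ := cyc_surjective (disc a).natAbs (ZMod.unitOfCoprime x hx)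
  have h1 : ActsBy τ (disc a).natAbs x := by
    rw [actsBy_iff_cyc_eq, h, ZMod.coe_unitOfCoprime]
  have h2 : ActsBy τ (disc a).natAbs y := by
    rw [actsBy_iff_cyc_eq, h, ZMod.coe_unitOfCoprime]
    exact (ZMod.natCast_eq_natCast_iff _ _ _).2 hxy
  have hs0 : s ≠ 0 := by
    rintro rfl
    refine ne_zero_of_not_isSquare ha ?_
    have : (a : ℂ) = 0 := by rw [← hs]; ring
    exact_mod_cast this
  have hy : y.Coprime (disc a).natAbs := by
    rw [Nat.Coprime, ← hxy.gcd_eq]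
    exact hx
  have h3 := (hτ τ x hx0 hx h1).symm.trans (hτ τ y hy0 hy h2)
  exact_mod_cast mul_right_cancel₀ hs0 h3

theorem kronecker_eq_one_or {a : ℤ} (ha : a ≠ -1 ∧ ¬ IsSquare a) {x : ℕ} (hx0 : x ≠ 0)
    (hx : x.Coprime (disc a).natAbs) : kronecker (disc a) x = 1 ∨ kronecker (disc a) x = -1 := by
  obtain ⟨s, hs, hτ⟩ := exists_sqrt_kronecker ha
  obtain ⟨τ, h⟩ := cyc_surjective (disc a).natAbs (ZMod.unitOfCoprime x hx)
  have h1 : ActsBy τ (disc a).natAbs x := by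
    rw [actsBy_iff_cyc_eq, h, ZMod.coe_unitOfCoprime]
  have ha0 : (a : ℂ) ≠ 0 := by exact_mod_cast ne_zero_of_not_isSquare ha
  have h2 : (τ s) ^ 2 = a := by rw [← map_pow, hs, map_intCast]
  rw [hτ τ x hx0 hx h1, mul_pow, hs] at h2
  have h3 : ((kronecker (disc a) x : ℂ)) ^ 2 = 1 :=
    mul_right_cancel₀ ha0 (h2.trans (one_mul _).symm)
  have h4 : (kronecker (disc a) x) ^ 2 = 1 := by exact_mod_cast h3
  rcases mul_eq_zero.1 (show (kronecker (disc a) x - 1) * (kronecker (disc a) x + 1) = 0 by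
    linear_combination h4) with h | h
  · exact Or.inl (by omega)
  · exact Or.inr (by omega)

theorem val_ne_zero_of_disc_dvd {a : ℤ} (ha : a ≠ -1 ∧ ¬ IsSquare a) {d x : ℕ}
    (h : (disc a).natAbs ∣ d) (hx : x.Coprime d) : x ≠ 0 := by
  rintro rfl
  have hd : d = 1 := by simpa using hx
  have := Nat.le_of_dvd one_pos (hd ▸ h)
  linarith [three_le_natAbs_disc ha]

/-- If √a is cyclotomic of level d and k is even, the degree loses a factor 2 and membership
requires χ(b) = 1; together these give 2·1_{χ=1} = 1 + χ. In the other saturated case the 2-part of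
Δ_a exceeds that of lcm(d, k) for every squarefree k, so √a is never involved. -/
theorem cInd_div_finrank {a : ℤ} (ha : a ≠ -1 ∧ ¬ IsSquare a) {d k : ℕ} [NeZero d]
    (hd : IsSaturated a d) (hk : Squarefree k) (b : (ZMod d)ˣ) [Decidable (b ∈ kummerSubgroup a d k)] :
    (if b ∈ kummerSubgroup a d k then (Module.finrank ℚ (compField a d k) : ℝ)⁻¹ else 0) =
      (d.totient : ℝ)⁻¹ * (∏ p ∈ k.primeFactors, classWeight a d (b : ZMod d).val p) *
        if 2 ∣ k then 1 + discChar a d (b : ZMod d).val else 1 := by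
  classical
  have : NeZero k := ⟨hk.ne_zero⟩
  have : NeZero (d.lcm k) := ⟨Nat.lcm_ne_zero (NeZero.ne d) (NeZero.ne k)⟩
  rw [prod_classWeight, discChar]
  have hu := unitsMap_gcd_eq_one_iff hk b
  by_cases hdvd : (disc a).natAbs ∣ d
  · have hP : True ↔ ∃ x ∈ cycloField (d.lcm k), x ^ 2 = (a : ℂ) := by
      obtain ⟨s, hs, -⟩ := exists_sqrt_kronecker ha
      exact ⟨fun _ => ⟨s, cycloField_mono (hdvd.trans (Nat.dvd_lcm_left d k))
        (mem_cycloField_disc ha hs), hs⟩, fun _ => trivial⟩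
    rw [inv_finrank_compField ha hk True hP]
    have hiff := mem_kummerSubgroup_of_disc_dvd ha hk hdvd (b := b)
    have hx0 : discChar a d (b : ZMod d).val = 1 ∨ discChar a d (b : ZMod d).val = -1 := by
      have hco := ZMod.val_coe_unit_coprime b
      rw [discChar, if_pos hdvd]
      exact_mod_cast kronecker_eq_one_or ha (val_ne_zero_of_disc_dvd ha hdvd hco)
        (hco.coprime_dvd_right hdvd)
    rw [discChar, if_pos hdvd] at hx0
    rw [if_pos hdvd]
    simp only [hiff, hu]
    by_cases h1 : ∀ p ∈ k.primeFactors, p ∣ d → (p : ℤ) ∣ ((b : ZMod d).val : ℤ) - 1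
    · by_cases h2 : 2 ∣ k
      · rcases hx0 with hx | hx
        · have hx' : kronecker (disc a) ((b : ZMod d).val : ℤ) = 1 := by exact_mod_cast hx
          rw [if_pos ⟨h1, fun _ => hx'⟩, if_pos ⟨h2, trivial⟩, if_pos h1, if_pos h2, hx]
          ring
        · have hx' : kronecker (disc a) ((b : ZMod d).val : ℤ) = -1 := by exact_mod_cast hx
          rw [if_neg fun h => by have := h.2 h2; omega, if_pos h2, hx]
          ring
      · rw [if_pos ⟨h1, fun h => absurd h h2⟩, if_neg fun h => h2 h.1, if_pos h1, if_neg h2]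
        ring
    · rw [if_neg fun h => h1 h.1, if_neg h1]
      ring
  · have hlt := hd.resolve_left hdvd
    have hnot : ¬ ∃ x ∈ cycloField (d.lcm k), x ^ 2 = (a : ℂ) := by
      refine not_mem_cycloField_of_val_lt ha (lt_of_le_of_lt ?_ hlt)
      rw [← Nat.factorization_def _ Nat.prime_two, ← Nat.factorization_def _ Nat.prime_two,
        Nat.factorization_lcm (NeZero.ne d) hk.ne_zero, Finsupp.sup_apply]
      exact max_le_max le_rfl (hk.natFactorization_le_one 2)
    rw [inv_finrank_compField ha hk False (by simpa using hnot), if_neg hdvd]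
    have hiff := mem_kummerSubgroup_of_sqrt_not_mem ha hk hnot (b := b)
    simp only [hiff, hu, and_false, if_false, add_zero, ite_self, mul_one]
    split_ifs
    · ring
    · ring

/-! ### The sum over k as an Euler product, and the Fourier expansion of Moree's density. -/

theorem summable_norm_prod_classWeight {a : ℤ} (ha : a ≠ -1 ∧ ¬ IsSquare a) {d : ℕ} [NeZero d]
    (x : ℤ) : Summable fun k : ℕ =>
      ‖(ArithmeticFunction.moebius k : ℝ) * ∏ p ∈ k.primeFactors, classWeight a d x p‖ := by
  rw [← summable_pnat_iff_summable_nat]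
  refine Summable.of_nonneg_of_le (fun _ => norm_nonneg _) (fun k => ?_)
    (summable_pnat_rpow.mul_left (d.totient * (4 * powIndex a : ℝ)))
  by_cases hk : Squarefree (k : ℕ)
  · have hnn : ∀ p ∈ (k : ℕ).primeFactors, 0 ≤ classWeight a d x p := fun p hp =>
      classWeight_nonneg a d x (Nat.prime_of_mem_primeFactors hp)
    have hμ := norm_moebius_le_one (k : ℕ)
    classical
    have hfin := inv_finrank_compField ha (d := d) hk _ Iff.rfl
    set K := ∏ p ∈ (k : ℕ).primeFactors, kummerWeight a p
    set R := (∏ p ∈ (k : ℕ).primeFactors, if p ∣ d then 1 else ((p : ℝ) - 1))⁻¹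
    have hK : 0 ≤ K := Finset.prod_nonneg fun p _ => kummerWeight_nonneg a p
    have hR : 0 ≤ R := inv_nonneg.2 (Finset.prod_nonneg fun p hp => by
      have := sub_one_pos_of_prime (Nat.prime_of_mem_primeFactors hp)
      split_ifs <;> linarith)
    have hφ : (0 : ℝ) < d.totient := by exact_mod_cast Nat.totient_pos.2 (NeZero.pos d)
    have h1 : ∏ p ∈ (k : ℕ).primeFactors, classWeight a d x p ≤ K * R := by
      rw [prod_classWeight]
      refine mul_le_mul_of_nonneg_left (mul_le_of_le_one_left hR ?_) hK
      split_ifs <;> norm_num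
    have h2 : K * R ≤ d.totient * (Module.finrank ℚ (compField a d k) : ℝ)⁻¹ := by
      rw [hfin, ← mul_assoc, ← mul_assoc, mul_inv_cancel₀ hφ.ne', one_mul]
      refine le_mul_of_one_le_right (mul_nonneg hK hR) ?_
      split_ifs <;> norm_num
    have h3 : (Module.finrank ℚ (compField a d k) : ℝ)⁻¹ ≤
        (Module.finrank ℚ (kummerField a k) : ℝ)⁻¹ := by
      have hG : (0 : ℝ) < Module.finrank ℚ (kummerField a k) := by
        exact_mod_cast finrank_kummerField_pos a k
      refine inv_anti₀ hG ?_
      rw [← card_kummerSubgroup_mul_finrank]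
      exact_mod_cast Nat.le_mul_of_pos_left _ Nat.card_pos
    rw [norm_mul, Real.norm_of_nonneg (Finset.prod_nonneg hnn)]
    refine (mul_le_of_le_one_left (Finset.prod_nonneg hnn) ?_).trans
      (h1.trans (h2.trans ?_))
    · simpa using hμ
    · rw [mul_assoc]
      exact mul_le_mul_of_nonneg_left (h3.trans (inv_finrank_kummerField_le_rpow ha hk)) hφ.le
  · rw [ArithmeticFunction.moebius_eq_zero_of_not_squarefree hk]
    simp only [Int.cast_zero, zero_mul, norm_zero]
    positivity

/-- The factors agree with those of 𝒜_a away from d; at p ∣ d their quotient is the residue weight.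
-/
theorem hasProd_classWeight {a : ℤ} (ha : a ≠ -1 ∧ ¬ IsSquare a) {d : ℕ} [NeZero d] (x : ℤ) :
    HasProd (Set.mulIndicator {p : ℕ | p.Prime} fun p => 1 - classWeight a d x p)
      (artinA a * ∏ p ∈ d.primeFactors, residueWeight a x p) := by
  have h1 := hasProd_prod_of_ne_finset_one
    (f := fun p : ℕ => if p ∈ d.primeFactors then residueWeight a x p else 1)
    (s := d.primeFactors) (L := SummationFilter.unconditional ℕ) fun p hp => if_neg hp
  have h2 : ∏ p ∈ d.primeFactors, (if p ∈ d.primeFactors then residueWeight a x p else 1) =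
      ∏ p ∈ d.primeFactors, residueWeight a x p :=
    Finset.prod_congr rfl fun p hp => if_pos hp
  rw [h2] at h1
  convert (hasProd_artinA ha).mul h1 using 1
  funext p
  by_cases hp : p.Prime
  · rw [Set.mulIndicator_of_mem (show p ∈ {p : ℕ | p.Prime} from hp),
      Set.mulIndicator_of_mem (show p ∈ {p : ℕ | p.Prime} from hp), classWeight]
    by_cases hd : p ∣ d
    · rw [if_pos hd, if_pos (Nat.mem_primeFactors.2 ⟨hp, hd, NeZero.ne d⟩), residueWeight,
        mul_div_cancel₀ _ (one_sub_artinWeight_pos ha hp).ne', mul_ite, mul_one, mul_zero]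
    · rw [if_neg hd, if_neg fun h => hd (Nat.dvd_of_mem_primeFactors h), mul_one, artinWeight,
        div_eq_mul_inv]
  · rw [Set.mulIndicator_of_notMem (show p ∉ {p : ℕ | p.Prime} from hp),
      Set.mulIndicator_of_notMem (show p ∉ {p : ℕ | p.Prime} from hp), if_neg, one_mul]
    exact fun h => hp (Nat.prime_of_mem_primeFactors h)

/-- The weight at 2 is always 1/2: if d is even, b is odd, hence 1 modulo 2. So `tsum_moebius_even`
applies and turns the factor 1 + ψ at even k into 1 - ψ, which is Moree's correction factor. -/
theorem hasSum_moebius_classWeight {a : ℤ} (ha : a ≠ -1 ∧ ¬ IsSquare a) {d : ℕ} [NeZero d]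
    (hd : IsSaturated a d) (b : (ZMod d)ˣ) :
    HasSum (fun k : ℕ+ => (ArithmeticFunction.moebius (k : ℕ) : ℝ) *
      (∏ p ∈ (k : ℕ).primeFactors, classWeight a d (b : ZMod d).val p) *
        (if 2 ∣ (k : ℕ) then 1 + discChar a d (b : ZMod d).val else 1))
      (d.totient * moreeDelta a (b : ZMod d).val d) := by
  have hco := ZMod.val_coe_unit_coprime b
  have hφ : (d.totient : ℝ) ≠ 0 := by exact_mod_cast (Nat.totient_pos.2 (NeZero.pos d)).ne'
  have hs := summable_norm_prod_classWeight ha (d := d) ((b : ZMod d).val : ℤ)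
  have hw2 : classWeight a d (b : ZMod d).val 2 = 1 / 2 := by
    rw [classWeight, kummerWeight_two ha]
    split_ifs with h1 h2
    · ring
    · refine absurd ?_ h2
      have : ¬ 2 ∣ (b : ZMod d).val := fun h => by
        have := Nat.dvd_gcd h h1
        rw [hco] at this
        omega
      push_cast
      omega
    · norm_num
  set ψ := discChar a d (b : ZMod d).val
  set f : ℕ → ℝ := fun k => (ArithmeticFunction.moebius k : ℝ) *
      (∏ p ∈ k.primeFactors, classWeight a d (b : ZMod d).val p) * (if 2 ∣ k then 1 + ψ else 1)
    with hf
  have hsum : Summable f := by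
    refine Summable.of_norm_bounded (hs.mul_left (1 + |1 + ψ|)) fun k => ?_
    rw [hf, norm_mul, mul_comm]
    refine mul_le_mul_of_nonneg_right ?_ (norm_nonneg _)
    split_ifs
    · rw [Real.norm_eq_abs]
      linarith
    · rw [norm_one]
      linarith [abs_nonneg (1 + ψ)]
  have hval : ∑' k : ℕ+, f k = d.totient * moreeDelta a (b : ZMod d).val d := by
    have h0 : f 0 = 0 := by simp [hf]
    rw [← zero_add (∑' k : ℕ+, f k), ← h0, tsum_zero_pnat_eq_tsum_nat hsum,
      tsum_moebius_even hs hw2, (hasProd_one_sub_of_summable hs).unique (hasProd_classWeight ha _),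
      moreeDelta_of_isSaturated hd, artinAMod_eq (by rw [Int.gcd_natCast_natCast]; exact hco)]
    change (1 - ψ) * _ = _ * (_ * (1 - ψ))
    field_simp
  rw [← hval]
  exact ((summable_pnat_iff_summable_nat (f := f)).2 hsum).hasSum

/-- The bridge from the singular series to Moree's densities: for each residue b the sum over k of
μ(k)c_{a,d,k}(b)/[F:ℚ] is the density of the class b. -/
theorem densityFourier_eq {a : ℤ} (ha : a ≠ -1 ∧ ¬ IsSquare a) {d : ℕ} [NeZero d]
    (hd : IsSaturated a d) (w : ZMod d) :
    densityFourier a d w = ∑ b : (ZMod d)ˣ,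
      (moreeDelta a (b : ZMod d).val d : ℂ) * ZMod.stdAddChar (w * (b : ZMod d)) := by
  classical
  have hφ : (d.totient : ℂ) ≠ 0 := by exact_mod_cast (Nat.totient_pos.2 (NeZero.pos d)).ne'
  have h1 := hasSum_sum (s := Finset.univ) fun (b : (ZMod d)ˣ) _ =>
    ((Complex.hasSum_ofReal.2 (hasSum_moebius_classWeight ha hd b)).mul_left
      ((d.totient : ℂ)⁻¹)).mul_right (ZMod.stdAddChar (w * (b : ZMod d)) : ℂ)
  have h2 := h1.tsum_eq
  rw [densityFourier]
  convert h2 using 1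
  · refine tsum_congr fun k => ?_
    by_cases hk : Squarefree (k : ℕ)
    · rw [normSum, expSum_eq, Finset.sum_filter, Finset.sum_div, Finset.mul_sum]
      refine Finset.sum_congr rfl fun b _ => ?_
      have h3 := congrArg (Complex.ofReal) (cInd_div_finrank ha hd hk b)
      push_cast at h3 ⊢
      rw [apply_ite Complex.ofReal] at h3
      push_cast at h3
      rw [div_eq_mul_inv]
      calc _ = (ArithmeticFunction.moebius (k : ℕ) : ℂ) *
            (if b ∈ kummerSubgroup a d k then (Module.finrank ℚ (compField a d k) : ℂ)⁻¹ else 0) *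
              ZMod.stdAddChar (w * (b : ZMod d)) := by split_ifs <;> ring
        _ = _ := by rw [h3]; ring
    · simp [ArithmeticFunction.moebius_eq_zero_of_not_squarefree hk]
  · refine Finset.sum_congr rfl fun b _ => ?_
    push_cast
    field_simp

/-! ### Lower bounds for infinite products -/

theorem exp_neg_tsum_le_of_hasProd {ι : Type*} {F w : ι → ℝ} {A : ℝ} (h : HasProd F A)
    (hw : Summable w) (hw0 : ∀ i, 0 ≤ w i) (hF : ∀ i, Real.exp (-w i) ≤ F i) :
    Real.exp (-∑' i, w i) ≤ A := by
  refine ge_of_tendsto' h fun s => ?_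
  calc Real.exp (-∑' i, w i) ≤ Real.exp (-∑ i ∈ s, w i) := by
        rw [Real.exp_le_exp, neg_le_neg_iff]
        exact hw.sum_le_tsum s fun i _ => hw0 i
    _ = ∏ i ∈ s, Real.exp (-w i) := by rw [← Finset.sum_neg_distrib, Real.exp_sum]
    _ ≤ ∏ i ∈ s, F i := Finset.prod_le_prod (fun i _ => (Real.exp_pos _).le) fun i _ => hF i

theorem exp_neg_two_mul_le {t : ℝ} (h0 : 0 ≤ t) (h1 : t ≤ 1 / 2) : Real.exp (-(2 * t)) ≤ 1 - t := by
  have h2 := Real.add_one_le_exp (2 * t)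
  rw [Real.exp_neg, inv_eq_one_div, div_le_iff₀ (Real.exp_pos _)]
  nlinarith

/-! ### Positivity of Artin's constants -/

theorem summable_const_div_nat_sq (c : ℝ) : Summable fun p : ℕ => c / (p : ℝ) ^ 2 := by
  refine ((Real.summable_one_div_nat_pow.2 one_lt_two).mul_left c).congr fun p => ?_
  rw [mul_one_div]

/-- The absolute constant in the lower bound for `𝒜_a`. -/
def artinBound : ℝ := Real.exp (-∑' p : ℕ, 8 / (p : ℝ) ^ 2)

theorem artinBound_pos : 0 < artinBound := Real.exp_pos _

theorem totient_div_eq_prod {q : ℕ} (hq : q ≠ 0) :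
    (q.totient : ℝ) / q = ∏ p ∈ q.primeFactors, (1 - (p : ℝ)⁻¹) := by
  have h := Nat.totient_eq_mul_prod_factors q
  have hq' : (q : ℝ) ≠ 0 := by exact_mod_cast hq
  have h' : (q.totient : ℝ) = q * ∏ p ∈ q.primeFactors, (1 - (p : ℝ)⁻¹) := by
    have := congrArg (fun r : ℚ => (r : ℝ)) h
    simpa using this
  rw [h', mul_div_cancel_left₀ _ hq']

/-- Dividing by φ(h)/h turns the factor at p ∣ h into 1 - 1/(p-1)², so every factor is 1 - O(p⁻²)
uniformly in a. The constant 8 covers both 4/p² and 2/p² in the inequality 1 - t ≥ exp(-2t). -/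
theorem artinBound_le {a : ℤ} (ha : a ≠ -1 ∧ ¬ IsSquare a) :
    artinBound * ((powIndex a).totient / powIndex a) ≤ artinA a := by
  have hh := (powIndex_pos ha).ne'
  have h1 := hasProd_prod_of_ne_finset_one
    (f := fun p : ℕ => if p ∈ (powIndex a).primeFactors then (1 - (p : ℝ)⁻¹)⁻¹ else 1)
    (s := (powIndex a).primeFactors) (L := SummationFilter.unconditional ℕ)
    fun p hp => if_neg hp
  have h2 : (∏ p ∈ (powIndex a).primeFactors,
      if p ∈ (powIndex a).primeFactors then (1 - (p : ℝ)⁻¹)⁻¹ else 1) =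
      ((powIndex a).totient / powIndex a : ℝ)⁻¹ := by
    rw [totient_div_eq_prod hh, ← Finset.prod_inv_distrib]
    exact Finset.prod_congr rfl fun p hp => if_pos hp
  rw [h2] at h1
  have h3 : (0 : ℝ) < (powIndex a).totient / powIndex a := by
    have := powIndex_pos ha
    have := Nat.totient_pos.2 this
    positivity
  rw [← le_div_iff₀ h3, div_eq_mul_inv]
  refine exp_neg_tsum_le_of_hasProd ((hasProd_artinA ha).mul h1) (summable_const_div_nat_sq 8)
    (fun p => by positivity) fun p => ?_
  by_cases hp : p.Prime
  · rw [Set.mulIndicator_of_mem (show p ∈ {p : ℕ | p.Prime} from hp)]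
    have hp2 : (2 : ℝ) ≤ p := by exact_mod_cast hp.two_le
    by_cases hd : p ∣ powIndex a
    · have h3 : (3 : ℝ) ≤ p := by
        have h1 : p ≠ 2 := fun h => not_two_dvd_powIndex ha (h ▸ hd)
        have := hp.two_le
        exact_mod_cast (show 3 ≤ p by omega)
      rw [if_pos (Nat.mem_primeFactors.2 ⟨hp, hd, hh⟩), artinWeight_of_dvd hd]
      have e : (1 - 1 / ((p : ℝ) - 1)) * (1 - (p : ℝ)⁻¹)⁻¹ = 1 - 1 / ((p : ℝ) - 1) ^ 2 := by
        have e0 : (p : ℝ) ≠ 0 := by linarith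
        have e1 : (p : ℝ) - 1 ≠ 0 := by linarith
        rw [show 1 - (p : ℝ)⁻¹ = (p - 1) / p by field_simp, inv_div]
        field_simp
        ring
      rw [e]
      have hle : 1 / ((p : ℝ) - 1) ^ 2 ≤ 4 / (p : ℝ) ^ 2 := by
        rw [div_le_div_iff₀ (by nlinarith) (by nlinarith)]
        nlinarith
      have hhalf : 1 / ((p : ℝ) - 1) ^ 2 ≤ 1 / 2 := by
        rw [div_le_div_iff₀ (by nlinarith) (by norm_num)]
        nlinarith
      refine le_trans ?_ (exp_neg_two_mul_le (by positivity) hhalf)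
      rw [Real.exp_le_exp, neg_le_neg_iff]
      have : 8 / (p : ℝ) ^ 2 = 2 * (4 / (p : ℝ) ^ 2) := by ring
      linarith
    · rw [if_neg fun h => hd (Nat.dvd_of_mem_primeFactors h), mul_one, artinWeight_of_not_dvd hd]
      have hle := inv_mul_sub_one_le p hp.two_le
      have hhalf : 1 / ((p : ℝ) * ((p : ℝ) - 1)) ≤ 1 / 2 := by
        rw [div_le_div_iff₀ (by nlinarith) (by norm_num)]
        nlinarith
      refine le_trans ?_ (exp_neg_two_mul_le (one_div_nonneg.2 (by nlinarith)) hhalf)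
      rw [Real.exp_le_exp, neg_le_neg_iff]
      have : 8 / (p : ℝ) ^ 2 = 8 * (1 / (p : ℝ) ^ 2) := by ring
      have : 0 ≤ 1 / (p : ℝ) ^ 2 := by positivity
      linarith
  · rw [Set.mulIndicator_of_notMem (show p ∉ {p : ℕ | p.Prime} from hp), if_neg, one_mul,
      Real.exp_le_one_iff, neg_nonpos]
    · positivity
    · exact fun h => hp (Nat.prime_of_mem_primeFactors h)

theorem artinA_pos {a : ℤ} (ha : a ≠ -1 ∧ ¬ IsSquare a) : 0 < artinA a := by
  refine lt_of_lt_of_le (mul_pos artinBound_pos ?_) (artinBound_le ha)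
  have := powIndex_pos ha
  have := Nat.totient_pos.2 this
  positivity

theorem artinWeight_div_nonneg {a : ℤ} (ha : a ≠ -1 ∧ ¬ IsSquare a) {p : ℕ} (hp : p.Prime) :
    0 ≤ artinWeight a p / (1 - artinWeight a p) :=
  div_nonneg (artinWeight_nonneg a hp) (one_sub_artinWeight_pos ha hp).le

theorem artinWeight_div_le_one {a : ℤ} (ha : a ≠ -1 ∧ ¬ IsSquare a) {p : ℕ} (hp : p.Prime) :
    artinWeight a p / (1 - artinWeight a p) ≤ 1 := by
  rw [div_le_one (one_sub_artinWeight_pos ha hp)]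
  linarith [artinWeight_le_half ha hp]

theorem artinWeight_lt_half {a : ℤ} {p : ℕ} (hp : 4 ≤ p) :
    artinWeight a p < 1 / 2 := by
  have h4 : (4 : ℝ) ≤ p := by exact_mod_cast hp
  rw [artinWeight, div_lt_iff₀ (by linarith)]
  linarith [kummerWeight_le_one a p]

theorem fDDagger_nonneg {a : ℤ} (ha : a ≠ -1 ∧ ¬ IsSquare a) (q : ℕ) : 0 ≤ fDDagger a q := by
  rw [fDDagger_eq ha]
  exact Finset.prod_nonneg fun p hp => artinWeight_div_nonneg ha (Nat.prime_of_mem_primeFactors hp)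

theorem fDDagger_lt_one {a : ℤ} (ha : a ≠ -1 ∧ ¬ IsSquare a) {q p : ℕ} (hq : q ≠ 0)
    (hp : p.Prime) (hp4 : 4 ≤ p) (hpq : p ∣ q) : fDDagger a q < 1 := by
  rw [fDDagger_eq ha, ← Finset.mul_prod_erase _ _ (Nat.mem_primeFactors.2 ⟨hp, hpq, hq⟩)]
  refine mul_lt_one_of_nonneg_of_lt_one_left (artinWeight_div_nonneg ha hp) ?_ ?_
  · rw [div_lt_one (one_sub_artinWeight_pos ha hp)]
    linarith [artinWeight_lt_half (a := a) hp4]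
  · exact Finset.prod_le_one
      (fun r hr => artinWeight_div_nonneg ha (Nat.prime_of_mem_primeFactors
        (Finset.mem_of_mem_erase hr)))
      fun r hr => artinWeight_div_le_one ha (Nat.prime_of_mem_primeFactors
        (Finset.mem_of_mem_erase hr))

/-- Only μ(2|Δ|) = -1 is dangerous. Then |Δ| is odd and squarefree, and it is not 3 because μ(6) =
1; so it has a prime factor above 3, whose contribution to f‡ is less than 1 while the others are at
most 1. -/
theorem artinL_pos {a : ℤ} (ha : a ≠ -1 ∧ ¬ IsSquare a) : 0 < artinL a := by
  refine mul_pos (artinA_pos ha) ?_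
  have hΔ := three_le_natAbs_disc ha
  set m := (disc a).natAbs
  have hf := fDDagger_nonneg ha m
  by_cases hμ : ArithmeticFunction.moebius (2 * m) = -1
  · have hsq : Squarefree (2 * m) := by
      rw [← ArithmeticFunction.moebius_ne_zero_iff_squarefree, hμ]
      norm_num
    have hms : Squarefree m := hsq.squarefree_of_dvd (Dvd.intro_left 2 rfl)
    have h2 : ¬ 2 ∣ m := fun h => by
      have := Nat.isUnit_iff.1 (hsq 2 (mul_dvd_mul_left 2 h))
      omega
    obtain ⟨p, hp, hpm, hp4⟩ : ∃ p, p.Prime ∧ p ∣ m ∧ 4 ≤ p := by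
      by_contra! hcon
      have hall : ∀ p ∈ m.primeFactors, p = 3 := fun p hp => by
        have hp' := Nat.prime_of_mem_primeFactors hp
        have hd := Nat.dvd_of_mem_primeFactors hp
        have h1 := hcon p hp' hd
        have h3 := hp'.two_le
        have h4 : p ≠ 2 := fun h => h2 (h ▸ hd)
        omega
      have hm3 : m ∣ 3 := by
        rw [← Nat.prod_primeFactors_of_squarefree hms]
        refine Finset.prod_primes_dvd _
          (fun p hp => (Nat.prime_of_mem_primeFactors hp).prime) fun p hp => ?_
        rw [hall p hp]
      have hm : m = 3 := le_antisymm (Nat.le_of_dvd (by norm_num) hm3) hΔ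
      rw [hm, ArithmeticFunction.isMultiplicative_moebius.map_mul_of_coprime (by norm_num),
        ArithmeticFunction.moebius_apply_prime Nat.prime_two,
        ArithmeticFunction.moebius_apply_prime Nat.prime_three] at hμ
      norm_num at hμ
    have := fDDagger_lt_one ha (natAbs_disc_pos a).ne' hp hp4 hpm
    rw [hμ]
    push_cast
    linarith
  · have h0 : 0 ≤ ArithmeticFunction.moebius (2 * m) := by
      have := ArithmeticFunction.abs_moebius_le_one (n := 2 * m)
      rw [abs_le] at this
      omega
    have h0' : (0 : ℝ) ≤ (ArithmeticFunction.moebius (2 * m) : ℝ) := by exact_mod_cast h0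
    nlinarith [mul_nonneg h0' hf]

/-! ### Moree's density modulo a product -/

theorem kronecker_one (x : ℤ) : kronecker 1 x = 1 := by
  rw [kronecker]
  split_ifs <;> simp_all

/-- If p ∤ Δ_a, the correction factor is the one in ℒ_a and cancels. If p = 2 divides Δ_a, then 4 ∣
Δ_a and both Möbius values vanish. -/
theorem moreeDelta_prime {a : ℤ} (ha : a ≠ -1 ∧ ¬ IsSquare a) {p : ℕ} (hp : p.Prime)
    (h : p ∣ (disc a).natAbs → p = 2) (x : ℤ) :
    moreeDelta a x p / artinL a = artinAMod a x p / artinA a := by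
  have hL := (artinL_pos ha).ne'
  rw [artinL] at hL ⊢
  rw [moreeDelta]
  by_cases hd : p ∣ (disc a).natAbs
  · have hp2 := h hd
    subst hp2
    have h4 : 4 ∣ (disc a).natAbs := four_dvd_disc_of_two_dvd ha hd
    rw [Nat.gcd_eq_left hd, Nat.mul_div_cancel_left _ two_pos, moebius_eq_zero_of_four_dvd h4,
      moebius_eq_zero_of_four_dvd (h4.mul_left 2)]
    simp
  · have hg : Nat.gcd p (disc a).natAbs = 1 := (Nat.Prime.coprime_iff_not_dvd hp).2 hd
    have hb : betaDisc a p = 1 := by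
      have hg' : Int.gcd p (disc a) = 1 := by
        rw [Int.gcd, Int.natAbs_natCast]
        exact hg
      simp only [betaDisc, hg', Nat.cast_one, Int.ediv_one]
      split_ifs with h1 h2
      · simp
      · have := disc_emod_four_of_odd ha (by omega)
        omega
      · rfl
    rw [hg, hb, kronecker_one, Nat.div_one, Nat.div_one]
    rw [Int.cast_one, mul_one, mul_div_mul_right _ _ (right_ne_zero_of_mul hL)]

theorem artinAMod_congr {a x y : ℤ} {q : ℕ} (h : x ≡ y [ZMOD q]) :
    artinAMod a x q = artinAMod a y q := by
  have h1 : Int.gcd x q = Int.gcd y q := by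
    rw [← Int.gcd_emod x, ← Int.gcd_emod y, h]
  have h2 : Int.gcd (x - 1) q = Int.gcd (y - 1) q := by
    rw [← Int.gcd_emod (x - 1), ← Int.gcd_emod (y - 1), h.sub_right 1]
  rw [artinAMod, artinAMod, h1, h2]
  have h3 : (q.primeFactors.filter fun p => ((p : ℕ) : ℤ) ∣ x - 1) =
      q.primeFactors.filter fun p => ((p : ℕ) : ℤ) ∣ y - 1 := by
    refine Finset.filter_congr fun p hp => ?_
    have hpq : (p : ℤ) ∣ q := Int.natCast_dvd_natCast.2 (Nat.dvd_of_mem_primeFactors hp)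
    exact Int.ModEq.dvd_iff ((h.sub_right 1).of_dvd hpq)
  rw [h3]

theorem artinAMod_mul {a : ℤ} (ha : a ≠ -1 ∧ ¬ IsSquare a) {d p : ℕ} [NeZero d] [NeZero p]
    (hdp : d.Coprime p) (x : ℤ) :
    artinAMod a x (d * p) = artinAMod a x d * (artinAMod a x p / artinA a) := by
  have hA := (artinA_pos ha).ne'
  have hiff : Int.gcd x (d * p : ℕ) = 1 ↔ Int.gcd x d = 1 ∧ Int.gcd x p = 1 := by
    simp only [Int.gcd, Int.natAbs_natCast]
    exact Nat.coprime_mul_iff_right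
  by_cases h1 : Int.gcd x d = 1
  · by_cases h2 : Int.gcd x p = 1
    · have : NeZero (d * p) := ⟨mul_ne_zero (NeZero.ne d) (NeZero.ne p)⟩
      rw [artinAMod_eq (hiff.2 ⟨h1, h2⟩), artinAMod_eq h1, artinAMod_eq h2, Nat.totient_mul hdp,
        hdp.primeFactors_mul, Finset.prod_union hdp.disjoint_primeFactors]
      push_cast
      field_simp
    · rw [artinAMod_eq_zero fun h => h2 (hiff.1 h).2, artinAMod_eq_zero h2]
      simp
  · rw [artinAMod_eq_zero fun h => h1 (hiff.1 h).1, artinAMod_eq_zero h1]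
    simp

theorem moreeDelta_congr {a : ℤ} (ha : a ≠ -1 ∧ ¬ IsSquare a) {d x y : ℕ}
    (hd : IsSaturated a d) (h : x ≡ y [MOD d]) : moreeDelta a x d = moreeDelta a y d := by
  rw [moreeDelta_of_isSaturated hd, moreeDelta_of_isSaturated hd,
    artinAMod_congr (Int.natCast_modEq_iff.2 h)]
  by_cases hco : x.Coprime d
  · have hco' : y.Coprime d := by
      rw [Nat.Coprime, ← h.gcd_eq]
      exact hco
    rw [discChar, discChar]
    split_ifs with hdvd
    · rw [kronecker_eq_of_modEq ha (val_ne_zero_of_disc_dvd ha hdvd hco)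
        (val_ne_zero_of_disc_dvd ha hdvd hco') (hco.coprime_dvd_right hdvd) (h.of_dvd hdvd)]
    · rfl
  · rw [artinAMod_eq_zero]
    · simp
    · rw [Int.gcd_natCast_natCast, ← h.gcd_eq]
      exact hco

theorem moreeDelta_mul {a : ℤ} (ha : a ≠ -1 ∧ ¬ IsSquare a) {d p : ℕ} [NeZero d]
    (hp : p.Prime) (hpd : ¬ p ∣ d) (hΔ : p ∣ (disc a).natAbs → p = 2)
    (hd : IsSaturated a d) (hdp : IsSaturated a (d * p)) (x : ℤ) :
    moreeDelta a x (d * p) = moreeDelta a x d * (moreeDelta a x p / artinL a) := by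
  have : NeZero p := ⟨hp.ne_zero⟩
  have hco : d.Coprime p := ((Nat.Prime.coprime_iff_not_dvd hp).2 hpd).symm
  rw [moreeDelta_of_isSaturated hd, moreeDelta_of_isSaturated hdp, moreeDelta_prime ha hp hΔ,
    artinAMod_mul ha hco]
  -- The new prime cannot make Δ_a divide the modulus: if p = 2, then d is odd and dp has valuation
  -- 1, which is why 1 appears in the maximum defining saturation.
  have hchar : discChar a (d * p) x = discChar a d x := by
    rw [discChar, discChar]
    by_cases h1 : (disc a).natAbs ∣ d
    · rw [if_pos h1, if_pos (h1.mul_right p)]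
    · rw [if_neg h1, if_neg]
      intro h2
      have : Fact (Nat.Prime 2) := ⟨Nat.prime_two⟩
      have hlt := hd.resolve_left h1
      have h3 : padicValNat 2 (disc a).natAbs ≤ padicValNat 2 (d * p) :=
        (padicValNat_dvd_iff_le (mul_ne_zero (NeZero.ne d) hp.ne_zero)).1
          (pow_padicValNat_dvd.trans h2)
      by_cases hp2 : p = 2
      · subst hp2
        rw [padicValNat.mul (NeZero.ne d) two_ne_zero, padicValNat.self one_lt_two,
          padicValNat.eq_zero_of_not_dvd hpd] at h3
        omega
      · rw [padicValNat.mul (NeZero.ne d) hp.ne_zero,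
          padicValNat.eq_zero_of_not_dvd (n := p) fun h =>
            hp2 ((Nat.prime_dvd_prime_iff_eq Nat.prime_two hp).1 h).symm] at h3
        omega
  rw [hchar]
  ring

/-! ### The bad modulus -/

theorem factorization_finset_lcm {ι : Type*} (s : Finset ι) (f : ι → ℕ) (hf : ∀ i, f i ≠ 0)
    (p : ℕ) : (s.lcm f).factorization p = s.sup fun i => (f i).factorization p := by
  classical
  induction s using Finset.induction_on with
  | empty => simp
  | insert i s hi ih =>
    have h0 : s.lcm f ≠ 0 := by
      rw [Ne, Finset.lcm_eq_zero_iff]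
      rintro ⟨j, -, hj⟩
      exact hf j hj
    rw [Finset.lcm_insert, Finset.sup_insert, ← ih]
    change ((f i).lcm (s.lcm f)).factorization p = _
    rw [Nat.factorization_lcm (hf i) h0, Finsupp.sup_apply]

theorem padicValInt_disc (a : ℤ) : padicValInt 2 (disc a) = (disc a).natAbs.factorization 2 :=
  (Nat.factorization_def _ Nat.prime_two).symm

theorem lcm_disc_ne_zero (a : Fin 3 → ℤ) :
    (Finset.univ.lcm fun i => (disc (a i)).natAbs) ≠ 0 := by
  rw [Ne, Finset.lcm_eq_zero_iff]
  rintro ⟨j, -, hj⟩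
  exact (natAbs_disc_pos (a j)).ne' hj

theorem factorization_lcm_disc (a : Fin 3 → ℤ) (p : ℕ) :
    (Finset.univ.lcm fun i => (disc (a i)).natAbs).factorization p =
      Finset.univ.sup fun i => (disc (a i)).natAbs.factorization p :=
  factorization_finset_lcm _ _ (fun i => (natAbs_disc_pos (a i)).ne') p

theorem factorization_lcm_disc_two (a : Fin 3 → ℤ) :
    (Finset.univ.lcm fun i => (disc (a i)).natAbs).factorization 2 = maxVal2 a := by
  rw [factorization_lcm_disc, maxVal2, Finset.sup'_eq_sup]
  simp only [padicValInt_disc]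

theorem le_maxVal2 (a : Fin 3 → ℤ) (i : Fin 3) :
    (disc (a i)).natAbs.factorization 2 ≤ maxVal2 a := by
  rw [← padicValInt_disc]
  exact Finset.le_sup' (fun i => padicValInt 2 (disc (a i))) (Finset.mem_univ i)

theorem exists_minVal2 (a : Fin 3 → ℤ) :
    ∃ i, (disc (a i)).natAbs.factorization 2 = minVal2 a := by
  obtain ⟨i, -, hi⟩ := Finset.exists_mem_eq_inf' (Finset.univ_nonempty (α := Fin 3))
    fun i => padicValInt 2 (disc (a i))
  exact ⟨i, by rw [← padicValInt_disc, minVal2, hi]⟩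

theorem two_pow_dvd_lcm_disc (a : Fin 3 → ℤ) :
    2 ^ (maxVal2 a - minVal2 a) ∣ Finset.univ.lcm fun i => (disc (a i)).natAbs := by
  rw [Nat.prime_two.pow_dvd_iff_le_factorization (lcm_disc_ne_zero a), factorization_lcm_disc_two]
  omega

theorem badModulus_ne_zero (a : Fin 3 → ℤ) : badModulus a ≠ 0 := by
  intro h
  have := Nat.div_mul_cancel (two_pow_dvd_lcm_disc a)
  rw [← badModulus, h, zero_mul] at this
  exact lcm_disc_ne_zero a this.symm

instance (a : Fin 3 → ℤ) : NeZero (badModulus a) := ⟨badModulus_ne_zero a⟩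

theorem factorization_badModulus_two (a : Fin 3 → ℤ) :
    (badModulus a).factorization 2 = minVal2 a := by
  rw [badModulus, Nat.factorization_div (two_pow_dvd_lcm_disc a), Finsupp.tsub_apply,
    factorization_lcm_disc_two, Nat.prime_two.factorization_pow, Finsupp.single_eq_same]
  obtain ⟨i, hi⟩ := exists_minVal2 a
  have := le_maxVal2 a i
  omega

theorem factorization_badModulus_odd (a : Fin 3 → ℤ) {p : ℕ} (hp : p ≠ 2) :
    (badModulus a).factorization p =
      Finset.univ.sup fun i => (disc (a i)).natAbs.factorization p := by
  rw [badModulus, Nat.factorization_div (two_pow_dvd_lcm_disc a), Finsupp.tsub_apply,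
    factorization_lcm_disc, Nat.prime_two.factorization_pow, Finsupp.single_eq_of_ne hp, tsub_zero]

theorem factorization_disc_le_badModulus (a : Fin 3 → ℤ) {p : ℕ} (hp : p ≠ 2) (i : Fin 3) :
    (disc (a i)).natAbs.factorization p ≤ (badModulus a).factorization p := by
  rw [factorization_badModulus_odd a hp]
  exact Finset.le_sup (f := fun i => (disc (a i)).natAbs.factorization p) (Finset.mem_univ i)

/-- Explains the minimum of the 2-adic valuations in 𝔇: one vanishing factor kills a term of the
series, so the smallest valuation decides. -/
theorem exists_factorization_disc_le (a : Fin 3 → ℤ) (p : ℕ) :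
    ∃ i, (disc (a i)).natAbs.factorization p ≤ (badModulus a).factorization p := by
  rcases eq_or_ne p 2 with rfl | hp
  · obtain ⟨i, hi⟩ := exists_minVal2 a
    exact ⟨i, by rw [factorization_badModulus_two, hi]⟩
  · exact ⟨0, factorization_disc_le_badModulus a hp 0⟩

theorem badModulus_le (a : Fin 3 → ℤ) : badModulus a ≤ ∏ i, (disc (a i)).natAbs := by
  refine (Nat.div_le_self _ _).trans (Nat.le_of_dvd (Finset.prod_pos fun i _ =>
    natAbs_disc_pos (a i)) (Finset.lcm_dvd fun i hi => Finset.dvd_prod_of_mem _ hi))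

theorem eq_two_of_dvd_disc {a : Fin 3 → ℤ} {p : ℕ} (hp : p.Prime) (h : ¬ p ∣ badModulus a)
    (i : Fin 3) (hd : p ∣ (disc (a i)).natAbs) : p = 2 := by
  by_contra h2
  have h1 := factorization_disc_le_badModulus a h2 i
  rw [Nat.factorization_eq_zero_of_not_dvd h] at h1
  have := (hp.dvd_iff_one_le_factorization (natAbs_disc_pos (a i)).ne').1 hd
  omega

/-- The odd part of Δ_{a_i} divides 𝔇. At 2, the valuation of a discriminant is 0 or at least 2, so
if it is at most max(ν₂(d), 1) it is at most ν₂(d). -/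
theorem isSaturated_of_badModulus_dvd {a : Fin 3 → ℤ} (ha : ∀ i, a i ≠ -1 ∧ ¬ IsSquare (a i))
    {d : ℕ} [NeZero d] (hd : badModulus a ∣ d) (i : Fin 3) : IsSaturated (a i) d := by
  have h0 := (natAbs_disc_pos (a i)).ne'
  rw [IsSaturated, ← Nat.factorization_def _ Nat.prime_two, ← Nat.factorization_def _ Nat.prime_two]
  rw [or_iff_not_imp_right]
  intro hle
  have hdf := (Nat.factorization_le_iff_dvd (badModulus_ne_zero a) (NeZero.ne d)).2 hd
  refine (Nat.factorization_le_iff_dvd h0 (NeZero.ne d)).1 fun p => ?_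
  rcases eq_or_ne p 2 with rfl | hp
  · by_contra hlt
    have h4 : 2 ≤ (disc (a i)).natAbs.factorization 2 := by
      refine (Nat.prime_two.pow_dvd_iff_le_factorization h0).1 ?_
      refine four_dvd_disc_of_two_dvd (ha i) ?_
      rw [Nat.prime_two.dvd_iff_one_le_factorization h0]
      omega
    omega
  · exact (factorization_disc_le_badModulus a hp i).trans (hdf p)

/-! ### The support of the singular series -/

/-- Since k is squarefree, the exponent of p in lcm(k, m) is at most max(1, ν_p(m)), which is below
ν_p(q). -/
theorem gcd_lcm_dvd_div {q k m p : ℕ} (hp : p.Prime) (hq : q ≠ 0) (hk : Squarefree k) (hm : m ≠ 0)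
    (h2 : 2 ≤ q.factorization p) (hlt : m.factorization p < q.factorization p) :
    q.gcd (k.lcm m) ∣ q / p := by
  have hpq : p ∣ q := (hp.dvd_iff_one_le_factorization hq).2 (by omega)
  have hl0 : k.lcm m ≠ 0 := Nat.lcm_ne_zero hk.ne_zero hm
  have hqp : q / p ≠ 0 := (Nat.div_pos (Nat.le_of_dvd (Nat.pos_of_ne_zero hq) hpq) hp.pos).ne'
  refine (Nat.factorization_le_iff_dvd (Nat.gcd_pos_of_pos_left _ (Nat.pos_of_ne_zero hq)).ne'
    hqp).1 fun r => ?_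
  rw [Nat.factorization_gcd hq hl0, Nat.factorization_lcm hk.ne_zero hm,
    Nat.factorization_div hpq, hp.factorization, Finsupp.inf_apply, Finsupp.sup_apply,
    Finsupp.tsub_apply]
  rcases eq_or_ne r p with rfl | hr
  · rw [Finsupp.single_eq_same]
    have := hk.natFactorization_le_one r
    exact (inf_le_right).trans (max_le (by omega) (by omega))
  · rw [Finsupp.single_eq_of_ne hr, tsub_zero]
    exact inf_le_left

theorem modulusTerm_eq_zero {a : Fin 3 → ℤ} (ha : ∀ i, a i ≠ -1 ∧ ¬ IsSquare (a i)) (n : ℕ)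
    {q p : ℕ} [NeZero q] (hp : p.Prime) (h2 : 2 ≤ q.factorization p)
    (hlt : (badModulus a).factorization p < q.factorization p) : modulusTerm a n q = 0 := by
  obtain ⟨i, hi⟩ := exists_factorization_disc_le a p
  have hpp : p * p ∣ q := by
    rw [← pow_two, hp.pow_dvd_iff_le_factorization (NeZero.ne q)]
    exact h2
  have h0 : ∀ z : (ZMod q)ˣ, densityFourier (a i) q (z : ZMod q) = 0 := by
    intro z
    rw [densityFourier]
    refine (tsum_congr fun k => ?_).trans tsum_zero
    by_cases hk : Squarefree (k : ℕ)
    · rw [normSum_eq_zero (ha i) hk z hp hpp (gcd_lcm_dvd_div hp (NeZero.ne q) hk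
        (natAbs_disc_pos (a i)).ne' h2 (hi.trans_lt hlt)), mul_zero]
    · rw [ArithmeticFunction.moebius_eq_zero_of_not_squarefree hk, Int.cast_zero, zero_mul]
  rw [modulusTerm]
  refine Finset.sum_eq_zero fun z _ => ?_
  rw [Finset.prod_eq_zero (Finset.mem_univ i) (h0 z), mul_zero]

/-! ### Fourier analysis on `ZMod d` -/

/-- The number of representations of `n` weighted by `f`. -/
def weightedCount {d : ℕ} [NeZero d] (f : Fin 3 → ZMod d → ℝ) (n : ZMod d) : ℝ :=
  ∑ b : Fin 3 → ZMod d with ∑ i, b i = n, ∏ i, f i (b i)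

theorem stdAddChar_sum {d : ℕ} [NeZero d] {ι : Type*} (s : Finset ι) (f : ι → ZMod d) :
    (ZMod.stdAddChar (∑ i ∈ s, f i) : ℂ) = ∏ i ∈ s, ZMod.stdAddChar (f i) := by
  classical
  induction s using Finset.induction_on with
  | empty => simp
  | insert i s hi ih => rw [Finset.sum_insert hi, Finset.prod_insert hi, AddChar.map_add_eq_mul, ih]

theorem sum_stdAddChar_mul_prod {d : ℕ} [NeZero d] (f : Fin 3 → ZMod d → ℝ) (n : ZMod d) :
    ∑ w : ZMod d, ZMod.stdAddChar (-n * w) *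
        ∏ i, ∑ b : ZMod d, (f i b : ℂ) * ZMod.stdAddChar (w * b) =
      (d : ℂ) * (weightedCount f n : ℂ) := by
  have h1 : ∀ w : ZMod d, ZMod.stdAddChar (-n * w) *
      ∏ i, ∑ b : ZMod d, (f i b : ℂ) * ZMod.stdAddChar (w * b) =
      ∑ b : Fin 3 → ZMod d, (∏ i, (f i (b i) : ℂ)) *
        ZMod.stdAddChar (w * (∑ i, b i - n)) := by
    intro w
    rw [Finset.prod_univ_sum, Fintype.piFinset_univ, Finset.mul_sum]
    refine Finset.sum_congr rfl fun b _ => ?_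
    rw [Finset.prod_mul_distrib, mul_sub, sub_eq_add_neg, AddChar.map_add_eq_mul, Finset.mul_sum,
      stdAddChar_sum, show -(w * n) = -n * w by ring]
    ring
  simp_rw [h1]
  rw [Finset.sum_comm, weightedCount, Complex.ofReal_sum, Finset.mul_sum, Finset.sum_filter]
  refine Finset.sum_congr rfl fun b _ => ?_
  rw [← Finset.mul_sum, AddChar.sum_mulShift _ (ZMod.isPrimitive_stdAddChar d), ZMod.card]
  simp only [sub_eq_zero]
  split_ifs
  · push_cast
    ring
  · simp

theorem sum_units_eq_sum {d : ℕ} [NeZero d] (f : ZMod d → ℂ) (hf : ∀ x, ¬ IsUnit x → f x = 0) :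
    ∑ b : (ZMod d)ˣ, f b = ∑ x : ZMod d, f x := by
  classical
  have h1 := Finset.sum_map (Finset.univ : Finset (ZMod d)ˣ) ⟨_, Units.val_injective⟩ f
  rw [Function.Embedding.coeFn_mk] at h1
  rw [← h1]
  refine Finset.sum_subset (Finset.subset_univ _) fun x _ hx => hf x fun hu => hx ?_
  exact Finset.mem_map.2 ⟨hu.unit, Finset.mem_univ _, rfl⟩

/-- The weighted number of representations of `n` for Moree's densities modulo `d`. -/
def densitySum (a : Fin 3 → ℤ) (n d : ℕ) [NeZero d] : ℝ :=
  d * weightedCount (fun i (x : ZMod d) => moreeDelta (a i) x.val d) (n : ZMod d)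

theorem moreeDelta_eq_zero_of_not_isUnit {a : ℤ} {d : ℕ} [NeZero d] {x : ZMod d} (hx : ¬ IsUnit x) :
    moreeDelta a x.val d = 0 := by
  rw [moreeDelta, artinAMod_eq_zero, zero_mul]
  rw [Int.gcd_natCast_natCast]
  intro h
  apply hx
  rw [← ZMod.natCast_zmod_val x]
  exact (ZMod.isUnit_iff_coprime _ _).2 h

theorem sum_densityFourier {a : Fin 3 → ℤ} (ha : ∀ i, a i ≠ -1 ∧ ¬ IsSquare (a i)) (n : ℕ) {d : ℕ}
    [NeZero d] (hd : ∀ i, IsSaturated (a i) d) :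
    ∑ w : ZMod d, ZMod.stdAddChar (-(n : ZMod d) * w) * ∏ i, densityFourier (a i) d w =
      (densitySum a n d : ℂ) := by
  rw [densitySum, Complex.ofReal_mul, Complex.ofReal_natCast, ← sum_stdAddChar_mul_prod]
  refine Finset.sum_congr rfl fun w _ => ?_
  congr 1
  refine Finset.prod_congr rfl fun i _ => ?_
  rw [densityFourier_eq (ha i) (hd i)]
  exact sum_units_eq_sum (fun x : ZMod d => (moreeDelta (a i) x.val d : ℂ) *
    ZMod.stdAddChar (w * x)) fun x hx => by
      rw [moreeDelta_eq_zero_of_not_isUnit hx, Complex.ofReal_zero, zero_mul]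

theorem localDensity_eq (a : Fin 3 → ℤ) (n d : ℕ) [NeZero d] :
    localDensity a n d =
      d * weightedCount (fun i (x : ZMod d) => moreeDelta (a i) x.val d / artinL (a i)) n := by
  rw [localDensity, weightedCount]
  congr 1
  refine Finset.sum_bij' (fun b _ i => (b i : ZMod d)) (fun b _ i => (b i).val) ?_ ?_ ?_ ?_ ?_
  · intro b hb
    rw [Finset.mem_filter] at hb ⊢
    refine ⟨Finset.mem_univ _, ?_⟩
    rw [← Nat.cast_sum]
    exact (ZMod.natCast_eq_natCast_iff _ _ _).2 hb.2
  · intro b hb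
    rw [Finset.mem_filter] at hb ⊢
    refine ⟨Fintype.mem_piFinset.2 fun i => Finset.mem_range.2 (ZMod.val_lt _), ?_⟩
    rw [← ZMod.natCast_eq_natCast_iff, Nat.cast_sum, ← hb.2]
    exact Finset.sum_congr rfl fun i _ => ZMod.natCast_zmod_val _
  · intro b hb
    funext i
    have := Fintype.mem_piFinset.1 (Finset.mem_filter.1 hb).1 i
    exact ZMod.val_cast_of_lt (Finset.mem_range.1 this)
  · intro b hb
    funext i
    exact ZMod.natCast_zmod_val _
  · intro b hb
    refine Finset.prod_congr rfl fun i _ => ?_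
    have := Fintype.mem_piFinset.1 (Finset.mem_filter.1 hb).1 i
    rw [ZMod.val_cast_of_lt (Finset.mem_range.1 this)]

theorem densitySum_eq {a : Fin 3 → ℤ} (ha : ∀ i, a i ≠ -1 ∧ ¬ IsSquare (a i)) (n d : ℕ) [NeZero d] :
    densitySum a n d = (∏ i, artinL (a i)) * localDensity a n d := by
  have hL : ∏ i, artinL (a i) ≠ 0 := Finset.prod_ne_zero_iff.2 fun i _ => (artinL_pos (ha i)).ne'
  rw [localDensity_eq, densitySum, weightedCount, weightedCount]
  simp_rw [Finset.prod_div_distrib]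
  rw [← Finset.sum_div]
  field_simp

/-! ### Multiplicativity of the densities -/

theorem weightedCount_mul {d p : ℕ} [NeZero d] [NeZero p] [NeZero (d * p)] (h : d.Coprime p)
    (f : Fin 3 → ZMod d → ℝ) (g : Fin 3 → ZMod p → ℝ) (n : ℕ) :
    weightedCount (fun i (x : ZMod (d * p)) => f i (x.val : ZMod d) * g i (x.val : ZMod p)) n =
      weightedCount f n * weightedCount g n := by
  set e := ZMod.chineseRemainder h with he
  have h1 : ∀ x : ZMod (d * p), (e x).1 = (x.val : ZMod d) := fun x => by
    conv_lhs => rw [← ZMod.natCast_zmod_val x, map_natCast]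
    rfl
  have h2 : ∀ x : ZMod (d * p), (e x).2 = (x.val : ZMod p) := fun x => by
    conv_lhs => rw [← ZMod.natCast_zmod_val x, map_natCast]
    rfl
  simp only [weightedCount, Finset.sum_filter]
  rw [Finset.sum_mul_sum, ← Fintype.sum_prod_type']
  refine Fintype.sum_equiv ((Equiv.arrowCongr (Equiv.refl _) e.toEquiv).trans
    (Equiv.arrowProdEquivProdArrow _ _ _)) _ _ fun b => ?_
  have hsum : ∑ i, b i = (n : ZMod (d * p)) ↔
      ∑ i, (e (b i)).1 = (n : ZMod d) ∧ ∑ i, (e (b i)).2 = (n : ZMod p) := by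
    rw [← e.injective.eq_iff, map_sum, map_natCast, Prod.ext_iff, Prod.fst_sum, Prod.snd_sum]
    rfl
  simp only [← h1, ← h2, Finset.prod_mul_distrib]
  change _ = (if ∑ i, (e (b i)).1 = (n : ZMod d) then ∏ i, f i (e (b i)).1 else 0) *
    (if ∑ i, (e (b i)).2 = (n : ZMod p) then ∏ i, g i (e (b i)).2 else 0)
  by_cases h3 : ∑ i, (e (b i)).1 = (n : ZMod d)
  · by_cases h4 : ∑ i, (e (b i)).2 = (n : ZMod p)
    · rw [if_pos (hsum.2 ⟨h3, h4⟩), if_pos h3, if_pos h4]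
    · rw [if_neg fun h => h4 (hsum.1 h).2, if_neg h4, mul_zero]
  · rw [if_neg fun h => h3 (hsum.1 h).1, if_neg h3, zero_mul]

theorem densitySum_mul {a : Fin 3 → ℤ} (ha : ∀ i, a i ≠ -1 ∧ ¬ IsSquare (a i)) (n : ℕ) {d p : ℕ}
    [NeZero d] [NeZero (d * p)] (hp : p.Prime) (hpd : ¬ p ∣ d)
    (hΔ : ∀ i, p ∣ (disc (a i)).natAbs → p = 2)
    (hd : ∀ i, IsSaturated (a i) d) (hdp : ∀ i, IsSaturated (a i) (d * p)) :
    densitySum a n (d * p) = densitySum a n d * localDensity a n p := by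
  have : NeZero p := ⟨hp.ne_zero⟩
  have hco : d.Coprime p := ((Nat.Prime.coprime_iff_not_dvd hp).2 hpd).symm
  rw [localDensity_eq, densitySum, densitySum]
  have h1 := weightedCount_mul hco (fun i (x : ZMod d) => moreeDelta (a i) x.val d)
    (fun i (x : ZMod p) => moreeDelta (a i) x.val p / artinL (a i)) n
  have h2 : (fun i (x : ZMod (d * p)) => moreeDelta (a i) ((x.val : ZMod d)).val d *
      (moreeDelta (a i) ((x.val : ZMod p)).val p / artinL (a i))) =
      fun i (x : ZMod (d * p)) => moreeDelta (a i) x.val (d * p : ℕ) := by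
    funext i x
    rw [moreeDelta_mul (ha i) hp hpd (hΔ i) (hd i) (hdp i), moreeDelta_prime (ha i) hp (hΔ i),
      moreeDelta_prime (ha i) hp (hΔ i), ZMod.val_natCast, ZMod.val_natCast,
      moreeDelta_congr (ha i) (hd i) (Nat.mod_modEq _ _),
      artinAMod_congr (Int.natCast_modEq_iff.2 (Nat.mod_modEq _ _))]
  rw [← h2, h1]
  push_cast
  ring

/-! ### Summing the singular series over the divisors of a modulus -/

theorem stdAddChar_natCast_mul {q t : ℕ} [NeZero q] [NeZero (q * t)] (m : ℕ) :
    (ZMod.stdAddChar ((m * t : ℕ) : ZMod (q * t)) : ℂ) = ZMod.stdAddChar (m : ZMod q) := by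
  have hq : (q : ℂ) ≠ 0 := by exact_mod_cast NeZero.ne q
  have ht : (t : ℂ) ≠ 0 := by exact_mod_cast right_ne_zero_of_mul (NeZero.ne (q * t))
  have h1 := ZMod.stdAddChar_coe (N := q * t) ((m * t : ℕ) : ℤ)
  have h2 := ZMod.stdAddChar_coe (N := q) (m : ℤ)
  rw [Int.cast_natCast] at h1 h2
  rw [h1, h2]
  congr 1
  push_cast
  field_simp

theorem densityFourier_eq_of_dvd {a : ℤ} {q t : ℕ} [NeZero q] [NeZero (q * t)] (m : ℕ) :
    densityFourier a (q * t) ((m * t : ℕ) : ZMod (q * t)) = densityFourier a q (m : ZMod q) := by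
  rw [densityFourier, densityFourier]
  refine tsum_congr fun k => ?_
  congr 1
  refine normSum_eq_of_dvd (dvd_mul_right q t) fun b => ?_
  rw [coe_unitsMap, ← Nat.cast_mul, ← stdAddChar_natCast_mul (t := t)]
  congr 1
  conv_lhs => rw [← ZMod.natCast_zmod_val (b : ZMod (q * t))]
  push_cast
  ring

/-- The integrand of the circle method at the point `w / d`. -/
def circleTerm (a : Fin 3 → ℤ) (n d : ℕ) [NeZero d] (w : ZMod d) : ℂ :=
  ZMod.stdAddChar (-(n : ZMod d) * w) * ∏ i, densityFourier (a i) d w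

theorem circleTerm_eq_of_dvd {a : Fin 3 → ℤ} {n q t : ℕ} [NeZero q] [NeZero (q * t)] (m : ℕ) :
    circleTerm a n (q * t) ((m * t : ℕ) : ZMod (q * t)) = circleTerm a n q (m : ZMod q) := by
  simp only [circleTerm, densityFourier_eq_of_dvd]
  congr 1
  rw [neg_mul, neg_mul, AddChar.map_neg_eq_inv, AddChar.map_neg_eq_inv, ← Nat.cast_mul,
    ← Nat.cast_mul, ← mul_assoc, stdAddChar_natCast_mul]

/-- Multiplication by t matches units modulo q with residues of order q modulo qt: these are the
fractions with lowest denominator q. Summing over q ∣ d thus recovers all of ℤ/d. -/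
theorem modulusTerm_eq_sum_addOrderOf (a : Fin 3 → ℤ) (n : ℕ) {q t : ℕ} [NeZero q]
    [NeZero (q * t)] :
    modulusTerm a n q = ∑ w : ZMod (q * t) with addOrderOf w = q, circleTerm a n (q * t) w := by
  have hqt := NeZero.ne (q * t)
  have hq := NeZero.ne q
  have ht : 0 < t := Nat.pos_of_ne_zero (right_ne_zero_of_mul hqt)
  have hord : ∀ m : ℕ, addOrderOf ((m * t : ℕ) : ZMod (q * t)) = q / q.gcd m := fun m => by
    rw [ZMod.addOrderOf_coe _ hqt, Nat.gcd_mul_right, Nat.mul_div_mul_right _ _ ht]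
  rw [modulusTerm]
  refine Finset.sum_bij (fun z _ => (((z : ZMod q).val * t : ℕ) : ZMod (q * t))) ?_ ?_ ?_ ?_
  · intro z _
    rw [Finset.mem_filter]
    refine ⟨Finset.mem_univ _, ?_⟩
    rw [hord, Nat.gcd_comm, ZMod.val_coe_unit_coprime z, Nat.div_one]
  · intro z _ z' _ h
    have h1 := (ZMod.natCast_eq_natCast_iff _ _ _).1 h
    have hlt : ∀ y : ZMod q, y.val * t < q * t := fun y =>
      Nat.mul_lt_mul_of_pos_right (ZMod.val_lt y) ht
    have h2 := h1.eq_of_lt_of_lt (hlt _) (hlt _)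
    exact Units.ext (ZMod.val_injective q (Nat.eq_of_mul_eq_mul_right ht h2))
  · intro w hw
    have hw := (Finset.mem_filter.1 hw).2
    have h1 := ZMod.addOrderOf_coe w.val hqt
    rw [ZMod.natCast_zmod_val, hw] at h1
    have h2 : (q * t).gcd w.val = t := by
      have h3 := Nat.div_mul_cancel (Nat.gcd_dvd_left (q * t) w.val)
      rw [← h1] at h3
      exact Nat.eq_of_mul_eq_mul_left (Nat.pos_of_ne_zero hq) h3
    obtain ⟨m, hm⟩ : t ∣ w.val := by
      have := Nat.gcd_dvd_right (q * t) w.val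
      rw [h2] at this
      exact this
    replace hm : w.val = m * t := hm.trans (mul_comm _ _)
    have hco : m.Coprime q := by
      rw [hm, Nat.gcd_mul_right] at h2
      have : q.gcd m = 1 := Nat.eq_of_mul_eq_mul_right ht (h2.trans (one_mul t).symm)
      rwa [Nat.coprime_comm]
    have hmq : m < q := by
      have := ZMod.val_lt w
      rw [hm] at this
      exact lt_of_mul_lt_mul_right this ht.le
    refine ⟨ZMod.unitOfCoprime m hco, Finset.mem_univ _, ?_⟩
    rw [ZMod.coe_unitOfCoprime, ZMod.val_cast_of_lt hmq, ← hm, ZMod.natCast_zmod_val]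
  · intro z _
    rw [circleTerm_eq_of_dvd, ZMod.natCast_zmod_val]
    rfl

/-- The additive order of an element of `ZMod d`. -/
def zmodOrder {d : ℕ} [NeZero d] (w : ZMod d) : ℕ+ := ⟨addOrderOf w, addOrderOf_pos w⟩

/-- The finite set of divisors of `d`, as the set of orders of elements of `ZMod d`. -/
def orderSet (d : ℕ) [NeZero d] : Finset ℕ+ :=
  (Finset.univ : Finset (ZMod d)).image zmodOrder

theorem mem_orderSet {d : ℕ} [NeZero d] {q : ℕ+} : q ∈ orderSet d ↔ (q : ℕ) ∣ d := by
  rw [orderSet, Finset.mem_image]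
  constructor
  · rintro ⟨w, -, rfl⟩
    have := addOrderOf_dvd_card (x := w)
    rwa [ZMod.card] at this
  · rintro ⟨t, rfl⟩
    refine ⟨((t : ℕ) : ZMod (q * t)), Finset.mem_univ _, ?_⟩
    apply PNat.eq
    have ht : 0 < t := Nat.pos_of_ne_zero (right_ne_zero_of_mul (NeZero.ne ((q : ℕ) * t)))
    change addOrderOf ((t : ℕ) : ZMod (q * t)) = q
    rw [ZMod.addOrderOf_coe _ (NeZero.ne _), Nat.gcd_mul_left_left, Nat.mul_div_cancel _ ht]

theorem sum_modulusTerm (a : Fin 3 → ℤ) (n d : ℕ) [NeZero d] :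
    ∑ q ∈ orderSet d, modulusTerm a n q = ∑ w : ZMod d, circleTerm a n d w := by
  rw [← Finset.sum_fiberwise_of_maps_to (s := Finset.univ) (t := orderSet d)
    (g := zmodOrder)
    fun w _ => Finset.mem_image_of_mem _ (Finset.mem_univ w)]
  refine Finset.sum_congr rfl fun q hq => ?_
  obtain ⟨t, rfl⟩ := mem_orderSet.1 hq
  rw [modulusTerm_eq_sum_addOrderOf a n (t := t)]
  refine Finset.sum_congr (Finset.filter_congr fun w _ => ?_) fun _ _ => rfl
  exact ⟨fun h => PNat.eq h, fun h => congrArg PNat.val h⟩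

/-! ### The product formula -/

/-- The primes not dividing the bad modulus. -/
abbrev GoodPrime (a : Fin 3 → ℤ) : Type := {p : ℕ // p.Prime ∧ ¬ p ∣ badModulus a}

/-- The modulus built from a finite set of good primes. -/
def levelModulus (a : Fin 3 → ℤ) (s : Finset (GoodPrime a)) : ℕ := badModulus a * ∏ p ∈ s, (p : ℕ)

theorem levelModulus_ne_zero (a : Fin 3 → ℤ) (s : Finset (GoodPrime a)) :
    levelModulus a s ≠ 0 :=
  mul_ne_zero (badModulus_ne_zero a) (Finset.prod_ne_zero_iff.2 fun p _ => p.2.1.ne_zero)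

instance (a : Fin 3 → ℤ) (s : Finset (GoodPrime a)) : NeZero (levelModulus a s) :=
  ⟨levelModulus_ne_zero a s⟩

theorem factorization_levelModulus (a : Fin 3 → ℤ) (s : Finset (GoodPrime a)) (p : ℕ) :
    (levelModulus a s).factorization p =
      (badModulus a).factorization p + ∑ r ∈ s, if (r : ℕ) = p then 1 else 0 := by
  rw [levelModulus, Nat.factorization_mul (badModulus_ne_zero a)
    (Finset.prod_ne_zero_iff.2 fun p _ => p.2.1.ne_zero), Nat.factorization_prod
    fun p _ => p.2.1.ne_zero, Finsupp.add_apply, Finsupp.finsetSum_apply]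
  congr 1
  refine Finset.sum_congr rfl fun r _ => ?_
  rw [r.2.1.factorization, Finsupp.single_apply]

theorem isSaturated_levelModulus {a : Fin 3 → ℤ} (ha : ∀ i, a i ≠ -1 ∧ ¬ IsSquare (a i))
    (s : Finset (GoodPrime a)) (i : Fin 3) : IsSaturated (a i) (levelModulus a s) :=
  isSaturated_of_badModulus_dvd ha (d := levelModulus a s) (dvd_mul_right _ _) i

theorem not_dvd_levelModulus {a : Fin 3 → ℤ} {s : Finset (GoodPrime a)} {p : GoodPrime a}
    (hp : p ∉ s) : ¬ (p : ℕ) ∣ levelModulus a s := by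
  rw [levelModulus, p.2.1.dvd_mul, p.2.1.prime.dvd_finsetProd_iff]
  rintro (h | ⟨r, hr, h⟩)
  · exact p.2.2 h
  · rw [Nat.prime_dvd_prime_iff_eq p.2.1 r.2.1] at h
    exact hp (Subtype.ext h ▸ hr)

theorem densitySum_congr (a : Fin 3 → ℤ) (n : ℕ) {d e : ℕ} [NeZero d] [NeZero e] (h : d = e) :
    densitySum a n d = densitySum a n e := by
  subst h
  rfl

theorem densitySum_levelModulus {a : Fin 3 → ℤ} (ha : ∀ i, a i ≠ -1 ∧ ¬ IsSquare (a i)) (n : ℕ)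
    (s : Finset (GoodPrime a)) :
    densitySum a n (levelModulus a s) =
      densitySum a n (badModulus a) * ∏ p ∈ s, localDensity a n p := by
  classical
  induction s using Finset.induction_on with
  | empty =>
    rw [Finset.prod_empty, mul_one]
    exact densitySum_congr a n (by rw [levelModulus, Finset.prod_empty, mul_one])
  | insert p s hp ih =>
    have h1 : levelModulus a (insert p s) = levelModulus a s * p := by
      rw [levelModulus, levelModulus, Finset.prod_insert hp]
      ring
    have : NeZero (levelModulus a s * p) := ⟨h1 ▸ levelModulus_ne_zero a _⟩
    rw [densitySum_congr a n h1, densitySum_mul ha n p.2.1 (not_dvd_levelModulus hp)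
      (fun i => eq_two_of_dvd_disc p.2.1 p.2.2 i) (isSaturated_levelModulus ha s)
      (h1 ▸ isSaturated_levelModulus ha _), ih, Finset.prod_insert hp]
    ring

theorem sum_orderSet_levelModulus {a : Fin 3 → ℤ} (ha : ∀ i, a i ≠ -1 ∧ ¬ IsSquare (a i)) (n : ℕ)
    (s : Finset (GoodPrime a)) :
    ∑ q ∈ orderSet (levelModulus a s), modulusTerm a n q =
      ((densitySum a n (badModulus a) * ∏ p ∈ s, localDensity a n p : ℝ) : ℂ) := by
  rw [sum_modulusTerm, ← densitySum_levelModulus ha]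
  exact sum_densityFourier ha n (isSaturated_levelModulus ha s)

/-- By `modulusTerm_eq_zero` the exponent of p in q is at most ν_p(𝔇) if p ∣ 𝔇, and at most 1
otherwise. The set consists of the good primes dividing q. -/
theorem exists_dvd_levelModulus {a : Fin 3 → ℤ} (ha : ∀ i, a i ≠ -1 ∧ ¬ IsSquare (a i)) {n : ℕ}
    {q : ℕ+} (hq : modulusTerm a n q ≠ 0) : ∃ s : Finset (GoodPrime a), (q : ℕ) ∣ levelModulus a s := by
  classical
  have hfin : {p : GoodPrime a | (p : ℕ) ∣ q}.Finite := by
    refine Set.Finite.of_finite_image (f := Subtype.val) ?_ Subtype.val_injective.injOn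
    refine (Nat.divisors q).finite_toSet.subset ?_
    rintro _ ⟨p, hp, rfl⟩
    exact Nat.mem_divisors.2 ⟨hp, q.ne_zero⟩
  refine ⟨hfin.toFinset, (Nat.factorization_le_iff_dvd q.ne_zero (levelModulus_ne_zero a _)).1
    fun p => ?_⟩
  by_cases hp : p.Prime
  · rw [factorization_levelModulus]
    by_cases hpq : p ∣ q
    · by_contra! hlt
      have hb : (badModulus a).factorization p < (q : ℕ).factorization p := by omega
      by_cases hpD : p ∣ badModulus a
      · have := (hp.dvd_iff_one_le_factorization (badModulus_ne_zero a)).1 hpD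
        exact hq (modulusTerm_eq_zero ha n hp (by omega) hb)
      · have h1 : 1 ≤ ∑ r ∈ hfin.toFinset, if (r : ℕ) = p then 1 else 0 := by
          refine le_trans ?_ (Finset.single_le_sum (f := fun r : GoodPrime a =>
            if (r : ℕ) = p then 1 else 0) (fun _ _ => Nat.zero_le _)
            (show (⟨p, hp, hpD⟩ : GoodPrime a) ∈ hfin.toFinset from
              hfin.mem_toFinset.2 hpq))
          simp
        exact hq (modulusTerm_eq_zero ha n hp (by omega) hb)
    · rw [Nat.factorization_eq_zero_of_not_dvd hpq]
      exact Nat.zero_le _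
  · rw [Nat.factorization_eq_zero_of_not_prime _ hp]
    exact Nat.zero_le _

theorem levelModulus_dvd {a : Fin 3 → ℤ} {s t : Finset (GoodPrime a)} (h : s ⊆ t) :
    levelModulus a s ∣ levelModulus a t :=
  mul_dvd_mul_left _ (Finset.prod_dvd_prod_of_subset _ _ _ h)

-- The divisors of the level moduli eventually cover any finite part of the support, so absolute
-- convergence allows summation along them.
open Filter Topology in
theorem tendsto_prod_localDensity {a : Fin 3 → ℤ} (ha : ∀ i, a i ≠ -1 ∧ ¬ IsSquare (a i)) (n : ℕ) :
    Tendsto (fun s : Finset (GoodPrime a) =>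
      ((densitySum a n (badModulus a) * ∏ p ∈ s, localDensity a n p : ℝ) : ℂ)) atTop
      (𝓝 (∑' q : ℕ+, modulusTerm a n q)) := by
  classical
  set f : ℕ+ → ℂ := fun q => modulusTerm a n q with hf
  have h1 : HasSum (fun q : Function.support f => f q) (∑' q, f q) :=
    hasSum_subtype_support.2 (summable_modulusTerm ha n).hasSum
  have h2 : Tendsto (fun s : Finset (GoodPrime a) =>
      (orderSet (levelModulus a s)).subtype (· ∈ Function.support f)) atTop atTop := by
    refine tendsto_atTop_finset_of_monotone (fun s t hst q hq => ?_) fun q => ?_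
    · rw [Finset.mem_subtype, mem_orderSet] at hq ⊢
      exact hq.trans (levelModulus_dvd hst)
    · obtain ⟨s, hs⟩ := exists_dvd_levelModulus ha (Function.mem_support.1 q.2)
      exact ⟨s, Finset.mem_subtype.2 (mem_orderSet.2 hs)⟩
  have h3 := h1.comp h2
  refine h3.congr fun s => ?_
  rw [← sum_orderSet_levelModulus ha, Function.comp_apply,
    Finset.sum_subtype_eq_sum_filter]
  convert Finset.sum_filter_ne_zero (orderSet (levelModulus a s)) (f := f)

/-! ### Size of the local densities -/

/-- The density of the class of `x` modulo `p`, relative to `𝒜_a`. -/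
def relativeWeight (a : ℤ) {d : ℕ} (x : ZMod d) : ℝ := artinAMod a (x.val : ℤ) d / artinA a

theorem localDensity_goodPrime {a : Fin 3 → ℤ} (ha : ∀ i, a i ≠ -1 ∧ ¬ IsSquare (a i)) (n : ℕ)
    (p : GoodPrime a) [NeZero (p : ℕ)] :
    localDensity a n p =
      (p : ℕ) * weightedCount (fun i (x : ZMod (p : ℕ)) => relativeWeight (a i) x) n := by
  rw [localDensity_eq]
  simp_rw [moreeDelta_prime (ha _) p.2.1 (eq_two_of_dvd_disc p.2.1 p.2.2 _)]
  rfl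

/-- Up to scaling, the weight is 1 minus a point mass at 0 and a multiple of a point mass at 1, so
its Fourier transform is explicit. -/
theorem relativeWeight_eq {a : ℤ} (ha : a ≠ -1 ∧ ¬ IsSquare a) {p : ℕ} [NeZero p] (hp : p.Prime)
    (x : ZMod p) : relativeWeight a x = (((p : ℝ) - 1) - kummerWeight a p)⁻¹ *
      (1 - (if x = 0 then 1 else 0) - kummerWeight a p * (if x = 1 then 1 else 0)) := by
  have hA := (artinA_pos ha).ne'
  have : Fact p.Prime := ⟨hp⟩
  have hp1 := sub_one_pos_of_prime hp
  rw [relativeWeight]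
  by_cases hx : x = 0
  · rw [if_pos hx, if_neg (by rw [hx]; exact zero_ne_one), artinAMod_eq_zero]
    · simp
    · rw [hx, ZMod.val_zero, Nat.cast_zero, Int.gcd_zero_left, Int.natAbs_natCast]
      exact hp.one_lt.ne'
  · have hco : Int.gcd (x.val : ℤ) p = 1 := by
      rw [Int.gcd_natCast_natCast]
      refine (ZMod.isUnit_iff_coprime _ _).1 ?_
      rw [ZMod.natCast_zmod_val]
      exact isUnit_iff_ne_zero.2 hx
    have h1 : (p : ℤ) ∣ (x.val : ℤ) - 1 ↔ x = 1 := by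
      rw [← ZMod.intCast_zmod_eq_zero_iff_dvd]
      push_cast
      rw [sub_eq_zero, ZMod.natCast_zmod_val]
    rw [artinAMod_eq hco, hp.primeFactors, Finset.prod_singleton, residueWeight, Nat.totient_prime hp,
      Nat.cast_sub hp.one_le, Nat.cast_one, if_neg hx]
    simp only [h1]
    have e1 : (1 : ℝ) - artinWeight a p = (((p : ℝ) - 1) - kummerWeight a p) / ((p : ℝ) - 1) := by
      rw [artinWeight, sub_div, div_self hp1.ne']
    have e2 : ((p : ℝ) - 1) - kummerWeight a p ≠ 0 := by
      intro h
      have := one_sub_artinWeight_pos ha hp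
      rw [e1, h, zero_div] at this
      exact lt_irrefl _ this
    rw [e1]
    split_ifs <;> field_simp <;> ring

theorem sum_relativeWeight_mul {a : ℤ} (ha : a ≠ -1 ∧ ¬ IsSquare a) {p : ℕ} [NeZero p]
    (hp : p.Prime) (w : ZMod p) :
    ∑ x : ZMod p, (relativeWeight a x : ℂ) * ZMod.stdAddChar (w * x) =
      ((((p : ℝ) - 1) - kummerWeight a p)⁻¹ : ℝ) *
        ((if w = 0 then (p : ℂ) else 0) - 1 - (kummerWeight a p : ℂ) * ZMod.stdAddChar w) := by
  have h1 : ∑ x : ZMod p, (ZMod.stdAddChar (w * x) : ℂ) = if w = 0 then (p : ℂ) else 0 := by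
    simp_rw [mul_comm w]
    rw [AddChar.sum_mulShift _ (ZMod.isPrimitive_stdAddChar p), ZMod.card]
    push_cast
    rfl
  simp_rw [relativeWeight_eq ha hp]
  push_cast
  simp_rw [mul_assoc]
  rw [← Finset.mul_sum]
  congr 1
  simp_rw [sub_mul, one_mul, Finset.sum_sub_distrib, h1]
  congr 1
  · congr 1
    rw [Finset.sum_eq_single 0]
    · simp
    · intro x _ hx
      simp [hx]
    · simp
  · rw [Finset.sum_eq_single 1]
    · simp
    · intro x _ hx
      simp [hx]
    · simp

theorem norm_sum_relativeWeight_mul_le {a : ℤ} (ha : a ≠ -1 ∧ ¬ IsSquare a) {p : ℕ} [NeZero p]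
    (hp : p.Prime) (hp4 : 4 ≤ p) {w : ZMod p} (hw : w ≠ 0) :
    ‖∑ x : ZMod p, (relativeWeight a x : ℂ) * ZMod.stdAddChar (w * x)‖ ≤ 4 / p := by
  have h4 : (4 : ℝ) ≤ p := by exact_mod_cast hp4
  have hκ0 := kummerWeight_nonneg a p
  have hκ1 := kummerWeight_le_one a p
  have hα : 0 < ((p : ℝ) - 1) - kummerWeight a p := by linarith
  rw [sum_relativeWeight_mul ha hp, if_neg hw, zero_sub, norm_mul, Complex.norm_real,
    Real.norm_of_nonneg (inv_nonneg.2 hα.le)]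
  have h2 : ‖(-1 : ℂ) - (kummerWeight a p : ℂ) * ZMod.stdAddChar w‖ ≤ 2 := by
    refine (norm_sub_le _ _).trans ?_
    rw [norm_neg, norm_one, norm_mul, AddChar.norm_apply, mul_one, Complex.norm_real,
      Real.norm_of_nonneg hκ0]
    linarith
  refine (mul_le_mul_of_nonneg_left h2 (inv_nonneg.2 hα.le)).trans ?_
  rw [inv_mul_eq_div, div_le_div_iff₀ hα (by linarith)]
  linarith

/-- On the Fourier side the zero frequency contributes exactly 1, and the fewer than p others at
most (4/p)³ each. -/
theorem abs_localDensity_sub_one_le {a : Fin 3 → ℤ} (ha : ∀ i, a i ≠ -1 ∧ ¬ IsSquare (a i)) (n : ℕ)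
    (p : GoodPrime a) (hp4 : 4 ≤ (p : ℕ)) :
    |localDensity a n p - 1| ≤ 64 / ((p : ℕ) : ℝ) ^ 2 := by
  have hp := p.2.1
  have : NeZero (p : ℕ) := ⟨hp.ne_zero⟩
  have : Fact (p : ℕ).Prime := ⟨hp⟩
  have h4 : (4 : ℝ) ≤ (p : ℕ) := by exact_mod_cast hp4
  set F : ZMod (p : ℕ) → ℂ := fun w => ZMod.stdAddChar (-(n : ZMod (p : ℕ)) * w) *
    ∏ i, ∑ x : ZMod (p : ℕ), (relativeWeight (a i) x : ℂ) * ZMod.stdAddChar (w * x) with hF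
  have h1 : ((localDensity a n p : ℝ) : ℂ) = ∑ w, F w := by
    rw [localDensity_goodPrime ha, Complex.ofReal_mul, Complex.ofReal_natCast,
      ← sum_stdAddChar_mul_prod]
  have h0 : F 0 = 1 := by
    simp only [hF, mul_zero, AddChar.map_zero_eq_one, one_mul]
    refine Finset.prod_eq_one fun i _ => ?_
    have h5 := sum_relativeWeight_mul (ha i) hp 0
    simp only [if_true, AddChar.map_zero_eq_one, mul_one] at h5 ⊢
    rw [h5, ← Complex.ofReal_natCast, ← Complex.ofReal_one, ← Complex.ofReal_sub,
      ← Complex.ofReal_sub, ← Complex.ofReal_mul, inv_mul_cancel₀]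
    linarith [kummerWeight_le_one (a i) p]
  have h2 : ((localDensity a n p - 1 : ℝ) : ℂ) = ∑ w ∈ Finset.univ.erase 0, F w := by
    rw [Complex.ofReal_sub, h1, ← Finset.add_sum_erase _ _ (Finset.mem_univ (0 : ZMod (p : ℕ))), h0]
    push_cast
    ring
  rw [← Real.norm_eq_abs, ← Complex.norm_real, h2]
  have h3 : ∀ w ∈ Finset.univ.erase (0 : ZMod (p : ℕ)), ‖F w‖ ≤ (4 / (p : ℕ)) ^ 3 := by
    intro w hw
    rw [hF, norm_mul, AddChar.norm_apply, one_mul, norm_prod]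
    refine (Finset.prod_le_prod (fun _ _ => norm_nonneg _) fun i _ =>
      norm_sum_relativeWeight_mul_le (ha i) hp hp4 (Finset.ne_of_mem_erase hw)).trans ?_
    rw [Finset.prod_const, Finset.card_univ, Fintype.card_fin]
  refine (norm_sum_le_of_le _ h3).trans ?_
  rw [Finset.sum_const, nsmul_eq_mul, Finset.card_erase_of_mem (Finset.mem_univ _),
    Finset.card_univ, ZMod.card]
  have h5 : (((p : ℕ) - 1 : ℕ) : ℝ) ≤ (p : ℕ) := by exact_mod_cast Nat.sub_le _ _
  refine (mul_le_mul_of_nonneg_right h5 (by positivity)).trans (le_of_eq ?_)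
  field_simp
  norm_num

theorem finite_goodPrime_lt (a : Fin 3 → ℤ) (N : ℕ) : {p : GoodPrime a | ¬ N ≤ (p : ℕ)}.Finite := by
  refine Set.Finite.of_finite_image (f := Subtype.val) ?_ Subtype.val_injective.injOn
  refine (Set.finite_lt_nat N).subset ?_
  rintro _ ⟨p, hp, rfl⟩
  exact not_le.1 hp

theorem multipliable_localDensity {a : Fin 3 → ℤ} (ha : ∀ i, a i ≠ -1 ∧ ¬ IsSquare (a i)) (n : ℕ) :
    Multipliable fun p : GoodPrime a => localDensity a n p := by
  have h1 : Summable fun p : GoodPrime a => ‖localDensity a n p - 1‖ := by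
    have h2 : Summable fun p : GoodPrime a => 64 / ((p : ℕ) : ℝ) ^ 2 :=
      (summable_const_div_nat_sq 64).subtype _
    refine Summable.of_norm_bounded_eventually h2 ?_
    rw [Filter.eventually_cofinite]
    refine (finite_goodPrime_lt a 4).subset fun p hp h4 => hp ?_
    rw [norm_norm, Real.norm_eq_abs]
    exact abs_localDensity_sub_one_le ha n p h4
  have h3 := multipliable_one_add_of_summable h1
  simpa using h3

theorem artinFactor_eq {a : Fin 3 → ℤ} (ha : ∀ i, a i ≠ -1 ∧ ¬ IsSquare (a i)) (n : ℕ) :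
    artinFactor a n = ((1 / 2 * densitySum a n (badModulus a) *
      ∏' p : GoodPrime a, localDensity a n p : ℝ) : ℂ) := by
  have h1 := (multipliable_localDensity ha n).hasProd
  have h2 : Filter.Tendsto (fun s : Finset (GoodPrime a) =>
      ((densitySum a n (badModulus a) * ∏ p ∈ s, localDensity a n p : ℝ) : ℂ)) Filter.atTop
      (nhds ((densitySum a n (badModulus a) * ∏' p : GoodPrime a, localDensity a n p : ℝ) : ℂ)) :=
    (Complex.continuous_ofReal.tendsto _).comp (Filter.Tendsto.const_mul _ h1)
  rw [artinFactor_eq_tsum ha, tendsto_nhds_unique (tendsto_prod_localDensity ha n) h2]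
  push_cast
  ring

/-! ### The lower bound -/

/-- All terms are nonnegative and one is nonzero; that one is at least d⁻³. -/
theorem inv_sq_le_mul_weightedCount {d : ℕ} [NeZero d] {f : Fin 3 → ZMod d → ℝ} {n : ZMod d}
    (hf : ∀ i x, f i x = 0 ∨ (d : ℝ)⁻¹ ≤ f i x) (h : d * weightedCount f n ≠ 0) :
    ((d : ℝ) ^ 2)⁻¹ ≤ d * weightedCount f n := by
  have hd : (0 : ℝ) < d := by exact_mod_cast NeZero.pos d
  have hnn : ∀ i x, 0 ≤ f i x := fun i x => by
    rcases hf i x with h | h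
    · exact h.ge
    · exact (inv_pos.2 hd).le.trans h
  have hne : weightedCount f n ≠ 0 := right_ne_zero_of_mul h
  rw [weightedCount] at hne
  obtain ⟨b, hb, hb0⟩ := Finset.exists_ne_zero_of_sum_ne_zero hne
  have h1 : ∏ i, f i (b i) ≤ weightedCount f n :=
    Finset.single_le_sum (f := fun b : Fin 3 → ZMod d => ∏ i, f i (b i))
      (fun b _ => Finset.prod_nonneg fun i _ => hnn i (b i)) hb
  have h2 : ((d : ℝ)⁻¹) ^ 3 ≤ ∏ i, f i (b i) := by
    have : ((d : ℝ)⁻¹) ^ 3 = ∏ _i : Fin 3, (d : ℝ)⁻¹ := by simp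
    rw [this]
    refine Finset.prod_le_prod (fun _ _ => by positivity) fun i _ => ?_
    exact (hf i (b i)).resolve_left (Finset.prod_ne_zero_iff.1 hb0 i (Finset.mem_univ i))
  calc ((d : ℝ) ^ 2)⁻¹ = d * ((d : ℝ)⁻¹) ^ 3 := by field_simp
    _ ≤ d * weightedCount f n := mul_le_mul_of_nonneg_left (h2.trans h1) hd.le

theorem residueWeight_eq_zero_or {a : ℤ} (ha : a ≠ -1 ∧ ¬ IsSquare a) (x : ℤ) {p : ℕ}
    (hp : p.Prime) : residueWeight a x p = 0 ∨ 1 - (p : ℝ)⁻¹ ≤ residueWeight a x p := by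
  have h1 := one_sub_artinWeight_pos ha hp
  have h2 := artinWeight_nonneg a hp
  have hinv : (p : ℝ)⁻¹ ≤ 1 := Nat.cast_inv_le_one p
  have hinv0 : 0 ≤ (p : ℝ)⁻¹ := by positivity
  have key : ∀ y : ℝ, 1 - (p : ℝ)⁻¹ ≤ y → 1 - (p : ℝ)⁻¹ ≤ y / (1 - artinWeight a p) := fun y hy => by
    rw [le_div_iff₀ h1]
    nlinarith
  rw [residueWeight, kummerWeight]
  split_ifs
  · left
    simp
  · exact Or.inr (key _ le_rfl)
  · exact Or.inr (key _ (by linarith))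

/-- Each local factor is 0 or at least 1 - 1/p, and the product of these is φ(d)/d, which cancels
the 1/φ(d). -/
theorem relativeWeight_eq_zero_or {a : ℤ} (ha : a ≠ -1 ∧ ¬ IsSquare a) {d : ℕ} [NeZero d]
    (x : ZMod d) : relativeWeight a x = 0 ∨ (d : ℝ)⁻¹ ≤ relativeWeight a x := by
  have hA := (artinA_pos ha).ne'
  by_cases hco : Int.gcd (x.val : ℤ) d = 1
  · have hφ : (0 : ℝ) < d.totient := by exact_mod_cast Nat.totient_pos.2 (NeZero.pos d)
    have hd : (d : ℝ) ≠ 0 := by exact_mod_cast NeZero.ne d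
    have h1 : relativeWeight a x =
        (d.totient : ℝ)⁻¹ * ∏ p ∈ d.primeFactors, residueWeight a x.val p := by
      rw [relativeWeight, artinAMod_eq hco]
      field_simp
    by_cases h0 : ∃ p ∈ d.primeFactors, residueWeight a x.val p = 0
    · obtain ⟨p, hp, h0⟩ := h0
      left
      rw [h1, Finset.prod_eq_zero hp h0, mul_zero]
    · push Not at h0
      right
      have h2 : ∏ p ∈ d.primeFactors, (1 - (p : ℝ)⁻¹) ≤
          ∏ p ∈ d.primeFactors, residueWeight a x.val p := by
        refine Finset.prod_le_prod (fun p _ => sub_nonneg.2 (Nat.cast_inv_le_one p)) fun p hp => ?_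
        exact (residueWeight_eq_zero_or ha _ (Nat.prime_of_mem_primeFactors hp)).resolve_left
          (h0 p hp)
      rw [← totient_div_eq_prod (NeZero.ne d)] at h2
      rw [h1]
      calc (d : ℝ)⁻¹ = (d.totient : ℝ)⁻¹ * (d.totient / d) := by field_simp
        _ ≤ _ := mul_le_mul_of_nonneg_left h2 (inv_nonneg.2 hφ.le)
  · left
    rw [relativeWeight, artinAMod_eq_zero hco, zero_div]

/-- On units the character factor 1 - χ takes only the values 0, 1 and 2. -/
theorem moreeDelta_div_eq_zero_or {a : ℤ} (ha : a ≠ -1 ∧ ¬ IsSquare a) {d : ℕ} [NeZero d]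
    (hd : IsSaturated a d) (x : ZMod d) :
    moreeDelta a x.val d / artinA a = 0 ∨ (d : ℝ)⁻¹ ≤ moreeDelta a x.val d / artinA a := by
  have h1 : moreeDelta a x.val d / artinA a = relativeWeight a x * (1 - discChar a d x.val) := by
    rw [moreeDelta_of_isSaturated hd, relativeWeight]
    ring
  rw [h1]
  rcases relativeWeight_eq_zero_or ha x with h | h
  · left
    rw [h, zero_mul]
  have hd0 : (0 : ℝ) ≤ (d : ℝ)⁻¹ := by positivity
  by_cases hco : x.val.Coprime d
  · rw [discChar]
    split_ifs with hdvd
    · rcases kronecker_eq_one_or ha (val_ne_zero_of_disc_dvd ha hdvd hco)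
        (hco.coprime_dvd_right hdvd) with hk | hk
      · left
        rw [hk]
        simp
      · right
        rw [hk]
        push_cast
        linarith
    · right
      rwa [sub_zero, mul_one]
  · left
    rw [relativeWeight, artinAMod_eq_zero (by rwa [Int.gcd_natCast_natCast]), zero_div, zero_mul]

theorem inv_sq_le_localDensity {a : Fin 3 → ℤ} (ha : ∀ i, a i ≠ -1 ∧ ¬ IsSquare (a i)) (n : ℕ)
    (p : GoodPrime a) (h : localDensity a n p ≠ 0) :
    (((p : ℕ) : ℝ) ^ 2)⁻¹ ≤ localDensity a n p := by
  have : NeZero (p : ℕ) := ⟨p.2.1.ne_zero⟩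
  rw [localDensity_goodPrime ha] at h ⊢
  exact inv_sq_le_mul_weightedCount (fun i x => relativeWeight_eq_zero_or (ha i) x) h

/-- The estimate 1 - 64/p² serves from 12 on. Below, only the bound p⁻² for a nonzero density is at
hand, and 20000 is large enough that 20000/p² ≥ 121 ≥ p² there. -/
theorem exp_le_localDensity {a : Fin 3 → ℤ} (ha : ∀ i, a i ≠ -1 ∧ ¬ IsSquare (a i)) (n : ℕ)
    (p : GoodPrime a) (h : localDensity a n p ≠ 0) :
    Real.exp (-(20000 / ((p : ℕ) : ℝ) ^ 2)) ≤ localDensity a n p := by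
  have hp0 : (0 : ℝ) < (p : ℕ) := by exact_mod_cast p.2.1.pos
  by_cases h12 : 12 ≤ (p : ℕ)
  · have h12' : (12 : ℝ) ≤ (p : ℕ) := by exact_mod_cast h12
    have h1 := (abs_le.1 (abs_localDensity_sub_one_le ha n p (by omega))).1
    have h2 : 64 / ((p : ℕ) : ℝ) ^ 2 ≤ 1 / 2 := by
      rw [div_le_div_iff₀ (by positivity) (by norm_num)]
      nlinarith
    have h3 : 20000 / ((p : ℕ) : ℝ) ^ 2 = 2 * (10000 / ((p : ℕ) : ℝ) ^ 2) := by ring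
    have h4 : 64 / ((p : ℕ) : ℝ) ^ 2 ≤ 10000 / ((p : ℕ) : ℝ) ^ 2 := by
      gcongr
      norm_num
    calc _ ≤ Real.exp (-(2 * (64 / ((p : ℕ) : ℝ) ^ 2))) := by
          rw [Real.exp_le_exp, neg_le_neg_iff, h3]
          linarith
      _ ≤ 1 - 64 / ((p : ℕ) : ℝ) ^ 2 := exp_neg_two_mul_le (by positivity) h2
      _ ≤ _ := by linarith
  · have h11 : ((p : ℕ) : ℝ) ≤ 11 := by
      exact_mod_cast (show (p : ℕ) ≤ 11 by omega)
    refine le_trans ?_ (inv_sq_le_localDensity ha n p h)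
    rw [Real.exp_neg]
    refine inv_anti₀ (by positivity) ?_
    have h1 : (121 : ℝ) ≤ 20000 / ((p : ℕ) : ℝ) ^ 2 := by
      rw [le_div_iff₀ (by positivity)]
      nlinarith
    have := Real.add_one_le_exp (20000 / ((p : ℕ) : ℝ) ^ 2)
    nlinarith

/-- The absolute constant in the lower bound for the product of the local densities. -/
def densityBound : ℝ := Real.exp (-∑' p : ℕ, 20000 / (p : ℝ) ^ 2)

theorem densityBound_le_tprod {a : Fin 3 → ℤ} (ha : ∀ i, a i ≠ -1 ∧ ¬ IsSquare (a i)) (n : ℕ)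
    (h : ∏' p : GoodPrime a, localDensity a n p ≠ 0) :
    densityBound ≤ ∏' p : GoodPrime a, localDensity a n p := by
  have hs := summable_const_div_nat_sq 20000
  have h0 : ∀ p : GoodPrime a, localDensity a n p ≠ 0 := fun p hp =>
    h (tprod_of_exists_eq_zero ⟨p, hp⟩)
  have h1 : ∑' p : GoodPrime a, 20000 / ((p : ℕ) : ℝ) ^ 2 ≤ ∑' p : ℕ, 20000 / (p : ℝ) ^ 2 :=
    hs.tsum_subtype_le _ {p : ℕ | p.Prime ∧ ¬ p ∣ badModulus a} fun p => by positivity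
  refine le_trans ?_ (exp_neg_tsum_le_of_hasProd (multipliable_localDensity ha n).hasProd
    (hs.subtype _)
    (fun p => div_nonneg (by norm_num) (sq_nonneg _)) fun p => exp_le_localDensity ha n p (h0 p))
  rw [densityBound, Real.exp_le_exp, neg_le_neg_iff]
  exact h1

theorem prod_artinA_div_le_densitySum {a : Fin 3 → ℤ} (ha : ∀ i, a i ≠ -1 ∧ ¬ IsSquare (a i))
    (n : ℕ) (h : densitySum a n (badModulus a) ≠ 0) :
    (∏ i, artinA (a i)) / (badModulus a : ℝ) ^ 2 ≤ densitySum a n (badModulus a) := by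
  have hA : 0 < ∏ i, artinA (a i) := Finset.prod_pos fun i _ => artinA_pos (ha i)
  have hsat : ∀ i, IsSaturated (a i) (badModulus a) :=
    isSaturated_of_badModulus_dvd ha dvd_rfl
  have h1 : densitySum a n (badModulus a) = (∏ i, artinA (a i)) * (badModulus a *
      weightedCount (fun i (x : ZMod (badModulus a)) =>
        moreeDelta (a i) x.val (badModulus a) / artinA (a i)) n) := by
    rw [densitySum, weightedCount, weightedCount]
    simp_rw [Finset.prod_div_distrib]
    rw [← Finset.sum_div]
    field_simp
  rw [h1] at h ⊢
  rw [div_eq_mul_inv]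
  exact mul_le_mul_of_nonneg_left (inv_sq_le_mul_weightedCount
    (fun i x => moreeDelta_div_eq_zero_or (ha i) (hsat i) x) (right_ne_zero_of_mul h)) hA.le

/-- Positivity makes the factor at 𝔇 and the infinite product nonzero, so the gaps at zero apply to
both; the squared discriminants come from 𝔇 ≤ ∏|Δ_{a_i}|. -/
theorem artinFactor_lower_bound {a : Fin 3 → ℤ} (ha : ∀ i, a i ≠ -1 ∧ ¬ IsSquare (a i)) (n : ℕ)
    (h : 0 < (artinFactor a n).re) :
    1 / 2 * artinBound ^ 3 * densityBound * ∏ i, ((Nat.totient (powIndex (a i)) : ℝ) /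
      (|(disc (a i) : ℝ)| ^ 2 * (powIndex (a i) : ℝ))) ≤ (artinFactor a n).re := by
  rw [artinFactor_eq ha, Complex.ofReal_re] at h ⊢
  have hS : densitySum a n (badModulus a) ≠ 0 := fun h0 => by
    rw [h0] at h
    simp at h
  have hP : ∏' p : GoodPrime a, localDensity a n p ≠ 0 := fun h0 => by
    rw [h0] at h
    simp at h
  have hB : 0 < artinBound := artinBound_pos
  have hE : 0 < densityBound := Real.exp_pos _
  have hD : (0 : ℝ) < badModulus a := by exact_mod_cast NeZero.pos (badModulus a)
  have hDle : (badModulus a : ℝ) ≤ ∏ i, |(disc (a i) : ℝ)| := by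
    have h1 : ((∏ i, (disc (a i)).natAbs : ℕ) : ℝ) = ∏ i, |(disc (a i) : ℝ)| := by
      rw [Nat.cast_prod]
      exact Finset.prod_congr rfl fun i _ => by rw [Nat.cast_natAbs, Int.cast_abs]
    rw [← h1]
    exact_mod_cast badModulus_le a
  have hA : artinBound ^ 3 * ∏ i, ((powIndex (a i)).totient / powIndex (a i) : ℝ) ≤
      ∏ i, artinA (a i) := by
    have h1 : artinBound ^ 3 = ∏ _i : Fin 3, artinBound := by simp
    rw [h1, ← Finset.prod_mul_distrib]
    exact Finset.prod_le_prod (fun i _ => by positivity) fun i _ => artinBound_le (ha i)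
  have hA0 : 0 < ∏ i, artinA (a i) := Finset.prod_pos fun i _ => artinA_pos (ha i)
  have hsplit : ∏ i, ((Nat.totient (powIndex (a i)) : ℝ) /
      (|(disc (a i) : ℝ)| ^ 2 * (powIndex (a i) : ℝ))) =
      (∏ i, ((powIndex (a i)).totient / powIndex (a i) : ℝ)) *
        ((∏ i, |(disc (a i) : ℝ)|) ^ 2)⁻¹ := by
    rw [← Finset.prod_pow, ← Finset.prod_inv_distrib, ← Finset.prod_mul_distrib]
    exact Finset.prod_congr rfl fun i _ => by
      rw [div_eq_mul_inv, mul_inv, div_eq_mul_inv]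
      ring
  rw [hsplit]
  calc _ = 1 / 2 * ((artinBound ^ 3 * ∏ i, ((powIndex (a i)).totient / powIndex (a i) : ℝ)) *
        ((∏ i, |(disc (a i) : ℝ)|) ^ 2)⁻¹) * densityBound := by ring
    _ ≤ 1 / 2 * ((∏ i, artinA (a i)) * ((badModulus a : ℝ) ^ 2)⁻¹) * densityBound := by
        gcongr
    _ ≤ 1 / 2 * densitySum a n (badModulus a) * densityBound := by
        gcongr
        exact prod_artinA_div_le_densitySum ha n hS
    _ ≤ _ := by
        have h0 : 0 ≤ densitySum a n (badModulus a) :=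
          le_trans (by positivity) (prod_artinA_div_le_densitySum ha n hS)
        gcongr
        exact densityBound_le_tprod ha n hP

end ArtinGoldbach

end

theorem theorem1p4 :
    (∀ a : Fin 3 → ℤ, (∀ i, a i ≠ -1 ∧ ¬ IsSquare (a i)) → ∀ n : ℕ,
      (∀ k : Fin 3 → ℕ+, (∀ i, Squarefree (k i : ℕ)) →
        Summable fun q : ℕ+ => ‖ArtinGoldbach.singTerm a k n q‖) ∧
      (Summable fun k : Fin 3 → ℕ+ => ‖ArtinGoldbach.factorTerm a n k‖) ∧
      (Multipliable fun p : {p : ℕ // p.Prime ∧ ¬ p ∣ ArtinGoldbach.badModulus a} =>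
        ArtinGoldbach.localDensity a n p) ∧
      ArtinGoldbach.artinFactor a n =
        (((1 / 2) * (∏ i, ArtinGoldbach.artinL (a i)) *
          ArtinGoldbach.localDensity a n (ArtinGoldbach.badModulus a) *
          ∏' p : {p : ℕ // p.Prime ∧ ¬ p ∣ ArtinGoldbach.badModulus a},
            ArtinGoldbach.localDensity a n p : ℝ) : ℂ)) ∧
    ∃ C : ℝ, 0 < C ∧
      ∀ a : Fin 3 → ℤ, (∀ i, a i ≠ -1 ∧ ¬ IsSquare (a i)) → ∀ n : ℕ,
        0 < (ArtinGoldbach.artinFactor a n).re →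
          C * ∏ i, ((Nat.totient (ArtinGoldbach.powIndex (a i)) : ℝ) /
              (|(ArtinGoldbach.disc (a i) : ℝ)| ^ 2 * (ArtinGoldbach.powIndex (a i) : ℝ))) ≤
            (ArtinGoldbach.artinFactor a n).re := by
  refine ⟨fun a ha n => ⟨fun k hk => ArtinGoldbach.summable_norm_singTerm ha hk n,
    ArtinGoldbach.summable_norm_factorTerm ha n, ArtinGoldbach.multipliable_localDensity ha n, ?_⟩,
    1 / 2 * ArtinGoldbach.artinBound ^ 3 * ArtinGoldbach.densityBound, ?_,
    fun a ha n h => ArtinGoldbach.artinFactor_lower_bound ha n h⟩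
  · rw [ArtinGoldbach.artinFactor_eq ha, ArtinGoldbach.densitySum_eq ha]
    congr 1
    ring
  · have h1 := ArtinGoldbach.artinBound_pos
    have h2 : 0 < ArtinGoldbach.densityBound := Real.exp_pos _
    positivity
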